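/- Let $d=n+1$ with $n\ge 0$; indices $\mu,\nu,b$ run over $0,\dots,n$, and $\eta=\mathrm{diag}(1,-1,\dots,-1)$. Let $a\in\mathbb R^d$ have all entries $a_\mu=a^\mu\neq0$, let $0\ne q\in\mathbb R^d$, and let $\Theta=(\Theta_{\mu\nu})$ be a real skew-symmetric $d\times d$ matrix, $(\Theta x)_\mu=\sum_\nu\Theta_{\mu\nu}x^\nu$. All pairings are $xy=\sum_\mu x^\mu y_\mu$, and there is no summation over $\mu$ in $a_\mu(\Theta x)_\mu$. Let $\Omega$ be the unital complex algebra generated by $\hat x^\mu,d\hat x^\mu$ with relations $[\hat x^\mu,\hat x^\nu]=0$ and $[\hat x^\mu,d\hat x^\nu]=i a^\mu\delta^{\mu\nu}d\hat x^\nu$, and let $ds^2=\sum_{\mu,\nu}\eta_{\mu\nu}\,d\hat x^\mu d\hat x^\nu\in\Omega$. Let $Q_\mu$ be multiplication by the $\mu$-th coordinate and $P_\mu=-i\partial_\mu$ on the Schwartz space $\mathscr S(\mathbb R^d)\subset L^2(\mathbb R^d)$, so that $[Q_\mu,P_\nu]=i\delta_{\mu\nu}$, and represent $\Omega$ on $\mathscr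 S(\mathbb R^d)$ by $$\pi(\hat x^\mu)=X^\mu=\tfrac{a^\mu}{2}(Q_\mu P_\mu+P_\mu Q_\mu),\qquad \pi(d\hat x^\mu)=dX^\mu=i\sum_b q_b[P_b,X^\mu].$$ There are a strongly continuous unitary group $U(p)=\exp(i\sum_\mu p_\mu X^\mu)$, $p\in\mathbb R^d$ (with generator $\sum_\mu p_\mu X^\mu$ on $\mathscr S(\mathbb R^d)$ in the direction $p$), and a projection-valued measure $E$ on $\mathbb R^d$ with $U(p)=\int e^{i px}\,dE(x)$. For every such $U$ and $E$ put $f(X)=\int f\,dE$, with its natural domain, and $\alpha_p(A)=U(p)AU(p)^{-1}$. For an operator $A$ on $\mathscr S(\mathbb R^d)$ let the warped convolution be $$A_\Theta\Phi=\int dE(x)\,\alpha_{\Theta x}(A)\Phi ,\qquad\text{or}\qquad A_\Theta\Phi=(2\pi)^{-d}\lim_{\epsilon\downarrow0}\iint dx\,dy\,\chi(\epsilon x,\epsilon y)\,e^{-ixy}\,\alpha_{\Theta x}(A)U(y)\Phi ,$$ defined for those $\Phi\in\mathscr S(\mathbb R^d)$ for which the respective expression converges in norm; the first is the limit of Riemann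 sums over cubes of side $1/N$, $N\to\infty$, for all choices of sample points, and in the second the limit has to exist and be the same for all Gaussian regulators $\chi(x,y)=e^{-s|x|^2-t|y|^2}$, $s,t>0$. Put $$(\eta_{\mu\nu})_\Theta(x)=e^{-2a_\mu(\Theta x)_\mu}\,\eta_{\mu\nu}.$$ For a matrix-valued function $g$ on $\mathbb R^d$, let $\sum_{\mu,\nu}g_{\mu\nu}(X)\,dX^\mu dX^\nu$ have as its domain all $\Phi\in\mathscr S(\mathbb R^d)$ with $dX^\mu dX^\nu\Phi$ in the domain of $g_{\mu\nu}(X)$ for all $\mu,\nu$. Then: 1. The operator $\sum_{\mu,\nu}(\eta_{\mu\nu})_\Theta(X)\,dX^\mu dX^\nu$ is densely defined in $L^2(\mathbb R^d)$. 2. With either form of the warped convolution, the deformed line-element $(ds^2)_\Theta=\sum_{\mu,\nu}\eta_{\mu\nu}(dX^\mu dX^\nu)_\Theta$ (sum over the terms with $\eta_{\mu\nu}\ne0$) satisfies $$(ds^2)_\Theta=\sum_{\mu,\nu}(\eta_{\mu\nu})_\Theta(X)\,dX^\mu dX^\nu$$ as an equality of operators, domains included. That is, $(ds^2)_\Theta=(\eta_{\mu\nu})_\Theta(\hat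 x)\,d\hat x^\mu d\hat x^\nu$ in the representation $\pi$. 3. On the domain of the right-hand side, both forms of $\big(\pi(ds^2)\big)_\Theta$ exist as well and have the same value. 4. In the sense of matrix elements the formula holds on all of $\mathscr S(\mathbb R^d)$: if $\Phi\in\mathscr S(\mathbb R^d)$ and $\Psi\in L^2(\mathbb R^d)$ lies in the domain of $(\eta_{\mu\nu})_\Theta(X)$ for all $\mu,\nu$, then for all Gaussian regulators as above $$(2\pi)^{-d}\lim_{\epsilon\downarrow0}\iint dx\,dy\,\chi(\epsilon x,\epsilon y)\,e^{-ixy}\,\langle\Psi,\alpha_{\Theta x}(\pi(ds^2))U(y)\Phi\rangle=\sum_{\mu,\nu}\langle(\eta_{\mu\nu})_\Theta(X)\Psi,\,dX^\mu dX^\nu\Phi\rangle .$$ 5. If $q_\mu\ne0$ for all $\mu$, the metric is determined by the line-element: $\eta_\Theta$ is the only continuous function $g$ with values in the symmetric real matrices for which $\sum_{\mu,\nu}g_{\mu\nu}(X)\,dX^\mu dX^\nu$ is the operator in 2, domains included. -/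

import Mathlib

open MeasureTheory Filter Topology
open scoped InnerProductSpace Matrix SchwartzMap LineDeriv

noncomputable section

namespace WarpedMetric

/-! ### Hilbert space, Schwartz space and Schrödinger representation

Space-time has dimension `d = n + 1`; the indices `0, …, n` are `Fin (n + 1)` and `0` is time. -/

/-- Points of `ℝ^d`, `d = n + 1`. -/
abbrev Pt (n : ℕ) : Type := Fin (n + 1) → ℝ

/-- The Hilbert space `L²(ℝ^d)` for Lebesgue measure. -/
abbrev Hilb (n : ℕ) : Type := Lp ℂ 2 (volume : Measure (Pt n))

/-- The Schwartz space `𝒮(ℝ^d)`. -/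
abbrev Sch (n : ℕ) : Type := 𝓢(Pt n, ℂ)

/-- Linear operators with stable domain `𝒮(ℝ^d)`. -/
abbrev SchOp (n : ℕ) : Type := Module.End ℂ (Sch n)

/-- The inclusion `𝒮(ℝ^d) ⊆ L²(ℝ^d)`. -/
def toHilb {n : ℕ} : Sch n →L[ℂ] Hilb n := SchwartzMap.toLpCLM ℂ ℂ 2 volume

/-- `Q_b`: multiplication by the `b`-th coordinate. -/
def posOp {n : ℕ} (b : Fin (n + 1)) : SchOp n :=
  (SchwartzMap.smulLeftCLM ℂ (fun x : Pt n => (x b : ℂ))).toLinearMap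

/-- `P_b = -i ∂_b`; this is the sign for which `[Q_b, P_c] = i δ_{bc}`. -/
def momOp {n : ℕ} (b : Fin (n + 1)) : SchOp n :=
  (-Complex.I) • (LineDeriv.lineDerivOpCLM ℂ (Sch n) (Pi.single b 1 : Pt n)).toLinearMap

theorem coord_temperate {n : ℕ} (b : Fin (n + 1)) :
    (fun x : Pt n => (x b : ℂ)).HasTemperateGrowth := by
  exact (Complex.ofRealCLM.comp (ContinuousLinearMap.proj (R := ℝ) (φ := fun _ : Fin (n+1) => ℝ) b)).hasTemperateGrowth

theorem posOp_apply {n : ℕ} (b : Fin (n + 1)) (f : Sch n) (x : Pt n) :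
    posOp b f x = (x b : ℂ) * f x := by
  simp [posOp, SchwartzMap.smulLeftCLM_apply_apply (coord_temperate b)]

theorem momOp_apply {n : ℕ} (b : Fin (n + 1)) (f : Sch n) (x : Pt n) :
    momOp b f x = -Complex.I * fderiv ℝ f x (Pi.single b 1) := by
  rfl

theorem posOp_comm {n : ℕ} (b c : Fin (n + 1)) : Commute (posOp (n := n) b) (posOp c) := by
  ext f x
  simp only [Module.End.mul_apply, posOp_apply]
  ring

theorem momOp_comm {n : ℕ} (b c : Fin (n + 1)) : Commute (momOp (n := n) b) (momOp c) := by
  ext f x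
  have key : ∀ u v : Pt n, fderiv ℝ (fun y => fderiv ℝ f y u) x v
      = fderiv ℝ (fderiv ℝ f) x v u := by
    intro u v
    have h : DifferentiableAt ℝ (fderiv ℝ f) x :=
      ((f.smooth 2).fderiv_right (m := 1) (by norm_num)).differentiable (by norm_num) x
    rw [fderiv_clm_apply h (differentiableAt_const u)]
    simp
  have hs := (ContDiffAt.isSymmSndFDerivAt (𝕜 := ℝ) (n := 2) ((f.smooth 2).contDiffAt (x := x))
    (by simp)).eq
  have e : ∀ b c : Fin (n + 1), (momOp b (momOp c f)) x
      = -Complex.I * (-Complex.I * fderiv ℝ (fderiv ℝ f) x (Pi.single b 1) (Pi.single c 1)) := by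
    intro b c
    rw [momOp_apply]
    congr 1
    rw [← key]
    have : (⇑(momOp c f) : Pt n → ℂ) = fun y => (-Complex.I) • fderiv ℝ f y (Pi.single c 1) := by
      funext y
      rfl
    rw [this, fderiv_fun_const_smul]
    · rfl
    · have h : DifferentiableAt ℝ (fderiv ℝ f) x :=
        ((f.smooth 2).fderiv_right (m := 1) (by norm_num)).differentiable (by norm_num) x
      exact h.clm_apply (differentiableAt_const _)
  simp only [Module.End.mul_apply, e]
  rw [hs]

/-- Canonical commutation relations `[Q_b, P_c] = i δ_{bc}`. -/
theorem ccr {n : ℕ} (b c : Fin (n + 1)) :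
    posOp (n := n) b * momOp c - momOp c * posOp b
      = (if b = c then Complex.I else 0) • (1 : SchOp n) := by
  ext f x
  have h1 : (⇑(posOp b f) : Pt n → ℂ) = fun y => (y b : ℂ) * f y := by
    funext y
    exact posOp_apply b f y
  have h2 : HasFDerivAt (fun y : Pt n => (y b : ℂ))
      (Complex.ofRealCLM.comp (ContinuousLinearMap.proj (R := ℝ) (φ := fun _ : Fin (n+1) => ℝ) b)) x :=
    (Complex.ofRealCLM.comp (ContinuousLinearMap.proj (R := ℝ) (φ := fun _ : Fin (n+1) => ℝ) b)).hasFDerivAt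
  have h3 := (h2.mul f.differentiableAt.hasFDerivAt).fderiv
  have h4 : (momOp c (posOp b f)) x = -Complex.I *
      ((x b : ℂ) * fderiv ℝ f x (Pi.single c 1) + f x * (if b = c then 1 else 0)) := by
    rw [momOp_apply, h1]
    erw [h3]
    by_cases h : b = c
    · subst h; simp
    · simp [h]
  simp only [LinearMap.sub_apply, Module.End.mul_apply, LinearMap.smul_apply,
    Module.End.one_apply]
  change posOp b (momOp c f) x - (momOp c (posOp b f)) x = (if b = c then Complex.I else 0) * f x
  rw [h4, posOp_apply, momOp_apply]
  split_ifs <;> ring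

/-- The dilation operator `X^μ = (a^μ / 2) (Q_μ P_μ + P_μ Q_μ)`. -/
def coordOp {n : ℕ} (a : Pt n) (μ : Fin (n + 1)) : SchOp n :=
  ((a μ : ℂ) / 2) • (posOp μ * momOp μ + momOp μ * posOp μ)

/-- `dX^μ = i ∑_b q_b [P_b, X^μ]`. -/
def diffOp {n : ℕ} (a q : Pt n) (μ : Fin (n + 1)) : SchOp n :=
  Complex.I • ∑ b, (q b : ℂ) • (momOp b * coordOp a μ - coordOp a μ * momOp b)

theorem coordOp_comm {n : ℕ} (a : Pt n) (μ ν : Fin (n + 1)) :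
    Commute (coordOp a μ) (coordOp a ν) := by
  by_cases h : μ = ν
  · rw [h]
  have qp : ∀ {b c : Fin (n + 1)}, b ≠ c → Commute (posOp (n := n) b) (momOp c) := by
    intro b c hbc
    have := ccr (n := n) b c
    rw [if_neg hbc, zero_smul, sub_eq_zero] at this
    exact this
  have h1 := qp h
  have h2 := (qp (Ne.symm h)).symm
  have hq := posOp_comm (n := n) μ ν
  have hp := momOp_comm (n := n) μ ν
  have hA : Commute (posOp (n := n) μ) (coordOp a ν) :=
    (((hq.mul_right h1).add_right (h1.mul_right hq))).smul_right _
  have hB : Commute (momOp (n := n) μ) (coordOp a ν) :=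
    (((h2.mul_right hp).add_right (hp.mul_right h2))).smul_right _
  exact (((hA.mul_left hB).add_left (hB.mul_left hA))).smul_left _

theorem coordOp_momOp {n : ℕ} (a : Pt n) (μ b : Fin (n + 1)) :
    coordOp a μ * momOp b - momOp b * coordOp a μ
      = (if μ = b then Complex.I * a μ else 0) • momOp b := by
  have h := eq_add_of_sub_eq (ccr (n := n) μ b)
  have hp := (momOp_comm (n := n) μ b).eq
  have e1 : posOp μ * momOp μ * momOp b = (if μ = b then Complex.I else 0) • momOp (n := n) μ
      + momOp b * (posOp μ * momOp μ) := by
    rw [mul_assoc, hp, ← mul_assoc, h, add_mul, smul_mul_assoc, one_mul, mul_assoc]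
  have e2 : momOp μ * posOp μ * momOp b = (if μ = b then Complex.I else 0) • momOp (n := n) μ
      + momOp b * (momOp μ * posOp μ) := by
    rw [mul_assoc, h, mul_add, mul_smul_comm, mul_one, ← mul_assoc, hp, mul_assoc]
  rw [coordOp, smul_mul_assoc, add_mul, e1, e2, mul_smul_comm, mul_add, ← smul_sub]
  by_cases hb : μ = b
  · subst hb
    simp only [if_true]
    module
  · simp [hb]

theorem diffOp_eq {n : ℕ} (a q : Pt n) (μ : Fin (n + 1)) :
    diffOp a q μ = ((q μ * a μ : ℝ) : ℂ) • momOp μ := by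
  have : ∀ b, momOp b * coordOp a μ - coordOp a μ * momOp b
      = -((if μ = b then Complex.I * a μ else 0) • momOp (n := n) b) := by
    intro b
    rw [← coordOp_momOp, neg_sub]
  simp only [diffOp, this]
  simp only [ite_smul, zero_smul, smul_neg, smul_ite, smul_zero, Finset.sum_neg_distrib,
    Finset.sum_ite_eq, Finset.mem_univ, if_true, smul_smul]
  rw [← neg_smul]
  congr 1
  push_cast
  linear_combination (-(q μ : ℂ) * a μ) * Complex.I_mul_I

theorem coordOp_diffOp {n : ℕ} (a q : Pt n) (μ ν : Fin (n + 1)) :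
    coordOp a μ * diffOp a q ν - diffOp a q ν * coordOp a μ
      = (if μ = ν then Complex.I * a μ else 0) • diffOp a q ν := by
  rw [diffOp_eq, mul_smul_comm, smul_mul_assoc, ← smul_sub, coordOp_momOp, smul_comm]

/-! ### The differential algebra and its representation -/

/-- Generators: coordinates and their differentials. -/
inductive Gen (n : ℕ) : Type
  | x (μ : Fin (n + 1)) : Gen n
  | dx (μ : Fin (n + 1)) : Gen n

/-- The relations `[x^μ, x^ν] = 0` and `[x^μ, dx^ν] = i a^μ δ^{μν} dx^ν`. -/
inductive DiffRel {n : ℕ} (a : Pt n) : FreeAlgebra ℂ (Gen n) → FreeAlgebra ℂ (Gen n) → Prop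
  | coord (μ ν : Fin (n + 1)) : DiffRel a
      (FreeAlgebra.ι ℂ (Gen.x μ) * FreeAlgebra.ι ℂ (Gen.x ν)
        - FreeAlgebra.ι ℂ (Gen.x ν) * FreeAlgebra.ι ℂ (Gen.x μ)) 0
  | diff (μ ν : Fin (n + 1)) : DiffRel a
      (FreeAlgebra.ι ℂ (Gen.x μ) * FreeAlgebra.ι ℂ (Gen.dx ν)
        - FreeAlgebra.ι ℂ (Gen.dx ν) * FreeAlgebra.ι ℂ (Gen.x μ))
      ((if μ = ν then Complex.I * a μ else 0) • FreeAlgebra.ι ℂ (Gen.dx ν))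

/-- The differential algebra: the unital algebra generated by the `x^μ` and `dx^μ` subject to
the relations above. -/
abbrev DiffAlg {n : ℕ} (a : Pt n) : Type := RingQuot (DiffRel a)

/-- The differential `dx^μ`. -/
def dx {n : ℕ} (a : Pt n) (μ : Fin (n + 1)) : DiffAlg a :=
  RingQuot.mkAlgHom ℂ (DiffRel a) (FreeAlgebra.ι ℂ (Gen.dx μ))

/-- The images of the generators. -/
def genOp {n : ℕ} (a q : Pt n) : Gen n → SchOp n
  | Gen.x μ => coordOp a μ
  | Gen.dx μ => diffOp a q μ

theorem genOp_rel {n : ℕ} (a q : Pt n) ⦃u v : FreeAlgebra ℂ (Gen n)⦄ (h : DiffRel a u v) :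
    FreeAlgebra.lift ℂ (genOp a q) u = FreeAlgebra.lift ℂ (genOp a q) v := by
  cases h with
  | coord μ ν =>
    simp only [map_sub, map_mul, FreeAlgebra.lift_ι_apply, map_zero, genOp]
    exact sub_eq_zero.2 (coordOp_comm a μ ν)
  | diff μ ν =>
    simp only [map_sub, map_mul, FreeAlgebra.lift_ι_apply, map_smul, genOp]
    exact coordOp_diffOp a q μ ν

/-- The representation `π` on the Schwartz space, `π(x^μ) = X^μ`, `π(dx^μ) = dX^μ`. -/
def rep {n : ℕ} (a q : Pt n) : DiffAlg a →ₐ[ℂ] SchOp n :=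
  RingQuot.liftAlgHom ℂ ⟨FreeAlgebra.lift ℂ (genOp a q), genOp_rel a q⟩

/-- The Minkowski metric `diag(1, -1, …, -1)`. -/
def eta (n : ℕ) : Matrix (Fin (n + 1)) (Fin (n + 1)) ℝ :=
  Matrix.diagonal fun μ => if μ = 0 then 1 else -1

/-- The flat line-element `ds² = η_{μν} dx^μ dx^ν`. -/
def lineElement {n : ℕ} (a : Pt n) : DiffAlg a :=
  ∑ μ, ∑ ν, (eta n μ ν : ℂ) • (dx a μ * dx a ν)

/-! ### The unitary group, projection-valued measures and functional calculus -/

/-- `U(p) = exp(i ∑_μ p_μ X^μ)`: a strongly continuous unitary representation of `ℝ^d` whose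
generator in the direction `p` is `∑_μ p_μ X^μ` on the Schwartz space. -/
structure IsExpGroup {n : ℕ} (X : Fin (n + 1) → SchOp n)
    (U : Pt n → (Hilb n ≃ₗᵢ[ℂ] Hilb n)) : Prop where
  map_add : ∀ p r ψ, U (p + r) ψ = U p (U r ψ)
  continuous : ∀ ψ, Continuous fun p => U p ψ
  generator : ∀ (p : Pt n) (Φ : Sch n),
    HasDerivAt (fun t : ℝ => U (t • p) (toHilb Φ))
      (toHilb (Complex.I • ∑ μ, (p μ : ℂ) • X μ Φ)) 0

/-- Projection-valued Borel measures on `ℝ^d`. -/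
structure PVM (n : ℕ) where
  proj : Set (Pt n) → (Hilb n →L[ℂ] Hilb n)
  selfAdjoint : ∀ B, MeasurableSet B → IsSelfAdjoint (proj B)
  univ : proj Set.univ = 1
  inter : ∀ B C, MeasurableSet B → MeasurableSet C → proj (B ∩ C) = proj B * proj C
  iUnion : ∀ (B : ℕ → Set (Pt n)), (∀ i, MeasurableSet (B i)) →
    Pairwise (Function.onFun Disjoint B) → ∀ ψ,
      HasSum (fun i => proj (B i) ψ) (proj (⋃ i, B i) ψ)

theorem PVM.empty {n : ℕ} (E : PVM n) (ψ : Hilb n) : E.proj ∅ ψ = 0 := by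
  have h := E.iUnion (fun _ => ∅) (fun _ => MeasurableSet.empty)
    (fun i j _ => by simp [Function.onFun]) ψ
  exact tendsto_nhds_unique tendsto_const_nhds h.summable.tendsto_atTop_zero

theorem PVM.inner_eq {n : ℕ} (E : PVM n) {B : Set (Pt n)} (hB : MeasurableSet B) (ψ : Hilb n) :
    ‖E.proj B ψ‖ ^ 2 = (⟪ψ, E.proj B ψ⟫_ℂ).re := by
  have h1 : E.proj B (E.proj B ψ) = E.proj B ψ := by
    have := E.inter B B hB hB
    rw [Set.inter_self] at this
    exact (congrArg (fun T : Hilb n →L[ℂ] Hilb n => T ψ) this).symm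
  have h2 := (E.selfAdjoint B hB).isSymmetric ψ (E.proj B ψ)
  simp only [ContinuousLinearMap.coe_coe] at h2
  rw [h1] at h2
  rw [← h2, ← inner_self_eq_norm_sq (𝕜 := ℂ)]
  rfl

/-- The spectral measure `B ↦ ‖E(B)ψ‖² = ⟨ψ, E(B)ψ⟩`. -/
def PVM.measure {n : ℕ} (E : PVM n) (ψ : Hilb n) : Measure (Pt n) :=
  Measure.ofMeasurable (fun B _ => ENNReal.ofReal (‖E.proj B ψ‖ ^ 2))
    (by simp [E.empty])
    (by
      intro B hB hd
      have h := ((E.iUnion B hB hd ψ).mapL (innerSL ℂ ψ)).mapL Complex.reCLM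
      simp only [innerSL_apply_apply, Complex.reCLM_apply] at h
      simp only [← E.inner_eq (hB _), ← E.inner_eq (MeasurableSet.iUnion hB)] at h
      rw [← h.tsum_eq]
      exact ENNReal.ofReal_tsum_of_nonneg (fun i => by positivity) h.summable)

/-- `E` is the spectral resolution of `U`: `U(p) = ∫ exp(i ∑_μ p_μ x^μ) dE(x)` (by polarization
it suffices to say this for diagonal matrix elements). -/
def IsSpectralResolution {n : ℕ} (U : Pt n → (Hilb n ≃ₗᵢ[ℂ] Hilb n)) (E : PVM n) : Prop :=
  ∀ p ψ, ⟪ψ, U p ψ⟫_ℂ = ∫ x, Complex.exp (Complex.I * ((p ⬝ᵥ x : ℝ) : ℂ)) ∂(E.measure ψ)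

/-- `∫ s dE` applied to `ψ`, for a simple function `s`. -/
def PVM.simpleIntegral {n : ℕ} (E : PVM n) (s : SimpleFunc (Pt n) ℂ) (ψ : Hilb n) : Hilb n :=
  ∑ c ∈ s.range, c • E.proj (s ⁻¹' {c}) ψ

/-- Functional calculus for a (generally unbounded) function `f`: the vector `ψ` lies in the
domain of `f(X) = ∫ f dE`, which is `{ψ | ∫ |f|² d‖Eψ‖² < ∞}`, and `f(X) ψ = v`. -/
def PVM.HasApply {n : ℕ} (E : PVM n) (f : Pt n → ℂ) (ψ v : Hilb n) : Prop :=
  ∃ s : ℕ → SimpleFunc (Pt n) ℂ,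
    Tendsto (fun k => ∫⁻ x, ‖s k x - f x‖ₑ ^ 2 ∂(E.measure ψ)) atTop (𝓝 0) ∧
    Tendsto (fun k => E.simpleIntegral (s k) ψ) atTop (𝓝 v)

/-- The cube `∏_i [k_i / (N + 1), (k_i + 1) / (N + 1))`. -/
def cube {n : ℕ} (N : ℕ) (k : Fin (n + 1) → ℤ) : Set (Pt n) :=
  {x | ∀ i, (k i : ℝ) / (N + 1) ≤ x i ∧ x i < ((k i : ℝ) + 1) / (N + 1)}

/-- The operator integral `∫ dE(x) F(x) = v` of a vector-valued function: for every choice of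
sample points, the Riemann sums `∑_k E(C_k) F(τ_k)` over the cubes `C_k` of side `1 / (N + 1)`
converge, and tend to `v` as `N → ∞`. -/
def PVM.HasIntegral {n : ℕ} (E : PVM n) (F : Pt n → Hilb n) (v : Hilb n) : Prop :=
  ∀ τ : ℕ → (Fin (n + 1) → ℤ) → Pt n, (∀ N k, τ N k ∈ cube N k) →
    ∃ S : ℕ → Hilb n,
      (∀ N, HasSum (fun k => E.proj (cube N k) (F (τ N k))) (S N)) ∧ Tendsto S atTop (𝓝 v)

/-! ### Warped convolution -/

/-- `α_p(A) ψ = v`, where `α_p(A) = U(p) A U(p)⁻¹` has the domain `U(p) 𝒮(ℝ^d)`. -/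
def ConjApply {n : ℕ} (U : Pt n → (Hilb n ≃ₗᵢ[ℂ] Hilb n)) (p : Pt n) (A : SchOp n)
    (ψ v : Hilb n) : Prop :=
  ∃ Φ : Sch n, toHilb Φ = (U p).symm ψ ∧ v = U p (toHilb (A Φ))

/-- `A_Θ Φ = v`, where `A_Θ = ∫ dE(x) α_{Θx}(A)`. -/
def HasWarped {n : ℕ} (U : Pt n → (Hilb n ≃ₗᵢ[ℂ] Hilb n)) (E : PVM n)
    (Θ : Matrix (Fin (n + 1)) (Fin (n + 1)) ℝ) (A : SchOp n) (Φ : Sch n) (v : Hilb n) : Prop :=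
  ∃ F : Pt n → Hilb n, (∀ x, ConjApply U (Θ *ᵥ x) A (toHilb Φ) (F x)) ∧ E.HasIntegral F v

/-- The factor `χ(εx, εy) exp(-i ∑_μ x^μ y_μ)` for the Gaussian regulator
`χ(x, y) = exp(-s|x|² - t|y|²)`. -/
def oscKernel {n : ℕ} (s t ε : ℝ) (x y : Pt n) : ℂ :=
  Complex.exp (-((s * ((ε • x) ⬝ᵥ (ε • x)) + t * ((ε • y) ⬝ᵥ (ε • y)) : ℝ) : ℂ)
    - Complex.I * ((x ⬝ᵥ y : ℝ) : ℂ))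

/-- `A_Θ Φ = v`, where `A_Θ` is the oscillatory integral
`(2π)^{-d} lim_{ε → 0} ∬ dx dy χ(εx, εy) e^{-ixy} α_{Θx}(A) U(y)`, for every Gaussian regulator. -/
def HasOscWarped {n : ℕ} (U : Pt n → (Hilb n ≃ₗᵢ[ℂ] Hilb n))
    (Θ : Matrix (Fin (n + 1)) (Fin (n + 1)) ℝ) (A : SchOp n) (Φ : Sch n) (v : Hilb n) : Prop :=
  ∃ F : Pt n → Pt n → Hilb n,
    (∀ x y, ConjApply U (Θ *ᵥ x) A (U y (toHilb Φ)) (F x y)) ∧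
    ∀ s t : ℝ, 0 < s → 0 < t →
      (∀ ε : ℝ, 0 < ε → Integrable (fun z : Pt n × Pt n => oscKernel s t ε z.1 z.2 • F z.1 z.2)) ∧
      Tendsto (fun ε : ℝ => (((2 * Real.pi) ^ (n + 1))⁻¹ : ℝ) •
          ∫ z : Pt n × Pt n, oscKernel s t ε z.1 z.2 • F z.1 z.2) (𝓝[>] 0) (𝓝 v)

/-- The oscillatory integral in the sense of matrix elements: `⟨Ψ, A_Θ Φ⟩ = c`. -/
def HasOscWarpedElement {n : ℕ} (U : Pt n → (Hilb n ≃ₗᵢ[ℂ] Hilb n))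
    (Θ : Matrix (Fin (n + 1)) (Fin (n + 1)) ℝ) (A : SchOp n) (Ψ : Hilb n) (Φ : Sch n)
    (c : ℂ) : Prop :=
  ∃ F : Pt n → Pt n → Hilb n,
    (∀ x y, ConjApply U (Θ *ᵥ x) A (U y (toHilb Φ)) (F x y)) ∧
    ∀ s t : ℝ, 0 < s → 0 < t →
      (∀ ε : ℝ, 0 < ε →
        Integrable (fun z : Pt n × Pt n => oscKernel s t ε z.1 z.2 * ⟪Ψ, F z.1 z.2⟫_ℂ)) ∧
      Tendsto (fun ε : ℝ => ((((2 * Real.pi) ^ (n + 1))⁻¹ : ℝ) : ℂ) *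
          ∫ z : Pt n × Pt n, oscKernel s t ε z.1 z.2 * ⟪Ψ, F z.1 z.2⟫_ℂ) (𝓝[>] 0) (𝓝 c)

/-! ### Line-elements -/

/-- The deformed line-element, deforming the differentials and leaving the constants alone:
`(ds²)_Θ Φ = v`, where `(ds²)_Θ = η_{μν} (π(dx^μ) π(dx^ν))_Θ` and only terms with `η_{μν} ≠ 0`
occur. `W A Φ v` stands for `A_Θ Φ = v`. -/
def HasDeformedLineElement {n : ℕ} (a q : Pt n) (W : SchOp n → Sch n → Hilb n → Prop)
    (Φ : Sch n) (v : Hilb n) : Prop :=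
  ∃ w : Fin (n + 1) → Fin (n + 1) → Hilb n,
    (∀ μ ν, eta n μ ν ≠ 0 → W (rep a q (dx a μ) * rep a q (dx a ν)) Φ (w μ ν)) ∧
    v = ∑ μ, ∑ ν, (eta n μ ν : ℂ) • w μ ν

/-- The line-element `g_{μν}(x) dx^μ dx^ν` of a coordinate-dependent metric `g` in the
representation: `(∑_{μν} g_{μν}(X) π(dx^μ) π(dx^ν)) Φ = v`, with the natural domain. -/
def HasLineElement {n : ℕ} (a q : Pt n) (E : PVM n)
    (g : Pt n → Matrix (Fin (n + 1)) (Fin (n + 1)) ℝ) (Φ : Sch n) (v : Hilb n) : Prop :=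
  ∃ w : Fin (n + 1) → Fin (n + 1) → Hilb n,
    (∀ μ ν, E.HasApply (fun x => (g x μ ν : ℂ))
      (toHilb (rep a q (dx a μ) (rep a q (dx a ν) Φ))) (w μ ν)) ∧
    v = ∑ μ, ∑ ν, w μ ν

/-- The metric `(η_{μν})_Θ(x) = exp(-2 a_μ (Θx)_μ) η_{μν}`. -/
def deformedMetric {n : ℕ} (a : Pt n) (Θ : Matrix (Fin (n + 1)) (Fin (n + 1)) ℝ) (x : Pt n) :
    Matrix (Fin (n + 1)) (Fin (n + 1)) ℝ :=
  Matrix.of fun μ ν => Real.exp (-2 * a μ * (Θ *ᵥ x) μ) * eta n μ ν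

end WarpedMetric

end

noncomputable section

namespace WarpedMetric

/-! ### Functional calculus of a projection-valued measure -/

section Calculus

variable {n : ℕ}

open scoped ENNReal

/-! The operators X^μ generate dilations: on Schwartz functions U(p)Φ(x) = exp(a·p/2) Φ(exp(a_μ p_μ)
x_μ), since both groups have the same generator (`IsExpGroup.apply_toHilb`). The differentials are
dX^μ = q_μ a_μ P_μ, and a derivative picks up the factor exp(a_μ p_μ) when it passes a dilation
(`momOp_dilSch`). So conjugation by the group only multiplies second derivatives by numbers. For A =
dX^μ dX^μ, and only these occur because η is diagonal, α_{Θx}(A) U(y)Φ = exp(w·x + b·y) U(y)AΦ with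
w·x = -2 a_μ (Θx)_μ and b·y = 2 a_μ y_μ. Warping A is thereby reduced to the spectral calculus of
one scalar exponential at the single vector AΦ.

That calculus rests on the isometry f ↦ f(X)ψ from L²(‖E(·)ψ‖²) into the Hilbert space, so that
domains become square integrability and limits become dominated convergence. For the Riemann sums,
an exponential varies on a cube by a bounded factor; each sum is the integral of a step function
that lies in L² exactly when the exponential does (`PVM.hasIntegral_expFun_iff`). For the
oscillatory integral, the Gaussian integral over x and y is explicit and gives a bounded function of
X, `weylSymbol`. Skew-symmetry gives w·b = 0, so no phase is left and the symbol tends to exp(w·z)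
(`integral_gaussKernel`). A bound uniform in the regulator gives convergence on the domain, and
Fatou's lemma shows that convergence forces membership in the domain. For matrix elements the
bounded symbol is moved to the other vector, where only the sign of b changes.

The domain is dense because averaging a Schwartz function over the dilations with a Gaussian weight
stays in the Schwartz space and multiplies AΦ by a function of X that decays like a Gaussian, which
every exponential tolerates (`memLp_expFun_smoothSeq`).

For uniqueness, replacing Φ by its dilates turns equality of two line-elements into the vanishing of
a quadratic form in the scaling factors, so the coefficients vanish one by one
(`integ_sub_eq_zero`). On the open set where two entries differ, the spectral projection then kills
all second derivatives. These span a dense subspace, because translates of a Schwartz function tend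
weakly to zero, so the projection is zero. Finally E has full support: multiplying a bump by
products of powers x_i^{i r_i} translates its spectral measure arbitrarily
(`eq_empty_of_proj_eq_zero`).

Existence of U and E is explicit as well. Logarithmic coordinates in each orthant turn dilations
into translations, which the Fourier transform diagonalizes; the spectral projections are pulled
back along the resulting isometry. -/

theorem PVM.measure_apply (E : PVM n) (ψ : Hilb n) {B : Set (Pt n)} (hB : MeasurableSet B) :
    E.measure ψ B = ‖E.proj B ψ‖ₑ ^ 2 := by
  rw [PVM.measure, Measure.ofMeasurable_apply B hB, ENNReal.ofReal_pow (norm_nonneg _),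
    ofReal_norm]

theorem PVM.measure_univ (E : PVM n) (ψ : Hilb n) : E.measure ψ Set.univ = ‖ψ‖ₑ ^ 2 := by
  rw [E.measure_apply ψ MeasurableSet.univ, E.univ]
  rfl

instance (E : PVM n) (ψ : Hilb n) : IsFiniteMeasure (E.measure ψ) :=
  ⟨by rw [E.measure_univ]; exact ENNReal.pow_lt_top enorm_lt_top⟩

theorem PVM.measure_real_apply (E : PVM n) (ψ : Hilb n) {B : Set (Pt n)} (hB : MeasurableSet B) :
    (E.measure ψ).real B = ‖E.proj B ψ‖ ^ 2 := by
  rw [Measure.real, E.measure_apply ψ hB]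
  simp

theorem PVM.proj_proj (E : PVM n) {B C : Set (Pt n)} (hB : MeasurableSet B) (hC : MeasurableSet C)
    (ψ : Hilb n) : E.proj B (E.proj C ψ) = E.proj (B ∩ C) ψ := by
  rw [E.inter B C hB hC]
  rfl

theorem PVM.inner_proj (E : PVM n) {B C : Set (Pt n)} (hB : MeasurableSet B)
    (hC : MeasurableSet C) (φ ψ : Hilb n) :
    ⟪E.proj B φ, E.proj C ψ⟫_ℂ = ⟪φ, E.proj (B ∩ C) ψ⟫_ℂ := by
  have h := (E.selfAdjoint B hB).isSymmetric φ (E.proj C ψ)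
  simp only [ContinuousLinearMap.coe_coe] at h
  rw [h, E.proj_proj hB hC]

theorem PVM.inner_proj_self (E : PVM n) {B : Set (Pt n)} (hB : MeasurableSet B) (ψ : Hilb n) :
    ⟪ψ, E.proj B ψ⟫_ℂ = ((E.measure ψ).real B : ℂ) := by
  have h := E.inner_proj hB hB ψ ψ
  rw [Set.inter_self] at h
  rw [← h, inner_self_eq_norm_sq_to_K, E.measure_real_apply ψ hB]
  simp

theorem PVM.proj_union (E : PVM n) {B C : Set (Pt n)} (hB : MeasurableSet B)
    (hC : MeasurableSet C) (hd : Disjoint B C) (ψ : Hilb n) :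
    E.proj (B ∪ C) ψ = E.proj B ψ + E.proj C ψ := by
  -- The sequence B, C, ∅, ∅, … extracts finite additivity from countable additivity.
  let S : ℕ → Set (Pt n) := fun i => if i = 0 then B else if i = 1 then C else ∅
  have hS : ∀ i, MeasurableSet (S i) := fun i => by
    simp only [S]; split_ifs <;> simp [hB, hC]
  have hp : Pairwise (Function.onFun Disjoint S) := by
    intro i j hij
    simp only [S, Function.onFun]
    split_ifs <;> simp_all [hd.symm]
  have h := E.iUnion S hS hp ψ
  have hU : (⋃ i, S i) = B ∪ C := by
    ext x
    simp only [S, Set.mem_iUnion, Set.mem_union]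
    constructor
    · rintro ⟨i, hi⟩
      split_ifs at hi <;> simp_all
    · rintro (hx | hx)
      · exact ⟨0, by simpa⟩
      · exact ⟨1, by simpa⟩
  rw [hU] at h
  have h2 : HasSum (fun i => E.proj (S i) ψ) (∑ i ∈ Finset.range 2, E.proj (S i) ψ) := by
    apply hasSum_sum_of_ne_finset_zero
    intro i hi
    have : S i = ∅ := by
      simp only [Finset.mem_range, not_lt] at hi
      simp only [S]
      rw [if_neg (by omega), if_neg (by omega)]
    rw [this, E.empty]
  rw [h.unique h2]
  simp [Finset.sum_range_succ, S]

/-- The vector measure `B ↦ (c ↦ c • E(B)ψ)`. -/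
def PVM.weight (E : PVM n) (ψ : Hilb n) (B : Set (Pt n)) : ℂ →L[ℝ] Hilb n :=
  ((ContinuousLinearMap.id ℂ ℂ).smulRight (E.proj B ψ)).restrictScalars ℝ

theorem PVM.weight_apply (E : PVM n) (ψ : Hilb n) (B : Set (Pt n)) (c : ℂ) :
    E.weight ψ B c = c • E.proj B ψ := rfl

/-- Gives access to the `setToSimpleFunc` calculus, so that linearity in the integrand needs no
common refinement of level sets. -/
theorem PVM.weight_additive (E : PVM n) (ψ : Hilb n) :
    FinMeasAdditive (E.measure ψ) (E.weight ψ) := by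
  intro B C hB hC _ _ hd
  ext
  simp [PVM.weight_apply, E.proj_union hB hC hd]

theorem PVM.simpleIntegral_eq (E : PVM n) (s : SimpleFunc (Pt n) ℂ) (ψ : Hilb n) :
    E.simpleIntegral s ψ = s.setToSimpleFunc (E.weight ψ) := rfl

/-- The integral of simple functions as a linear map. -/
def PVM.simpleIntegralₗ (E : PVM n) (ψ : Hilb n) : SimpleFunc (Pt n) ℂ →ₗ[ℂ] Hilb n where
  toFun s := E.simpleIntegral s ψ
  map_add' s t := by
    simp only [E.simpleIntegral_eq]
    exact SimpleFunc.setToSimpleFunc_add _ (E.weight_additive ψ)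
      (s.integrable_of_isFiniteMeasure) (t.integrable_of_isFiniteMeasure)
  map_smul' c s := by
    simp only [E.simpleIntegral_eq]
    exact SimpleFunc.setToSimpleFunc_smul _ (E.weight_additive ψ)
      (fun c B x => by simp [PVM.weight_apply, smul_smul]) c (s.integrable_of_isFiniteMeasure)

/-- Pythagoras: projections onto different fibres of `s` have orthogonal ranges. This is the
isometry on which the whole calculus is built. -/
theorem PVM.enorm_simpleIntegral (E : PVM n) (s : SimpleFunc (Pt n) ℂ) (ψ : Hilb n) :
    ‖E.simpleIntegral s ψ‖ₑ ^ 2 = ∫⁻ x, ‖s x‖ₑ ^ 2 ∂(E.measure ψ) := by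
  have hm : ∀ c, MeasurableSet (s ⁻¹' {c}) := fun c => s.measurableSet_fiber c
  have h1 : ‖E.simpleIntegral s ψ‖ ^ 2
      = ∑ c ∈ s.range, ‖c‖ ^ 2 * ‖E.proj (s ⁻¹' {c}) ψ‖ ^ 2 := by
    have : ((‖E.simpleIntegral s ψ‖ ^ 2 : ℝ) : ℂ)
        = ((∑ c ∈ s.range, ‖c‖ ^ 2 * ‖E.proj (s ⁻¹' {c}) ψ‖ ^ 2 : ℝ) : ℂ) := by
      have h := inner_self_eq_norm_sq_to_K (𝕜 := ℂ) (E.simpleIntegral s ψ)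
      push_cast
      simp only [Complex.coe_algebraMap] at h
      rw [← h, PVM.simpleIntegral, sum_inner]
      refine Finset.sum_congr rfl fun c hc => ?_
      rw [inner_sum, Finset.sum_eq_single c]
      · rw [inner_smul_left, inner_smul_right, inner_self_eq_norm_sq_to_K, ← mul_assoc,
          Complex.conj_mul']
        rfl
      · intro d _ hd
        rw [inner_smul_left, inner_smul_right, E.inner_proj (hm c) (hm d)]
        have : s ⁻¹' {c} ∩ s ⁻¹' {d} = ∅ := by
          ext x; simp only [Set.mem_inter_iff, Set.mem_preimage, Set.mem_singleton_iff,
            Set.mem_empty_iff_false, iff_false, not_and]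
          intro h h'; exact hd (h'.symm.trans h)
        rw [this, E.empty, inner_zero_right, mul_zero, mul_zero]
      · exact fun h => absurd hc h
    exact_mod_cast this
  have h2 : (∫⁻ x, ‖s x‖ₑ ^ 2 ∂(E.measure ψ)) = ∑ c ∈ s.range, ‖c‖ₑ ^ 2 * E.measure ψ (s ⁻¹' {c}) := by
    rw [← SimpleFunc.map_lintegral (fun c : ℂ => ‖c‖ₑ ^ 2), ← SimpleFunc.lintegral_eq_lintegral]
    rfl
  rw [h2, ← ofReal_norm, ← ENNReal.ofReal_pow (norm_nonneg _), h1,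
    ENNReal.ofReal_sum_of_nonneg (fun c _ => by positivity)]
  refine Finset.sum_congr rfl fun c _ => ?_
  rw [E.measure_apply ψ (hm c), ENNReal.ofReal_mul (by positivity),
    ENNReal.ofReal_pow (norm_nonneg _), ENNReal.ofReal_pow (norm_nonneg _), ofReal_norm, ofReal_norm]

/-- Simple functions in `L²` of the spectral measure. -/
def PVM.simpleToLp (E : PVM n) (ψ : Hilb n) :
    SimpleFunc (Pt n) ℂ →ₗ[ℂ] Lp ℂ 2 (E.measure ψ) where
  toFun s := (s.memLp_of_isFiniteMeasure 2 (E.measure ψ)).toLp s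
  map_add' _ _ := rfl
  map_smul' _ _ := rfl

theorem eLpNorm_two_sq {α F : Type*} [MeasurableSpace α] [NormedAddCommGroup F] (f : α → F)
    (μ : Measure α) : eLpNorm f 2 μ ^ 2 = ∫⁻ x, ‖f x‖ₑ ^ 2 ∂μ := by
  have := eLpNorm_nnreal_pow_eq_lintegral (f := f) (μ := μ) (p := 2) (by norm_num)
  simpa using this

theorem enorm_eq_of_sq {x y : ℝ≥0∞} (h : x ^ 2 = y ^ 2) : x = y :=
  (ENNReal.pow_right_strictMono two_ne_zero).injective h

theorem PVM.norm_simpleIntegral (E : PVM n) (s : SimpleFunc (Pt n) ℂ) (ψ : Hilb n) :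
    ‖E.simpleIntegralₗ ψ s‖ = ‖E.simpleToLp ψ s‖ := by
  have : ‖E.simpleIntegral s ψ‖ₑ = eLpNorm s 2 (E.measure ψ) := by
    apply enorm_eq_of_sq
    rw [E.enorm_simpleIntegral, eLpNorm_two_sq]
  have h2 : ‖E.simpleToLp ψ s‖ₑ = eLpNorm s 2 (E.measure ψ) :=
    Lp.enorm_toLp (s.memLp_of_isFiniteMeasure 2 _)
  exact (enorm_eq_iff_norm_eq).1 (this.trans h2.symm)

theorem PVM.denseRange_simpleToLp (E : PVM n) (ψ : Hilb n) : DenseRange (E.simpleToLp ψ) := by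
  refine (Lp.simpleFunc.dense (E := ℂ) (μ := E.measure ψ) (p := 2) (by norm_num)).mono ?_
  rintro f ⟨s, hs⟩
  refine ⟨s, ?_⟩
  rw [← Subtype.coe_inj]
  exact hs

/-- The isometry `f ↦ ∫ f dE ψ` of `L²(‖Eψ‖²)` into the Hilbert space. -/
def PVM.toHilbL (E : PVM n) (ψ : Hilb n) : Lp ℂ 2 (E.measure ψ) →L[ℂ] Hilb n :=
  (E.simpleIntegralₗ ψ).extendOfNorm (E.simpleToLp ψ)

theorem PVM.toHilbL_simple (E : PVM n) (ψ : Hilb n) (s : SimpleFunc (Pt n) ℂ) :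
    E.toHilbL ψ (E.simpleToLp ψ s) = E.simpleIntegral s ψ :=
  LinearMap.extendOfNorm_eq (E.denseRange_simpleToLp ψ)
    ⟨1, fun s => by rw [one_mul, E.norm_simpleIntegral]⟩ s

theorem PVM.norm_toHilbL (E : PVM n) (ψ : Hilb n) (f : Lp ℂ 2 (E.measure ψ)) :
    ‖E.toHilbL ψ f‖ = ‖f‖ := by
  refine (E.denseRange_simpleToLp ψ).induction_on
    (p := fun f => ‖E.toHilbL ψ f‖ = ‖f‖) f ?_ ?_
  · exact isClosed_eq (by fun_prop) (by fun_prop)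
  · intro s
    rw [E.toHilbL_simple]
    exact E.norm_simpleIntegral s ψ

open Classical in
/-- `f(X)ψ = ∫ f dE ψ` for `f` square integrable for the spectral measure of `ψ`
(and `0` otherwise). -/
def PVM.integ (E : PVM n) (f : Pt n → ℂ) (ψ : Hilb n) : Hilb n :=
  if h : MemLp f 2 (E.measure ψ) then E.toHilbL ψ (h.toLp f) else 0

theorem PVM.integ_eq (E : PVM n) {f : Pt n → ℂ} {ψ : Hilb n} (h : MemLp f 2 (E.measure ψ)) :
    E.integ f ψ = E.toHilbL ψ (h.toLp f) := dif_pos h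

theorem PVM.integ_simple (E : PVM n) (s : SimpleFunc (Pt n) ℂ) (ψ : Hilb n) :
    E.integ s ψ = E.simpleIntegral s ψ := by
  rw [E.integ_eq (s.memLp_of_isFiniteMeasure 2 _), ← E.toHilbL_simple]
  rfl

theorem PVM.integ_sub (E : PVM n) {f g : Pt n → ℂ} {ψ : Hilb n} (hf : MemLp f 2 (E.measure ψ))
    (hg : MemLp g 2 (E.measure ψ)) : E.integ (f - g) ψ = E.integ f ψ - E.integ g ψ := by
  rw [E.integ_eq hf, E.integ_eq hg, E.integ_eq (hf.sub hg), MemLp.toLp_sub, map_sub]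

theorem PVM.integ_const_mul (E : PVM n) (c : ℂ) {f : Pt n → ℂ} {ψ : Hilb n}
    (hf : MemLp f 2 (E.measure ψ)) : E.integ (fun x => c * f x) ψ = c • E.integ f ψ := by
  have h : MemLp (fun x => c * f x) 2 (E.measure ψ) := hf.const_mul c
  rw [E.integ_eq hf, E.integ_eq h, ← map_smul]
  rfl

theorem PVM.enorm_integ (E : PVM n) {f : Pt n → ℂ} {ψ : Hilb n} (hf : MemLp f 2 (E.measure ψ)) :
    ‖E.integ f ψ‖ₑ = eLpNorm f 2 (E.measure ψ) := by
  rw [E.integ_eq hf, ← Lp.enorm_toLp hf]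
  exact enorm_eq_iff_norm_eq.2 (E.norm_toHilbL ψ _)

theorem PVM.integ_congr_ae (E : PVM n) {f g : Pt n → ℂ} {ψ : Hilb n}
    (hf : MemLp f 2 (E.measure ψ)) (h : f =ᵐ[E.measure ψ] g) : E.integ f ψ = E.integ g ψ := by
  rw [E.integ_eq hf, E.integ_eq ((memLp_congr_ae h).1 hf)]
  congr 1
  exact MemLp.toLp_congr _ _ h

/-- By the isometry, the distance of the two vectors is exactly the L² distance of the two
functions. -/
theorem PVM.tendsto_integ (E : PVM n) {ι : Type*} {l : Filter ι} {f : ι → Pt n → ℂ}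
    {g : Pt n → ℂ} {ψ : Hilb n} (hf : ∀ i, MemLp (f i) 2 (E.measure ψ))
    (hg : MemLp g 2 (E.measure ψ))
    (h : Tendsto (fun i => ∫⁻ x, ‖f i x - g x‖ₑ ^ 2 ∂(E.measure ψ)) l (𝓝 0)) :
    Tendsto (fun i => E.integ (f i) ψ) l (𝓝 (E.integ g ψ)) := by
  rw [tendsto_iff_edist_tendsto_0]
  have : ∀ i, edist (E.integ (f i) ψ) (E.integ g ψ) ^ 2
      = ∫⁻ x, ‖f i x - g x‖ₑ ^ 2 ∂(E.measure ψ) := by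
    intro i
    rw [edist_eq_enorm_sub, ← E.integ_sub (hf i) hg, E.enorm_integ ((hf i).sub hg),
      eLpNorm_two_sq]
    rfl
  simp only [← this] at h
  have h2 := (ENNReal.continuous_rpow_const (y := (2 : ℝ)⁻¹)).tendsto 0 |>.comp h
  have e : ∀ x : ℝ≥0∞, (x ^ 2) ^ ((2 : ℝ)⁻¹) = x := fun x => by
    rw [← ENNReal.rpow_natCast, ← ENNReal.rpow_mul]; norm_num
  simpa [Function.comp_def, e] using h2

theorem PVM.tendsto_integ_of_dominated (E : PVM n) {ι : Type*} {l : Filter ι}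
    [l.IsCountablyGenerated] {f : ι → Pt n → ℂ} {g : Pt n → ℂ} {ψ : Hilb n} (b : Pt n → ℝ)
    (hfm : ∀ i, Measurable (f i)) (hgm : Measurable g) (hb : MemLp b 2 (E.measure ψ))
    (hfb : ∀ i x, ‖f i x‖ ≤ b x) (hgb : ∀ x, ‖g x‖ ≤ b x)
    (h : ∀ x, Tendsto (fun i => f i x) l (𝓝 (g x))) :
    Tendsto (fun i => E.integ (f i) ψ) l (𝓝 (E.integ g ψ)) := by
  have hf : ∀ i, MemLp (f i) 2 (E.measure ψ) := fun i =>
    hb.mono (hfm i).aestronglyMeasurable (ae_of_all _ fun x => (hfb i x).trans (le_abs_self _))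
  have hg : MemLp g 2 (E.measure ψ) :=
    hb.mono hgm.aestronglyMeasurable (ae_of_all _ fun x => (hgb x).trans (le_abs_self _))
  refine E.tendsto_integ hf hg ?_
  have h0 : (∫⁻ _, 0 ∂(E.measure ψ)) = 0 := by simp
  rw [← h0]
  -- The factor 4 is the square of the 2 in |f - g| ≤ 2|b|.
  refine tendsto_lintegral_filter_of_dominated_convergence (fun x => 4 * ‖b x‖ₑ ^ 2) ?_ ?_ ?_ ?_
  · exact Eventually.of_forall fun i => (((hfm i).sub hgm).enorm).pow_const 2
  · refine Eventually.of_forall fun i => ae_of_all _ fun x => ?_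
    have h1 : ‖f i x - g x‖ ≤ 2 * ‖b x‖ := by
      have := norm_sub_le (f i x) (g x)
      have := hfb i x
      have := hgb x
      have := le_abs_self (b x)
      rw [Real.norm_eq_abs]
      linarith
    have h2 : ‖f i x - g x‖ₑ ≤ 2 * ‖b x‖ₑ := by
      rw [← ofReal_norm, ← ofReal_norm]
      calc ENNReal.ofReal ‖f i x - g x‖ ≤ ENNReal.ofReal (2 * ‖b x‖) := ENNReal.ofReal_le_ofReal h1
        _ = _ := by rw [ENNReal.ofReal_mul (by norm_num)]; norm_num
    calc ‖f i x - g x‖ₑ ^ 2 ≤ (2 * ‖b x‖ₑ) ^ 2 := by gcongr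
      _ = _ := by rw [mul_pow]; norm_num
  · rw [lintegral_const_mul' _ _ (by norm_num), ← eLpNorm_two_sq]
    exact ENNReal.mul_ne_top (by norm_num) (ENNReal.pow_ne_top hb.2.ne)
  · refine ae_of_all _ fun x => ?_
    have h1 : Tendsto (fun i => f i x - g x) l (𝓝 0) := by
      simpa using (h x).sub_const (g x)
    have h2 := (continuous_enorm.tendsto (0 : ℂ)).comp h1
    have h3 := ((ENNReal.continuous_pow 2).tendsto _).comp h2
    simpa [Function.comp_def] using h3

theorem PVM.exists_simple_tendsto (E : PVM n) {f : Pt n → ℂ} {ψ : Hilb n}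
    (hf : MemLp f 2 (E.measure ψ)) : ∃ s : ℕ → SimpleFunc (Pt n) ℂ,
    Tendsto (fun k => ∫⁻ x, ‖s k x - f x‖ₑ ^ 2 ∂(E.measure ψ)) atTop (𝓝 0) := by
  have h : ∀ k : ℕ, ∃ g : SimpleFunc (Pt n) ℂ,
      eLpNorm (f - ⇑g) 2 (E.measure ψ) < ((k : ℝ≥0∞) + 1)⁻¹ := fun k =>
    let ⟨g, hg, _⟩ := hf.exists_simpleFunc_eLpNorm_sub_lt (by norm_num)
      (ε := ((k : ℝ≥0∞) + 1)⁻¹) (by simp)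
    ⟨g, hg⟩
  choose s hs using h
  refine ⟨s, ?_⟩
  have h1 : Tendsto (fun k => eLpNorm (f - ⇑(s k)) 2 (E.measure ψ)) atTop (𝓝 0) := by
    refine tendsto_of_tendsto_of_tendsto_of_le_of_le tendsto_const_nhds ?_ (fun _ => zero_le)
      (fun k => (hs k).le)
    have := (tendsto_add_atTop_iff_nat 1).2 ENNReal.tendsto_inv_nat_nhds_zero
    simpa using this
  have h2 := ((ENNReal.continuous_pow 2).tendsto _).comp h1
  simp only [ne_eq, OfNat.ofNat_ne_zero, not_false_eq_true, zero_pow] at h2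
  refine h2.congr fun k => ?_
  simp only [Function.comp, eLpNorm_two_sq]
  refine lintegral_congr fun x => ?_
  rw [Pi.sub_apply, ← enorm_neg, neg_sub]

/-- Translates the definition by approximating sequences into plain square integrability; the
isometry makes the value independent of the sequence. -/
theorem PVM.hasApply_iff (E : PVM n) {f : Pt n → ℂ} (hf : Measurable f) (ψ v : Hilb n) :
    E.HasApply f ψ v ↔ MemLp f 2 (E.measure ψ) ∧ v = E.integ f ψ := by
  constructor
  · rintro ⟨s, h1, h2⟩
    have hfm : MemLp f 2 (E.measure ψ) := by
      -- A single simple function at finite L² distance already puts `f` into L², since simple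
      -- functions lie in L² of a finite measure.
      have h : ∀ᶠ k in atTop, ∫⁻ x, ‖s k x - f x‖ₑ ^ 2 ∂(E.measure ψ) < 1 :=
        h1.eventually (gt_mem_nhds (by norm_num))
      obtain ⟨k, hk⟩ := h.exists
      have hd : MemLp (⇑(s k) - f) 2 (E.measure ψ) := by
        refine ⟨((s k).measurable.sub hf).aestronglyMeasurable, ?_⟩
        have : eLpNorm (⇑(s k) - f) 2 (E.measure ψ) ^ 2 < 1 := by
          rw [eLpNorm_two_sq]; exact hk
        by_contra hcon
        rw [not_lt, top_le_iff] at hcon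
        simp [hcon] at this
      have := ((s k).memLp_of_isFiniteMeasure 2 (E.measure ψ)).sub hd
      simpa using this
    refine ⟨hfm, ?_⟩
    have h3 := E.tendsto_integ (fun k => (s k).memLp_of_isFiniteMeasure 2 (E.measure ψ)) hfm h1
    simp only [E.integ_simple] at h3
    exact tendsto_nhds_unique h2 h3
  · rintro ⟨hfm, rfl⟩
    obtain ⟨s, hs⟩ := E.exists_simple_tendsto hfm
    refine ⟨s, hs, ?_⟩
    have h3 := E.tendsto_integ (fun k => (s k).memLp_of_isFiniteMeasure 2 (E.measure ψ)) hfm hs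
    simpa only [E.integ_simple] using h3

end Calculus

/-! ### Bounded functions of the commuting operators, and operators commuting with the projections
-/

section BoundedCalculus

variable {n : ℕ}

open scoped ENNReal ComplexConjugate

theorem PVM.memLp_of_bound (E : PVM n) {f : Pt n → ℂ} (hf : Measurable f) {C : ℝ}
    (hC : ∀ x, ‖f x‖ ≤ C) (ψ : Hilb n) : MemLp f 2 (E.measure ψ) :=
  MemLp.of_bound hf.aestronglyMeasurable C (ae_of_all _ hC)

theorem exists_simple_tendsto_of_bound {f : Pt n → ℂ} (hf : Measurable f) {C : ℝ}
    (hC : ∀ x, ‖f x‖ ≤ C) : ∃ s : ℕ → SimpleFunc (Pt n) ℂ,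
    (∀ k x, ‖s k x‖ ≤ C) ∧ ∀ x, Tendsto (fun k => s k x) atTop (𝓝 (f x)) := by
  have h0 : 0 ≤ C := (norm_nonneg _).trans (hC 0)
  refine ⟨hf.stronglyMeasurable.approxBounded C, fun k x =>
    StronglyMeasurable.norm_approxBounded_le _ h0 k x, fun x => ?_⟩
  exact StronglyMeasurable.tendsto_approxBounded_of_norm_le hf.stronglyMeasurable (hC x)

theorem PVM.tendsto_simpleIntegral (E : PVM n) {f : Pt n → ℂ} (hf : Measurable f) {C : ℝ}
    (hC : ∀ x, ‖f x‖ ≤ C) {s : ℕ → SimpleFunc (Pt n) ℂ} (hs : ∀ k x, ‖s k x‖ ≤ C)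
    (ht : ∀ x, Tendsto (fun k => s k x) atTop (𝓝 (f x))) (ψ : Hilb n) :
    Tendsto (fun k => E.simpleIntegral (s k) ψ) atTop (𝓝 (E.integ f ψ)) := by
  simp only [← E.integ_simple]
  exact E.tendsto_integ_of_dominated (fun _ => C) (fun k => (s k).measurable) hf
    (memLp_const C) hs hC ht

/-- `integ` works in a different L² space for every vector, so linearity in the vector is not
automatic. Uniformly bounded simple functions converging pointwise approximate for all vectors at
once, and for simple functions linearity is clear. -/
theorem PVM.integ_vec_add (E : PVM n) {f : Pt n → ℂ} (hf : Measurable f) {C : ℝ}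
    (hC : ∀ x, ‖f x‖ ≤ C) (φ ψ : Hilb n) : E.integ f (φ + ψ) = E.integ f φ + E.integ f ψ := by
  obtain ⟨s, hs, ht⟩ := exists_simple_tendsto_of_bound hf hC
  have h := E.tendsto_simpleIntegral hf hC hs ht
  refine tendsto_nhds_unique (h (φ + ψ)) (((h φ).add (h ψ)).congr fun k => ?_)
  simp [PVM.simpleIntegral, Finset.sum_add_distrib]

theorem PVM.integ_vec_smul (E : PVM n) {f : Pt n → ℂ} (hf : Measurable f) {C : ℝ}
    (hC : ∀ x, ‖f x‖ ≤ C) (c : ℂ) (ψ : Hilb n) : E.integ f (c • ψ) = c • E.integ f ψ := by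
  obtain ⟨s, hs, ht⟩ := exists_simple_tendsto_of_bound hf hC
  have h := E.tendsto_simpleIntegral hf hC hs ht
  refine tendsto_nhds_unique (h (c • ψ)) (((h ψ).const_smul c).congr fun k => ?_)
  simp [PVM.simpleIntegral, Finset.smul_sum, smul_comm c]

theorem PVM.norm_integ_le (E : PVM n) {f : Pt n → ℂ} (hf : Measurable f) {C : ℝ}
    (hC : ∀ x, ‖f x‖ ≤ C) (ψ : Hilb n) : ‖E.integ f ψ‖ ≤ C * ‖ψ‖ := by
  have h0 : 0 ≤ C := (norm_nonneg _).trans (hC 0)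
  have h1 := E.enorm_integ (E.memLp_of_bound hf hC ψ)
  have h2 : ‖E.integ f ψ‖ₑ ^ 2 ≤ (ENNReal.ofReal C * ‖ψ‖ₑ) ^ 2 := by
    rw [h1, eLpNorm_two_sq, mul_pow, ← E.measure_univ ψ, ← lintegral_const]
    refine lintegral_mono fun x => ?_
    gcongr
    rw [← ofReal_norm]
    exact ENNReal.ofReal_le_ofReal (hC x)
  have h3 : ‖E.integ f ψ‖ₑ ≤ ENNReal.ofReal C * ‖ψ‖ₑ :=
    (ENNReal.pow_right_strictMono two_ne_zero).le_iff_le.1 h2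
  rw [← ofReal_norm, ← ofReal_norm, ← ENNReal.ofReal_mul h0] at h3
  exact (ENNReal.ofReal_le_ofReal_iff (by positivity)).1 h3

/-- `f(X)` for a bounded function `f`. -/
def PVM.boundedOp (E : PVM n) {f : Pt n → ℂ} (hf : Measurable f) {C : ℝ}
    (hC : ∀ x, ‖f x‖ ≤ C) : Hilb n →L[ℂ] Hilb n :=
  LinearMap.mkContinuous
    { toFun := E.integ f
      map_add' := E.integ_vec_add hf hC
      map_smul' := E.integ_vec_smul hf hC } C (E.norm_integ_le hf hC)

theorem PVM.simpleIntegral_map (E : PVM n) (s : SimpleFunc (Pt n) ℂ) (g : ℂ → ℂ) (hg : g 0 = 0)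
    (ψ : Hilb n) :
    E.simpleIntegral (s.map g) ψ = ∑ c ∈ s.range, g c • E.proj (s ⁻¹' {c}) ψ := by
  rw [E.simpleIntegral_eq, SimpleFunc.map_setToSimpleFunc _ (E.weight_additive ψ)
    s.integrable_of_isFiniteMeasure hg]
  rfl

/-- For simple functions this is self-adjointness of the projections; bounded pointwise
approximation does the rest. -/
theorem PVM.inner_integ_left (E : PVM n) {f : Pt n → ℂ} (hf : Measurable f) {C : ℝ}
    (hC : ∀ x, ‖f x‖ ≤ C) (φ ψ : Hilb n) :
    ⟪E.integ f φ, ψ⟫_ℂ = ⟪φ, E.integ (fun x => conj (f x)) ψ⟫_ℂ := by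
  obtain ⟨s, hs, ht⟩ := exists_simple_tendsto_of_bound hf hC
  have h := E.tendsto_simpleIntegral hf hC hs ht φ
  have h' := E.tendsto_simpleIntegral (f := fun x => conj (f x)) (C := C)
    (Complex.continuous_conj.measurable.comp hf) (fun x => by simpa using hC x)
    (s := fun k => (s k).map conj) (fun k x => by simpa using hs k x)
    (fun x => (Complex.continuous_conj.tendsto _).comp (ht x)) ψ
  refine tendsto_nhds_unique (h.inner tendsto_const_nhds)
    ((tendsto_const_nhds.inner h').congr fun k => ?_)
  rw [E.simpleIntegral_map _ _ (map_zero _), PVM.simpleIntegral, sum_inner, inner_sum]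
  refine Finset.sum_congr rfl fun c _ => ?_
  have := (E.selfAdjoint _ ((s k).measurableSet_fiber c)).isSymmetric φ ψ
  simp only [ContinuousLinearMap.coe_coe] at this
  rw [inner_smul_left, inner_smul_right, this]

theorem PVM.inner_integ_self (E : PVM n) {f : Pt n → ℂ} (hf : Measurable f) {C : ℝ}
    (hC : ∀ x, ‖f x‖ ≤ C) (ψ : Hilb n) : ⟪ψ, E.integ f ψ⟫_ℂ = ∫ x, f x ∂(E.measure ψ) := by
  obtain ⟨s, hs, ht⟩ := exists_simple_tendsto_of_bound hf hC
  have h := E.tendsto_simpleIntegral hf hC hs ht ψ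
  have h2 : Tendsto (fun k => ∫ x, s k x ∂(E.measure ψ)) atTop (𝓝 (∫ x, f x ∂(E.measure ψ))) :=
    tendsto_integral_of_dominated_convergence (fun _ => C)
      (fun k => (s k).measurable.aestronglyMeasurable) (integrable_const C)
      (fun k => ae_of_all _ (hs k)) (ae_of_all _ ht)
  refine tendsto_nhds_unique (tendsto_const_nhds.inner h) (h2.congr fun k => ?_)
  rw [← SimpleFunc.integral_eq_integral _ (s k).integrable_of_isFiniteMeasure,
    SimpleFunc.integral_eq, PVM.simpleIntegral, inner_sum]
  refine Finset.sum_congr rfl fun c _ => ?_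
  rw [inner_smul_right, E.inner_proj_self ((s k).measurableSet_fiber c), mul_comm]
  rfl

/-- Two bounded operators with the same diagonal matrix elements agree. -/
theorem eq_of_inner_self {H : Type*} [NormedAddCommGroup H] [InnerProductSpace ℂ H]
    {S T : H →L[ℂ] H} (h : ∀ ψ, ⟪ψ, S ψ⟫_ℂ = ⟪ψ, T ψ⟫_ℂ) : S = T := by
  have h2 := (inner_map_self_eq_zero ((S - T : H →L[ℂ] H) : H →ₗ[ℂ] H)).1 (fun x => by
    rw [← inner_conj_symm]
    simp [inner_sub_right, h])
  ext1 x
  have := LinearMap.congr_fun h2 x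
  simpa [sub_eq_zero] using this

theorem PVM.norm_proj_le (E : PVM n) {B : Set (Pt n)} (hB : MeasurableSet B) (ψ : Hilb n) :
    ‖E.proj B ψ‖ ≤ ‖ψ‖ := by
  have h : ‖E.proj B ψ‖ₑ ^ 2 ≤ ‖ψ‖ₑ ^ 2 := by
    rw [← E.measure_apply ψ hB, ← E.measure_univ]
    exact measure_mono (Set.subset_univ _)
  rw [← enorm_le_iff_norm_le]
  exact (ENNReal.pow_right_strictMono two_ne_zero).le_iff_le.1 h

/-- ‖E(B)Tψ‖ = ‖TE(B)ψ‖ ≤ ‖E(B)ψ‖. Hence `T` preserves the domain of every f(X), bounded or not. -/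
theorem PVM.measure_map_le (E : PVM n) {T : Hilb n →L[ℂ] Hilb n} (hT : ∀ ψ, ‖T ψ‖ ≤ ‖ψ‖)
    (hE : ∀ B, MeasurableSet B → ∀ ψ, T (E.proj B ψ) = E.proj B (T ψ)) (ψ : Hilb n) :
    E.measure (T ψ) ≤ E.measure ψ := by
  refine Measure.le_iff.2 fun B hB => ?_
  rw [E.measure_apply _ hB, E.measure_apply _ hB, ← hE B hB]
  gcongr
  exact enorm_le_iff_norm_le.2 (hT _)

/-- A contraction commuting with the projections commutes with the functional calculus. -/
theorem PVM.map_integ (E : PVM n) {T : Hilb n →L[ℂ] Hilb n} (hT : ∀ ψ, ‖T ψ‖ ≤ ‖ψ‖)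
    (hE : ∀ B, MeasurableSet B → ∀ ψ, T (E.proj B ψ) = E.proj B (T ψ)) {f : Pt n → ℂ}
    {ψ : Hilb n} (hf : MemLp f 2 (E.measure ψ)) : T (E.integ f ψ) = E.integ f (T ψ) := by
  have hle := E.measure_map_le hT hE ψ
  obtain ⟨s, hs⟩ := E.exists_simple_tendsto hf
  have h1 := E.tendsto_integ (fun k => (s k).memLp_of_isFiniteMeasure 2 (E.measure ψ)) hf hs
  have h2 := E.tendsto_integ (fun k => (s k).memLp_of_isFiniteMeasure 2 (E.measure (T ψ)))
    (hf.mono_measure hle) (tendsto_of_tendsto_of_tendsto_of_le_of_le tendsto_const_nhds hs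
      (fun _ => zero_le) (fun k => lintegral_mono' hle le_rfl))
  refine tendsto_nhds_unique ((T.continuous.tendsto _).comp h1) (h2.congr fun k => ?_)
  simp only [Function.comp, E.integ_simple, PVM.simpleIntegral, map_sum, map_smul]
  refine Finset.sum_congr rfl fun c _ => ?_
  rw [hE _ ((s k).measurableSet_fiber c)]

theorem PVM.proj_comm (E : PVM n) {B C : Set (Pt n)} (hB : MeasurableSet B)
    (hC : MeasurableSet C) (ψ : Hilb n) : E.proj B (E.proj C ψ) = E.proj C (E.proj B ψ) := by
  rw [E.proj_proj hB hC, E.proj_proj hC hB, Set.inter_comm]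

theorem PVM.proj_integ (E : PVM n) {B : Set (Pt n)} (hB : MeasurableSet B) {f : Pt n → ℂ}
    {ψ : Hilb n} (hf : MemLp f 2 (E.measure ψ)) :
    E.proj B (E.integ f ψ) = E.integ f (E.proj B ψ) :=
  E.map_integ (E.norm_proj_le hB) (fun _ hC => E.proj_comm hB hC) hf

theorem PVM.measure_proj (E : PVM n) {B : Set (Pt n)} (hB : MeasurableSet B) (ψ : Hilb n) :
    E.measure (E.proj B ψ) = (E.measure ψ).restrict B := by
  ext C hC
  rw [E.measure_apply _ hC, Measure.restrict_apply hC, E.measure_apply _ (hC.inter hB),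
    E.proj_proj hC hB]

/-- E(B) commutes with f(X), so ‖E(B) f(X)ψ‖² is the integral of |f|² over B by the isometry. -/
theorem PVM.measure_integ (E : PVM n) {f : Pt n → ℂ} {ψ : Hilb n}
    (hf : MemLp f 2 (E.measure ψ)) :
    E.measure (E.integ f ψ) = (E.measure ψ).withDensity fun x => ‖f x‖ₑ ^ 2 := by
  ext B hB
  rw [E.measure_apply _ hB, E.proj_integ hB hf, withDensity_apply _ hB, ← E.measure_proj hB,
    E.enorm_integ, eLpNorm_two_sq]
  exact hf.mono_measure (E.measure_map_le (E.norm_proj_le hB) (fun _ hC => E.proj_comm hB hC) ψ)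

end BoundedCalculus

/-! ### The unitary group as a function of its spectral resolution -/

section Unitary

variable {n : ℕ} {U : Pt n → (Hilb n ≃ₗᵢ[ℂ] Hilb n)} {E : PVM n}

theorem measurable_character (p : Pt n) :
    Measurable fun x : Pt n => Complex.exp (Complex.I * ((p ⬝ᵥ x : ℝ) : ℂ)) := by
  refine Continuous.measurable ?_
  simp only [dotProduct]
  fun_prop

theorem norm_character (p x : Pt n) :
    ‖Complex.exp (Complex.I * ((p ⬝ᵥ x : ℝ) : ℂ))‖ ≤ 1 := by
  rw [mul_comm, Complex.norm_exp_ofReal_mul_I]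

/-- Diagonal matrix elements determine a bounded operator on a complex space, so the defining
property of the resolution upgrades to an identity of vectors. -/
theorem IsSpectralResolution.apply_eq (h : IsSpectralResolution U E) (p : Pt n) (ψ : Hilb n) :
    U p ψ = E.integ (fun x => Complex.exp (Complex.I * ((p ⬝ᵥ x : ℝ) : ℂ))) ψ := by
  have : ((U p : Hilb n →L[ℂ] Hilb n)) = E.boundedOp (measurable_character p) (norm_character p) := by
    refine eq_of_inner_self fun ψ => ?_
    exact (h p ψ).trans (E.inner_integ_self (measurable_character p) (norm_character p) ψ).symm
  exact congrArg (fun T : Hilb n →L[ℂ] Hilb n => T ψ) this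

theorem IsSpectralResolution.comm (h : IsSpectralResolution U E) (p : Pt n) {B : Set (Pt n)}
    (hB : MeasurableSet B) (ψ : Hilb n) : U p (E.proj B ψ) = E.proj B (U p ψ) := by
  rw [h.apply_eq, h.apply_eq, E.proj_integ hB
    (E.memLp_of_bound (measurable_character p) (norm_character p) ψ)]

theorem integrable_smul_unitary {Z : Type*} [MeasurableSpace Z] {ν : Measure Z}
    (hU : ∀ ψ, Continuous fun p => U p ψ) {k : Z → ℂ} (hk : Integrable k ν) {y : Z → Pt n}
    (hy : Measurable y) (ψ : Hilb n) : Integrable (fun z => k z • U (y z) ψ) ν := by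
  refine hk.smul_bdd ‖ψ‖ ?_ (ae_of_all _ fun z => ((U (y z)).norm_map ψ).le)
  exact ((hU ψ).stronglyMeasurable.comp_measurable hy).aestronglyMeasurable

/-- An average of the group is a function of X, namely the Fourier transform of the weight. Fubini
on diagonal matrix elements suffices, because both sides are bounded operators. -/
theorem IsSpectralResolution.integral_smul (h : IsSpectralResolution U E)
    (hU : ∀ ψ, Continuous fun p => U p ψ) {Z : Type*} [MeasurableSpace Z] {ν : Measure Z}
    [SFinite ν] {k : Z → ℂ} (hkm : Measurable k) (hk : Integrable k ν) {y : Z → Pt n}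
    (hy : Measurable y) (ψ : Hilb n) :
    ∫ z, k z • U (y z) ψ ∂ν
      = E.integ (fun x => ∫ z, k z * Complex.exp (Complex.I * ((y z ⬝ᵥ x : ℝ) : ℂ)) ∂ν) ψ := by
  have hm : Measurable fun q : Pt n × Z =>
      k q.2 * Complex.exp (Complex.I * ((y q.2 ⬝ᵥ q.1 : ℝ) : ℂ)) := by
    have h1 : Measurable fun r : Pt n × Pt n =>
        Complex.exp (Complex.I * ((r.1 ⬝ᵥ r.2 : ℝ) : ℂ)) := by
      refine Continuous.measurable ?_
      simp only [dotProduct]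
      fun_prop
    exact (hkm.comp measurable_snd).mul
      (h1.comp ((hy.comp measurable_snd).prodMk measurable_fst))
  have hfm : Measurable fun x : Pt n =>
      ∫ z, k z * Complex.exp (Complex.I * ((y z ⬝ᵥ x : ℝ) : ℂ)) ∂ν :=
    hm.stronglyMeasurable.integral_prod_right'.measurable
  have hfb : ∀ x : Pt n,
      ‖∫ z, k z * Complex.exp (Complex.I * ((y z ⬝ᵥ x : ℝ) : ℂ)) ∂ν‖ ≤ ∫ z, ‖k z‖ ∂ν := by
    intro x
    refine norm_integral_le_of_norm_le hk.norm (ae_of_all _ fun z => ?_)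
    rw [norm_mul]
    exact mul_le_of_le_one_right (norm_nonneg _) (norm_character _ _)
  let A : Hilb n →L[ℂ] Hilb n := LinearMap.mkContinuous
    { toFun := fun ψ => ∫ z, k z • U (y z) ψ ∂ν
      map_add' := fun φ ψ => by
        simp only [map_add, smul_add]
        exact integral_add (integrable_smul_unitary hU hk hy φ) (integrable_smul_unitary hU hk hy ψ)
      map_smul' := fun c ψ => by
        simp only [map_smul, smul_comm _ c, RingHom.id_apply]
        exact MeasureTheory.integral_smul c _ } (∫ z, ‖k z‖ ∂ν) (fun ψ => by
      rw [← integral_mul_const]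
      refine norm_integral_le_of_norm_le (hk.norm.mul_const _) (ae_of_all _ fun z => ?_)
      rw [norm_smul, (U (y z)).norm_map])
  have : A = E.boundedOp hfm hfb := by
    refine eq_of_inner_self fun ψ => ?_
    change ⟪ψ, ∫ z, k z • U (y z) ψ ∂ν⟫_ℂ = ⟪ψ, E.integ _ ψ⟫_ℂ
    rw [E.inner_integ_self hfm hfb, ← integral_inner (integrable_smul_unitary hU hk hy ψ)]
    rw [integral_integral_swap]
    · refine integral_congr_ae (ae_of_all _ fun z => ?_)
      simp only [inner_smul_right, h (y z) ψ, integral_const_mul]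
    · refine ((integrable_const (1 : ℝ)).mul_prod hk.norm).mono' hm.aestronglyMeasurable
        (ae_of_all _ fun q => ?_)
      simp only [Function.uncurry]
      rw [norm_mul, one_mul]
      exact mul_le_of_le_one_right (norm_nonneg _) (norm_character _ _)
  exact congrArg (fun T : Hilb n →L[ℂ] Hilb n => T ψ) this

end Unitary

/-! ### Riemann sums of operator integrals -/

section RiemannSums

variable {n : ℕ}

open scoped ENNReal

/-- The index of the cube containing `x`. -/
def cubeIndex (N : ℕ) (x : Pt n) : Fin (n + 1) → ℤ := fun i => ⌊x i * (N + 1)⌋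

/-- Exhibits the cubes of one mesh as the fibres of a measurable map. Measurability, disjointness
and covering follow at once, and Riemann sums become integrals of functions of `cubeIndex N`. -/
theorem mem_cube_iff (N : ℕ) (k : Fin (n + 1) → ℤ) (x : Pt n) :
    x ∈ cube N k ↔ cubeIndex N x = k := by
  have hN : (0 : ℝ) < N + 1 := by positivity
  simp only [cube, Set.mem_ofPred_eq, cubeIndex, funext_iff, Int.floor_eq_iff, div_le_iff₀ hN,
    lt_div_iff₀ hN]

theorem measurable_cubeIndex (N : ℕ) : Measurable (cubeIndex (n := n) N) := by
  refine measurable_pi_lambda _ fun i => ?_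
  exact Int.measurable_floor.comp ((measurable_pi_apply i).mul_const _)

theorem cube_eq_preimage (N : ℕ) (k : Fin (n + 1) → ℤ) :
    cube N k = cubeIndex (n := n) N ⁻¹' {k} := by
  ext x
  simp [mem_cube_iff]

theorem measurableSet_cube (N : ℕ) (k : Fin (n + 1) → ℤ) : MeasurableSet (cube (n := n) N k) := by
  rw [cube_eq_preimage]
  exact measurable_cubeIndex N (measurableSet_singleton k)

theorem iUnion_cube (N : ℕ) : (⋃ k, cube (n := n) N k) = Set.univ := by
  ext x
  simp [mem_cube_iff]

theorem disjoint_cube (N : ℕ) : Pairwise (Function.onFun Disjoint (cube (n := n) N)) := by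
  intro k l hkl
  rw [Function.onFun, Set.disjoint_left]
  intro x hx hx'
  rw [mem_cube_iff] at hx hx'
  exact hkl (hx.symm.trans hx')

theorem PVM.hasSum_countable (E : PVM n) {ι : Type*} [Countable ι] [Infinite ι]
    {B : ι → Set (Pt n)} (hB : ∀ i, MeasurableSet (B i))
    (hd : Pairwise (Function.onFun Disjoint B)) (ψ : Hilb n) :
    HasSum (fun i => E.proj (B i) ψ) (E.proj (⋃ i, B i) ψ) := by
  obtain ⟨hι⟩ := nonempty_denumerable ι
  have e := Denumerable.eqv ι
  have h := E.iUnion (fun i => B (e.symm i)) (fun i => hB _)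
    (fun i j hij => hd (e.symm.injective.ne hij)) ψ
  rw [e.symm.iSup_comp (g := B) |> fun h : (⋃ i, B (e.symm i)) = ⋃ i, B i => h] at h
  exact (e.symm.hasSum_iff (f := fun i => E.proj (B i) ψ)).1 h

theorem PVM.hasSum_cube (E : PVM n) (N : ℕ) (ψ : Hilb n) :
    HasSum (fun k => E.proj (cube N k) ψ) ψ := by
  have h := E.hasSum_countable (measurableSet_cube (n := n) N) (disjoint_cube N) ψ
  rw [iUnion_cube, E.univ] at h
  exact h

theorem PVM.integ_const (E : PVM n) (c : ℂ) (ψ : Hilb n) : E.integ (fun _ => c) ψ = c • ψ := by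
  have : E.boundedOp (f := fun _ => c) measurable_const (fun _ => le_rfl)
      = c • ContinuousLinearMap.id ℂ (Hilb n) := by
    refine eq_of_inner_self fun ψ => ?_
    refine (E.inner_integ_self measurable_const (fun _ => le_rfl) ψ).trans ?_
    have := E.inner_proj_self MeasurableSet.univ ψ
    rw [E.univ] at this
    simp only [integral_const, _root_.smul_apply, ContinuousLinearMap.id_apply,
      inner_smul_right]
    rw [Complex.real_smul, ← this, mul_comm]
    rfl
  exact congrArg (fun T : Hilb n →L[ℂ] Hilb n => T ψ) this

theorem PVM.proj_cube_step (E : PVM n) (N : ℕ) (f : (Fin (n + 1) → ℤ) → ℂ) {ψ : Hilb n}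
    (hf : MemLp (fun x => f (cubeIndex N x)) 2 (E.measure ψ)) (k : Fin (n + 1) → ℤ) :
    E.proj (cube N k) (E.integ (fun x => f (cubeIndex N x)) ψ) = E.proj (cube N k) (f k • ψ) := by
  have hm := measurableSet_cube (n := n) N k
  rw [E.proj_integ hm hf, map_smul, ← E.integ_const]
  refine E.integ_congr_ae ?_ ?_
  · rw [E.measure_proj hm]
    exact hf.mono_measure Measure.restrict_le_self
  · rw [E.measure_proj hm]
    filter_upwards [ae_restrict_mem hm] with x hx
    rw [(mem_cube_iff N k x).1 hx]

/-- On each cube the step function is a constant, and the projections onto the cubes sum to the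
identity. -/
theorem PVM.hasSum_step (E : PVM n) (N : ℕ) (f : (Fin (n + 1) → ℤ) → ℂ) {ψ : Hilb n}
    (hf : MemLp (fun x => f (cubeIndex N x)) 2 (E.measure ψ)) :
    HasSum (fun k => E.proj (cube N k) (f k • ψ)) (E.integ (fun x => f (cubeIndex N x)) ψ) := by
  simp only [← E.proj_cube_step N f hf]
  exact E.hasSum_cube N _

/-- Convergence of a Riemann sum at one mesh is enough: the norm of its sum computes the L² norm of
the step function, which is therefore finite. -/
theorem PVM.memLp_of_hasSum (E : PVM n) (N : ℕ) (f : (Fin (n + 1) → ℤ) → ℂ) {ψ S : Hilb n}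
    (h : HasSum (fun k => E.proj (cube N k) (f k • ψ)) S) :
    MemLp (fun x => f (cubeIndex N x)) 2 (E.measure ψ) := by
  have hm := measurableSet_cube (n := n) N
  -- Projecting the series onto one cube leaves one term, by disjointness.
  have hS : ∀ k, E.proj (cube N k) S = E.proj (cube N k) (f k • ψ) := by
    intro k
    refine ((h.mapL (E.proj (cube N k))).unique
      (hasSum_single k fun l hl => ?_)).trans ?_
    · rw [E.proj_proj (hm _) (hm _), (disjoint_cube N hl.symm).inter_eq, E.empty]
    · rw [E.proj_proj (hm _) (hm _), Set.inter_self]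
  have hmeas : Measurable fun x : Pt n => f (cubeIndex N x) :=
    (measurable_of_countable f).comp (measurable_cubeIndex N)
  refine ⟨hmeas.aestronglyMeasurable, ?_⟩
  have : eLpNorm (fun x => f (cubeIndex N x)) 2 (E.measure ψ) ^ 2 = E.measure S Set.univ := by
    rw [eLpNorm_two_sq, ← setLIntegral_univ, ← iUnion_cube N,
      lintegral_iUnion hm (disjoint_cube N), measure_iUnion (disjoint_cube N) hm]
    refine tsum_congr fun k => ?_
    rw [setLIntegral_congr_fun (g := fun _ => ‖f k‖ₑ ^ 2) (hm k)
      (fun x hx => by simp only [(mem_cube_iff N k x).1 hx]), setLIntegral_const,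
      E.measure_apply _ (hm k), E.measure_apply _ (hm k), hS, map_smul, enorm_smul, mul_pow]
  by_contra hcon
  rw [not_lt, top_le_iff] at hcon
  rw [hcon] at this
  exact measure_ne_top _ _ (this.symm.trans (by simp))

/-- The exponential `x ↦ exp(w·x)`, as a complex-valued function. -/
def expFun (w x : Pt n) : ℂ := (Real.exp (w ⬝ᵥ x) : ℂ)

theorem norm_expFun (w x : Pt n) : ‖expFun w x‖ = Real.exp (w ⬝ᵥ x) := by
  rw [expFun, Complex.norm_real, Real.norm_eq_abs, abs_of_pos (Real.exp_pos _)]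

theorem continuous_expFun (w : Pt n) : Continuous (expFun w) := by
  change Continuous fun x : Pt n => ((Real.exp (∑ i, w i * x i) : ℝ) : ℂ)
  fun_prop

theorem dotProduct_sub_le_of_mem_cube (w : Pt n) {N : ℕ} {k : Fin (n + 1) → ℤ} {x y : Pt n}
    (hx : x ∈ cube N k) (hy : y ∈ cube N k) :
    w ⬝ᵥ x - w ⬝ᵥ y ≤ (∑ i, |w i|) / (N + 1) := by
  rw [← dotProduct_sub, Finset.sum_div]
  refine Finset.sum_le_sum fun i _ => ?_
  have h : |x i - y i| ≤ 1 / (N + 1) := by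
    have h1 := hx i
    have h2 := hy i
    rw [add_div] at h1 h2
    rw [abs_le]
    constructor <;> linarith
  calc w i * (x - y) i ≤ |w i * (x i - y i)| := le_abs_self _
    _ = |w i| * |x i - y i| := abs_mul _ _
    _ ≤ |w i| * (1 / (N + 1)) := by gcongr
    _ = _ := by ring

/-- The sides are at most 1, so the exponent varies by at most ∑|w_i| on a cube. The constant does
not depend on the mesh, which supplies a common majorant for all Riemann sums. -/
theorem norm_expFun_le_of_mem_cube (w : Pt n) {N : ℕ} {k : Fin (n + 1) → ℤ} {x y : Pt n}
    (hx : x ∈ cube N k) (hy : y ∈ cube N k) :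
    ‖expFun w x‖ ≤ Real.exp (∑ i, |w i|) * ‖expFun w y‖ := by
  rw [norm_expFun, norm_expFun, ← Real.exp_add, Real.exp_le_exp]
  have h1 := dotProduct_sub_le_of_mem_cube w hx hy
  have h2 : (∑ i, |w i|) / ((N : ℝ) + 1) ≤ ∑ i, |w i| :=
    div_le_self (Finset.sum_nonneg fun i _ => abs_nonneg _) (by simp)
  linarith

theorem tendsto_expFun_sample (w x : Pt n) {τ : ℕ → (Fin (n + 1) → ℤ) → Pt n}
    (hτ : ∀ N k, τ N k ∈ cube N k) :
    Tendsto (fun N => expFun w (τ N (cubeIndex N x))) atTop (𝓝 (expFun w x)) := by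
  have h0 : Tendsto (fun N : ℕ => (∑ i, |w i|) / ((N : ℝ) + 1)) atTop (𝓝 0) := by
    simpa [Function.comp_def] using
      (tendsto_const_div_atTop_nhds_zero_nat (∑ i, |w i|)).comp (tendsto_add_atTop_nat 1)
  have h1 : Tendsto (fun N => w ⬝ᵥ τ N (cubeIndex N x)) atTop (𝓝 (w ⬝ᵥ x)) := by
    rw [tendsto_iff_dist_tendsto_zero]
    refine squeeze_zero (fun _ => dist_nonneg) (fun N => ?_) h0
    have hx : x ∈ cube N (cubeIndex N x) := (mem_cube_iff _ _ _).2 rfl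
    rw [Real.dist_eq, abs_le]
    have a := dotProduct_sub_le_of_mem_cube w (hτ N (cubeIndex N x)) hx
    have b := dotProduct_sub_le_of_mem_cube w hx (hτ N (cubeIndex N x))
    constructor <;> linarith
  exact (Complex.continuous_ofReal.tendsto _).comp ((Real.continuous_exp.tendsto _).comp h1)

theorem PVM.memLp_sample_iff (E : PVM n) (w : Pt n) (ψ : Hilb n) (N : ℕ)
    {τ : (Fin (n + 1) → ℤ) → Pt n} (hτ : ∀ k, τ k ∈ cube N k) :
    MemLp (fun x => expFun w (τ (cubeIndex N x))) 2 (E.measure ψ) ↔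
      MemLp (expFun w) 2 (E.measure ψ) := by
  have hm : Measurable fun x : Pt n => expFun w (τ (cubeIndex N x)) :=
    (measurable_of_countable fun k => expFun w (τ k)).comp (measurable_cubeIndex N)
  have hx : ∀ x : Pt n, x ∈ cube N (cubeIndex N x) := fun x => (mem_cube_iff _ _ _).2 rfl
  constructor <;> intro h
  · exact MemLp.of_le_mul h (continuous_expFun w).measurable.aestronglyMeasurable
      (ae_of_all _ fun x => norm_expFun_le_of_mem_cube w (hx x) (hτ _))
  · exact MemLp.of_le_mul h hm.aestronglyMeasurable
      (ae_of_all _ fun x => norm_expFun_le_of_mem_cube w (hτ _) (hx x))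

theorem corner_mem_cube (N : ℕ) (k : Fin (n + 1) → ℤ) :
    (fun i => (k i : ℝ) / (N + 1)) ∈ cube N k := by
  have hN : (0 : ℝ) < N + 1 := by positivity
  exact fun i => ⟨le_rfl, div_lt_div_of_pos_right (lt_add_one _) hN⟩

/-- The step functions built from the samples are comparable with the exponential. So they converge
by domination when the exponential is in L², and a convergent sum puts the exponential into L². -/
theorem PVM.hasIntegral_expFun_iff (E : PVM n) (w : Pt n) (ψ v : Hilb n) :
    E.HasIntegral (fun x => expFun w x • ψ) v ↔ E.HasApply (expFun w) ψ v := by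
  rw [E.hasApply_iff (continuous_expFun w).measurable]
  have key : MemLp (expFun w) 2 (E.measure ψ) →
      E.HasIntegral (fun x => expFun w x • ψ) (E.integ (expFun w) ψ) := by
    intro hf τ hτ
    refine ⟨fun N => E.integ (fun x => expFun w (τ N (cubeIndex N x))) ψ, fun N => ?_, ?_⟩
    · exact E.hasSum_step N (fun k => expFun w (τ N k)) ((E.memLp_sample_iff w ψ N (hτ N)).2 hf)
    · refine E.tendsto_integ_of_dominated (fun x => Real.exp (∑ i, |w i|) * ‖expFun w x‖)
        (fun N => (measurable_of_countable fun k => expFun w (τ N k)).comp (measurable_cubeIndex N))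
        (continuous_expFun w).measurable (hf.norm.const_mul _) (fun N x => ?_) (fun x => ?_)
        (fun x => tendsto_expFun_sample w x hτ)
      · exact norm_expFun_le_of_mem_cube w (hτ _ _) ((mem_cube_iff _ _ _).2 rfl)
      -- Both points are `x` itself; this only says that the constant is at least one.
      · exact norm_expFun_le_of_mem_cube w (N := 0) ((mem_cube_iff _ _ _).2 rfl)
          ((mem_cube_iff _ _ _).2 rfl)
  constructor
  · intro h
    obtain ⟨τ, hτ⟩ : ∃ τ : ℕ → (Fin (n + 1) → ℤ) → Pt n, ∀ N k, τ N k ∈ cube N k :=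
      ⟨_, corner_mem_cube⟩
    obtain ⟨S, hS, hSt⟩ := h τ hτ
    -- The coarsest mesh, cubes of side 1 at `N = 0`, already decides membership in the domain.
    have hf : MemLp (expFun w) 2 (E.measure ψ) :=
      (E.memLp_sample_iff w ψ 0 (hτ 0)).1
        (E.memLp_of_hasSum 0 (fun k => expFun w (τ 0 k)) (hS 0))
    refine ⟨hf, ?_⟩
    obtain ⟨S', hS', hSt'⟩ := key hf τ hτ
    have : S = S' := funext fun N => (hS N).unique (hS' N)
    exact tendsto_nhds_unique hSt (this ▸ hSt')
  · rintro ⟨hf, rfl⟩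
    exact key hf

theorem PVM.HasIntegral.sum_smul {E : PVM n} {ι : Type*} (s : Finset ι) (c : ι → ℂ)
    {F : ι → Pt n → Hilb n} {v : ι → Hilb n} (h : ∀ i ∈ s, E.HasIntegral (F i) (v i)) :
    E.HasIntegral (fun x => ∑ i ∈ s, c i • F i x) (∑ i ∈ s, c i • v i) := by
  intro τ hτ
  have h' : ∀ i, ∃ S : ℕ → Hilb n, i ∈ s →
      (∀ N, HasSum (fun k => E.proj (cube N k) (F i (τ N k))) (S N)) ∧
        Tendsto S atTop (𝓝 (v i)) := by
    intro i
    by_cases hi : i ∈ s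
    · obtain ⟨S, hS⟩ := h i hi τ hτ
      exact ⟨S, fun _ => hS⟩
    · exact ⟨0, fun h => absurd h hi⟩
  choose S hS using h'
  refine ⟨fun N => ∑ i ∈ s, c i • S i N, fun N => ?_, ?_⟩
  · simp only [map_sum, map_smul]
    exact hasSum_sum fun i hi => ((hS i hi).1 N).const_smul (c i)
  · exact tendsto_finsetSum s fun i hi => (hS i hi).2.const_smul (c i)

end RiemannSums

/-! ### Dilations of Schwartz functions -/

section Dilations

variable {n : ℕ}

open scoped ENNReal

/-- The dilation `x ↦ (exp(a_μ p_μ) x_μ)_μ`. -/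
def dilate (a p : Pt n) : Pt n ≃L[ℝ] Pt n :=
  ContinuousLinearEquiv.piCongrRight fun μ =>
    ContinuousLinearEquiv.unitsEquivAut ℝ (Units.mk0 (Real.exp (a μ * p μ)) (Real.exp_ne_zero _))

@[simp]
theorem dilate_apply (a p x : Pt n) (μ : Fin (n + 1)) :
    dilate a p x μ = Real.exp (a μ * p μ) * x μ := by
  simp [dilate, mul_comm]

/-- The action of the dilations on Schwartz functions,
`Φ ↦ exp(a·p / 2) Φ(exp(a_μ p_μ) x_μ)`. -/
def dilSch (a p : Pt n) : SchOp n :=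
  (Real.exp (a ⬝ᵥ p / 2) : ℂ) •
    (SchwartzMap.compCLMOfContinuousLinearEquiv ℂ (dilate a p)).toLinearMap

theorem dilSch_apply (a p : Pt n) (Φ : Sch n) (x : Pt n) :
    dilSch a p Φ x = (Real.exp (a ⬝ᵥ p / 2) : ℂ) * Φ (dilate a p x) := rfl

theorem dilSch_add (a p r : Pt n) (Φ : Sch n) :
    dilSch a (p + r) Φ = dilSch a p (dilSch a r Φ) := by
  ext x
  simp only [dilSch_apply]
  rw [dotProduct_add, add_div, Real.exp_add, Complex.ofReal_mul, mul_assoc]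
  congr 3
  ext μ
  simp [mul_add, Real.exp_add]
  ring

theorem dilSch_zero (a : Pt n) (Φ : Sch n) : dilSch a 0 Φ = Φ := by
  ext x
  have : dilate a 0 x = x := by ext μ; simp
  simp [dilSch_apply, this]

theorem dilSch_neg_dilSch (a p : Pt n) (Φ : Sch n) : dilSch a (-p) (dilSch a p Φ) = Φ := by
  rw [← dilSch_add, neg_add_cancel, dilSch_zero]

/-- The dilations as linear automorphisms of the Schwartz space. -/
def dilEquiv (a p : Pt n) : Sch n ≃ₗ[ℂ] Sch n :=
  LinearEquiv.ofLinearMap (dilSch a p) (dilSch a (-p))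
    (by ext1 Φ; simpa using dilSch_neg_dilSch a (-p) Φ)
    (by ext1 Φ; exact dilSch_neg_dilSch a p Φ)

/-- The covariance behind the whole deformation: by the chain rule, a dilation rescales each partial
derivative by its own scale factor. -/
theorem momOp_dilSch (a p : Pt n) (μ : Fin (n + 1)) (Φ : Sch n) :
    momOp μ (dilSch a p Φ) = (Real.exp (a μ * p μ) : ℂ) • dilSch a p (momOp μ Φ) := by
  ext x
  have h1 : (⇑(dilSch a p Φ) : Pt n → ℂ)
      = fun y => (Real.exp (a ⬝ᵥ p / 2) : ℂ) * Φ (dilate a p y) := rfl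
  have h2 : HasFDerivAt (fun y => Φ (dilate a p y))
      ((fderiv ℝ Φ (dilate a p x)).comp (dilate a p : Pt n →L[ℝ] Pt n)) x :=
    (Φ.differentiableAt.hasFDerivAt).comp x (dilate a p).hasFDerivAt
  have h3 : dilate a p (Pi.single μ 1) = Real.exp (a μ * p μ) • (Pi.single μ 1 : Pt n) := by
    ext ν
    by_cases h : ν = μ
    · subst h; simp
    · simp [h]
  rw [momOp_apply, h1, (h2.const_mul _).fderiv]
  change -Complex.I * ((Real.exp (a ⬝ᵥ p / 2) : ℂ) *
    (fderiv ℝ Φ (dilate a p x)) (dilate a p (Pi.single μ 1))) = _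
  rw [h3, map_smul]
  change _ = (Real.exp (a μ * p μ) : ℂ) * (dilSch a p (momOp μ Φ) x)
  rw [dilSch_apply, momOp_apply, Complex.real_smul]
  ring

theorem coordOp_eq (a : Pt n) (μ : Fin (n + 1)) :
    coordOp a μ = (a μ : ℂ) • (posOp μ * momOp μ) - (a μ * Complex.I / 2) • (1 : SchOp n) := by
  have h := ccr (n := n) μ μ
  rw [if_pos rfl] at h
  have h2 : momOp (n := n) μ * posOp μ = posOp μ * momOp μ - Complex.I • 1 := by
    rw [← h]; abel
  rw [coordOp, h2]
  module

theorem coordOp_apply (a : Pt n) (μ : Fin (n + 1)) (Φ : Sch n) (x : Pt n) :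
    coordOp a μ Φ x
      = -Complex.I * a μ * (x μ * fderiv ℝ Φ x (Pi.single μ 1) + Φ x / 2) := by
  rw [coordOp_eq]
  change (a μ : ℂ) * (posOp μ (momOp μ Φ) x) - (a μ * Complex.I / 2) * Φ x = _
  rw [posOp_apply, momOp_apply]
  ring

/-- The generator `i ∑_μ p_μ X^μ` of the dilations in the direction `p`. -/
def genSch (a p : Pt n) : SchOp n :=
  Complex.I • ∑ μ, (p μ : ℂ) • coordOp a μ

theorem genSch_apply (a p : Pt n) (Φ : Sch n) :
    genSch a p Φ = Complex.I • ∑ μ, (p μ : ℂ) • coordOp a μ Φ := by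
  simp [genSch]

theorem sum_apply_sch {ι : Type*} (s : Finset ι) (f : ι → Sch n) (x : Pt n) :
    (∑ i ∈ s, f i) x = ∑ i ∈ s, f i x := by
  classical
  induction s using Finset.induction_on with
  | empty => simp
  | insert i s hi ih => rw [Finset.sum_insert hi, Finset.sum_insert hi, ← ih]; rfl

/-- An Euler vector field with rates `p μ * a μ`, plus half its divergence; the divergence term
makes the flow isometric on L². -/
theorem genSch_apply_apply (a p : Pt n) (Φ : Sch n) (x : Pt n) :
    genSch a p Φ x = fderiv ℝ Φ x (fun μ => p μ * a μ * x μ) + ((a ⬝ᵥ p / 2 : ℝ) : ℂ) * Φ x := by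
  rw [genSch_apply]
  change Complex.I * ((∑ μ, (p μ : ℂ) • coordOp a μ Φ) x) = _
  rw [sum_apply_sch]
  have h1 : ∀ μ, ((p μ : ℂ) • coordOp a μ Φ) x = (p μ : ℂ) * coordOp a μ Φ x := fun _ => rfl
  have h2 : (fun μ => p μ * a μ * x μ) = ∑ μ, (p μ * a μ * x μ) • (Pi.single μ 1 : Pt n) := by
    ext ν
    simp [Finset.sum_apply, Pi.single_apply]
  rw [h2, map_sum]
  simp only [h1, coordOp_apply, map_smul, Complex.real_smul, dotProduct]
  push_cast
  rw [Finset.mul_sum, Finset.sum_div, Finset.sum_mul, ← Finset.sum_add_distrib]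
  refine Finset.sum_congr rfl fun μ _ => ?_
  linear_combination (-(p μ * a μ : ℂ) * (x μ * fderiv ℝ Φ x (Pi.single μ 1) + Φ x / 2)) *
    Complex.I_mul_I

/-- Writing the derivative as the dilate of a fixed Schwartz function lets one decay bound dominate
it for all small times. -/
theorem hasDerivAt_dilSch_apply (a p : Pt n) (Φ : Sch n) (x : Pt n) (t : ℝ) :
    HasDerivAt (fun t : ℝ => dilSch a (t • p) Φ x) (dilSch a (t • p) (genSch a p Φ) x) t := by
  have h1 : HasDerivAt (fun t : ℝ => dilate a (t • p) x)
      (fun μ => p μ * a μ * dilate a (t • p) x μ) t := by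
    rw [hasDerivAt_pi]
    intro μ
    simp only [dilate_apply, Pi.smul_apply, smul_eq_mul]
    have : HasDerivAt (fun t : ℝ => a μ * (t * p μ)) (a μ * (1 * p μ)) t :=
      ((hasDerivAt_id t).mul_const _).const_mul _
    refine (this.exp.mul_const (x μ)).congr_deriv ?_
    ring
  have h2 : HasDerivAt (fun t : ℝ => Φ (dilate a (t • p) x))
      (fderiv ℝ Φ (dilate a (t • p) x) (fun μ => p μ * a μ * dilate a (t • p) x μ)) t :=
    (Φ.differentiableAt.hasFDerivAt).comp_hasDerivAt t h1
  have h3 : HasDerivAt (fun t : ℝ => ((Real.exp (a ⬝ᵥ (t • p) / 2) : ℝ) : ℂ))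
      ((Real.exp (a ⬝ᵥ (t • p) / 2) * (a ⬝ᵥ p / 2) : ℝ) : ℂ) t := by
    have : HasDerivAt (fun t : ℝ => a ⬝ᵥ (t • p) / 2) (a ⬝ᵥ p / 2) t := by
      simp only [dotProduct_smul, smul_eq_mul]
      simpa using ((hasDerivAt_id t).mul_const (a ⬝ᵥ p)).div_const 2
    exact this.exp.ofReal_comp
  have h4 := h3.mul h2
  refine h4.congr_deriv ?_
  rw [dilSch_apply, genSch_apply_apply]
  push_cast
  ring

/-! #### Domination -/

/-- A polynomially decaying function that is integrable and square integrable. -/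
def decay (x : Pt n) : ℝ := ((1 + ‖x‖) ^ (n + 2))⁻¹

theorem decay_pos (x : Pt n) : 0 < decay x := by
  unfold decay; positivity

theorem continuous_decay : Continuous (decay (n := n)) := by
  unfold decay
  exact Continuous.inv₀ (by fun_prop) (fun x => by positivity)

theorem decay_le_one (x : Pt n) : decay x ≤ 1 := by
  unfold decay
  exact inv_le_one_of_one_le₀ (one_le_pow₀ (by linarith [norm_nonneg x]))

theorem integrable_decay : Integrable (decay (n := n)) := by
  -- The exponent `n + 2` just exceeds the dimension `n + 1`.
  have h := integrable_one_add_norm (E := Pt n) (μ := volume) (r := (n + 2 : ℕ))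
    (by rw [Module.finrank_fin_fun]; push_cast; linarith)
  refine h.congr (ae_of_all _ fun x => ?_)
  simp only [decay]
  rw [Real.rpow_neg (by positivity), Real.rpow_natCast]

theorem memLp_decay : MemLp (decay (n := n)) 2 volume := by
  rw [memLp_two_iff_integrable_sq continuous_decay.aestronglyMeasurable]
  refine integrable_decay.mono' (continuous_decay.pow 2).aestronglyMeasurable
    (ae_of_all _ fun x => ?_)
  rw [Real.norm_eq_abs, abs_of_nonneg (sq_nonneg _), sq]
  exact mul_le_of_le_one_left (decay_pos x).le (decay_le_one x)

theorem exists_norm_le_decay (Φ : Sch n) : ∃ C, 0 ≤ C ∧ ∀ x, ‖Φ x‖ ≤ C * decay x := by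
  refine ⟨2 ^ (n + 2) * (Finset.Iic ((n + 2, 0) : ℕ × ℕ)).sup
    (fun m => SchwartzMap.seminorm ℝ m.1 m.2) Φ, by positivity, fun x => ?_⟩
  have h := SchwartzMap.one_add_le_sup_seminorm_apply (𝕜 := ℝ) (m := (n + 2, 0)) (k := n + 2)
    (n := 0) le_rfl le_rfl Φ x
  rw [norm_iteratedFDeriv_zero] at h
  rw [decay, ← div_eq_mul_inv, le_div_iff₀ (by positivity), mul_comm]
  exact h

/-- The growth rate of the dilations. -/
def growth (a p : Pt n) : ℝ := ∑ μ, |a μ * p μ|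

theorem growth_nonneg (a p : Pt n) : 0 ≤ growth a p := Finset.sum_nonneg fun _ _ => abs_nonneg _

theorem norm_le_exp_mul_dilate (a p x : Pt n) :
    ‖x‖ ≤ Real.exp (growth a p) * ‖dilate a p x‖ := by
  rw [pi_norm_le_iff_of_nonneg (by positivity)]
  intro μ
  have h1 : |a μ * p μ| ≤ growth a p :=
    Finset.single_le_sum (f := fun μ => |a μ * p μ|) (fun _ _ => abs_nonneg _) (Finset.mem_univ μ)
  have h2 : ‖x μ‖ = Real.exp (-(a μ * p μ)) * ‖dilate a p x μ‖ := by
    rw [dilate_apply, norm_mul, Real.norm_eq_abs (Real.exp _), Real.abs_exp, ← mul_assoc,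
      ← Real.exp_add, neg_add_cancel, Real.exp_zero, one_mul]
  rw [h2]
  gcongr
  · exact (neg_le_abs _).trans h1
  · exact norm_le_pi_norm _ μ

theorem norm_dilate_le (a p x : Pt n) :
    ‖dilate a p x‖ ≤ Real.exp (growth a p) * ‖x‖ := by
  have h := norm_le_exp_mul_dilate a (-p) (dilate a p x)
  have h1 : growth a (-p) = growth a p := by simp [growth]
  have h2 : dilate a (-p) (dilate a p x) = x := by
    ext μ
    simp only [dilate_apply, Pi.neg_apply, mul_neg]
    rw [← mul_assoc, ← Real.exp_add, neg_add_cancel, Real.exp_zero, one_mul]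
  rwa [h1, h2] at h

theorem decay_dilate_le (a p x : Pt n) :
    decay (dilate a p x) ≤ Real.exp ((n + 2) * growth a p) * decay x := by
  have h := norm_le_exp_mul_dilate a p x
  have h1 : 1 ≤ Real.exp (growth a p) := Real.one_le_exp (growth_nonneg a p)
  have h2 : 1 + ‖x‖ ≤ Real.exp (growth a p) * (1 + ‖dilate a p x‖) := by linarith
  have h3 : (1 + ‖x‖) ^ (n + 2) ≤
      Real.exp ((n + 2) * growth a p) * (1 + ‖dilate a p x‖) ^ (n + 2) := by
    have : Real.exp ((n + 2) * growth a p) = Real.exp (growth a p) ^ (n + 2) := by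
      rw [← Real.exp_nat_mul]; push_cast; rfl
    rw [this, ← mul_pow]
    gcongr
  unfold decay
  rw [← div_eq_mul_inv, le_div_iff₀ (by positivity), mul_comm, ← div_eq_mul_inv,
    div_le_iff₀ (by positivity)]
  exact h3

theorem half_dotProduct_le_growth (a p : Pt n) : a ⬝ᵥ p / 2 ≤ growth a p := by
  have : a ⬝ᵥ p ≤ growth a p := Finset.sum_le_sum fun μ _ => le_abs_self _
  linarith [growth_nonneg a p]

/-- Of the exponent `n + 3`, the part `n + 2` is lost by the decay under the dilation and 1 pays for
the prefactor exp(a·p/2). -/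
theorem norm_dilSch_le (a p : Pt n) {Φ : Sch n} {C : ℝ} (hC : ∀ x, ‖Φ x‖ ≤ C * decay x)
    (h0 : 0 ≤ C) (x : Pt n) :
    ‖dilSch a p Φ x‖ ≤ C * Real.exp ((n + 3) * growth a p) * decay x := by
  rw [dilSch_apply, norm_mul, Complex.norm_real, Real.norm_eq_abs, Real.abs_exp]
  calc Real.exp (a ⬝ᵥ p / 2) * ‖Φ (dilate a p x)‖
      ≤ Real.exp (growth a p) * (C * (Real.exp ((n + 2) * growth a p) * decay x)) := by
        gcongr
        · exact half_dotProduct_le_growth a p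
        · exact (hC _).trans (mul_le_mul_of_nonneg_left (decay_dilate_le a p x) h0)
    _ = C * (Real.exp (growth a p) * Real.exp ((n + 2) * growth a p)) * decay x := by ring
    _ = _ := by
        rw [← Real.exp_add]
        ring_nf

/-! #### Convergence in `L²` -/

theorem enorm_toHilb_sq (Φ : Sch n) : ‖toHilb Φ‖ₑ ^ 2 = ∫⁻ x, ‖Φ x‖ₑ ^ 2 := by
  have h : ‖toHilb Φ‖ₑ = eLpNorm Φ 2 volume := Lp.enorm_toLp (Φ.memLp 2 volume)
  rw [h, eLpNorm_two_sq]

theorem tendsto_toHilb_of_dominated {ι : Type*} {l : Filter ι} [l.IsCountablyGenerated]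
    {F : ι → Sch n} {Φ : Sch n} {b : Pt n → ℝ} (hb : MemLp b 2 volume)
    (hF : ∀ᶠ i in l, ∀ x, ‖F i x - Φ x‖ ≤ b x)
    (h : ∀ x, Tendsto (fun i => F i x) l (𝓝 (Φ x))) :
    Tendsto (fun i => toHilb (F i)) l (𝓝 (toHilb Φ)) := by
  rw [tendsto_iff_edist_tendsto_0]
  have key : Tendsto (fun i => ∫⁻ x, ‖(F i - Φ) x‖ₑ ^ 2) l (𝓝 (∫⁻ _ : Pt n, 0)) := by
    refine tendsto_lintegral_filter_of_dominated_convergence (fun x => ‖b x‖ₑ ^ 2) ?_ ?_ ?_ ?_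
    · exact Eventually.of_forall fun i =>
        ((F i - Φ).continuous.enorm.measurable).pow_const 2
    · filter_upwards [hF] with i hi
      refine ae_of_all _ fun x => ?_
      have : ‖(F i - Φ) x‖ₑ ≤ ‖b x‖ₑ :=
        enorm_le_iff_norm_le.2 ((hi x).trans (le_abs_self _))
      gcongr
    · rw [← eLpNorm_two_sq]
      exact ENNReal.pow_ne_top hb.2.ne
    · refine ae_of_all _ fun x => ?_
      have h1 : Tendsto (fun i => F i x - Φ x) l (𝓝 0) := by
        simpa using (h x).sub_const (Φ x)
      have h3 := ((ENNReal.continuous_pow 2).tendsto _).comp ((continuous_enorm.tendsto (0 : ℂ)).comp h1)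
      simpa [Function.comp_def] using h3
  simp only [lintegral_zero, ← enorm_toHilb_sq] at key
  have h2 := (ENNReal.continuous_rpow_const (y := (2 : ℝ)⁻¹)).tendsto 0 |>.comp key
  have e : ∀ x : ℝ≥0∞, (x ^ 2) ^ ((2 : ℝ)⁻¹) = x := fun x => by
    rw [← ENNReal.rpow_natCast, ← ENNReal.rpow_mul]; norm_num
  simpa [Function.comp_def, e, edist_eq_enorm_sub] using h2

/-- The mean value inequality bounds the difference quotients by the majorant of the derivatives, so
pointwise differentiability becomes differentiability in L² by dominated convergence. -/
theorem hasDerivAt_toHilb {F : ℝ → Sch n} {F' : ℝ → Sch n} {b : Pt n → ℝ}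
    (hb : MemLp b 2 volume) (hd : ∀ x t, HasDerivAt (fun t => F t x) (F' t x) t)
    (hF : ∀ t, |t| ≤ 1 → ∀ x, ‖F' t x‖ ≤ b x) :
    HasDerivAt (fun t => toHilb (F t)) (toHilb (F' 0)) 0 := by
  rw [hasDerivAt_iff_tendsto_slope]
  have hs : slope (fun t => toHilb (F t)) 0
      = fun t => toHilb (((t : ℝ) : ℂ)⁻¹ • (F t - F 0)) := by
    funext t
    rw [slope_def_module, sub_zero, map_smul, map_sub, ← Complex.ofReal_inv, Complex.coe_smul]
    rfl
  rw [hs]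
  have hval : ∀ t x, (((t : ℝ) : ℂ)⁻¹ • (F t - F 0)) x = slope (fun t => F t x) 0 t := by
    intro t x
    rw [slope_def_module, sub_zero, ← Complex.coe_smul, Complex.ofReal_inv]
    rfl
  refine tendsto_toHilb_of_dominated (b := fun x => 2 * b x) (hb.const_mul 2) ?_ fun x => ?_
  · have : ∀ᶠ t : ℝ in 𝓝[≠] 0, |t| < 1 ∧ t ≠ 0 := by
      refine (eventually_nhdsWithin_of_eventually_nhds ?_).and self_mem_nhdsWithin
      filter_upwards [Metric.ball_mem_nhds (0 : ℝ) one_pos] with t ht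
      simpa using ht
    filter_upwards [this] with t ht x
    rw [hval]
    have h1 : ‖F t x - F 0 x‖ ≤ b x * ‖t - 0‖ := by
      refine (convex_uIcc (0 : ℝ) t).norm_image_sub_le_of_norm_hasDerivWithin_le
        (f' := fun t => F' t x) (fun s _ => (hd x s).hasDerivWithinAt) (fun s hs => hF s ?_ x)
        Set.left_mem_uIcc Set.right_mem_uIcc
      have := Set.abs_sub_left_of_mem_uIcc hs
      rw [sub_zero, sub_zero] at this
      exact this.trans ht.1.le
    have h2 : ‖slope (fun t => F t x) 0 t‖ ≤ b x := by
      rw [slope_def_module, norm_smul, norm_inv, inv_mul_le_iff₀ (norm_pos_iff.2 (by simpa using ht.2)),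
        mul_comm]
      exact h1
    have h3 := hF 0 (by simp) x
    linarith [norm_sub_le (slope (fun t => F t x) 0 t) (F' 0 x)]
  · simp only [hval]
    exact hasDerivAt_iff_tendsto_slope.1 (hd x 0)

theorem growth_smul (a p : Pt n) (t : ℝ) : growth a (t • p) = |t| * growth a p := by
  simp only [growth, Pi.smul_apply, smul_eq_mul, Finset.mul_sum, abs_mul]
  exact Finset.sum_congr rfl fun _ _ => by ring

theorem hasDerivAt_toHilb_dilSch (a p : Pt n) (Φ : Sch n) :
    HasDerivAt (fun t : ℝ => toHilb (dilSch a (t • p) Φ)) (toHilb (genSch a p Φ)) 0 := by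
  obtain ⟨C, h0, hC⟩ := exists_norm_le_decay (genSch a p Φ)
  have := hasDerivAt_toHilb (F := fun t => dilSch a (t • p) Φ)
    (F' := fun t => dilSch a (t • p) (genSch a p Φ))
    (b := fun x => C * Real.exp ((n + 3) * growth a p) * decay x) (memLp_decay.const_mul _)
    (fun x t => hasDerivAt_dilSch_apply a p Φ x t) (fun t ht x => by
      refine (norm_dilSch_le a _ hC h0 x).trans ?_
      have hd := (decay_pos x).le
      gcongr
      rw [growth_smul]
      exact mul_le_of_le_one_left (growth_nonneg a p) ht)
  simpa [dilSch_zero] using this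

theorem continuous_growth (a : Pt n) : Continuous (growth a) := by
  unfold growth
  fun_prop

theorem continuous_dilSch_apply (a : Pt n) (Φ : Sch n) :
    Continuous fun z : Pt n × Pt n => dilSch a z.1 Φ z.2 := by
  simp only [dilSch_apply]
  refine Continuous.mul ?_ (Φ.continuous.comp (continuous_pi fun μ => ?_))
  · simp only [dotProduct]
    fun_prop
  · simp only [dilate_apply]
    fun_prop

theorem continuous_toHilb_dilSch (a : Pt n) (Φ : Sch n) :
    Continuous fun p => toHilb (dilSch a p Φ) := by
  rw [continuous_iff_continuousAt]
  intro p
  obtain ⟨C, h0, hC⟩ := exists_norm_le_decay Φ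
  refine tendsto_toHilb_of_dominated
    (b := fun x => 2 * C * Real.exp ((n + 3) * (growth a p + 1)) * decay x)
    (memLp_decay.const_mul _) ?_ fun x => ?_
  · have : ∀ᶠ r in 𝓝 p, growth a r < growth a p + 1 :=
      (continuous_growth a).continuousAt.eventually (gt_mem_nhds (lt_add_one _))
    filter_upwards [this] with r hr x
    have hd := (decay_pos x).le
    have h1 := norm_dilSch_le a r hC h0 x
    have h2 := norm_dilSch_le a p hC h0 x
    have h3 : C * Real.exp ((n + 3) * growth a r) * decay x
        ≤ C * Real.exp ((n + 3) * (growth a p + 1)) * decay x := by gcongr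
    have h4 : C * Real.exp ((n + 3) * growth a p) * decay x
        ≤ C * Real.exp ((n + 3) * (growth a p + 1)) * decay x := by gcongr; linarith
    linarith [norm_sub_le (dilSch a r Φ x) (dilSch a p Φ x)]
  · exact ((continuous_dilSch_apply a Φ).comp (Continuous.prodMk_left x)).tendsto p

/-! #### The unitary group on the Schwartz space -/

theorem IsExpGroup.apply_zero {X : Fin (n + 1) → SchOp n} {U : Pt n → (Hilb n ≃ₗᵢ[ℂ] Hilb n)}
    (h : IsExpGroup X U) (ψ : Hilb n) : U 0 ψ = ψ := by
  have := h.map_add 0 0 ψ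
  rw [add_zero] at this
  exact ((U 0).injective this).symm

theorem IsExpGroup.symm_apply {X : Fin (n + 1) → SchOp n} {U : Pt n → (Hilb n ≃ₗᵢ[ℂ] Hilb n)}
    (h : IsExpGroup X U) (p : Pt n) (ψ : Hilb n) : (U p).symm ψ = U (-p) ψ := by
  rw [LinearIsometryEquiv.symm_apply_eq, ← h.map_add, add_neg_cancel, h.apply_zero]

theorem toHilb_injective : Function.Injective (toHilb (n := n)) :=
  SchwartzMap.injective_toLp 2 volume

theorem denseRange_toHilb : DenseRange (toHilb (n := n)) :=
  SchwartzMap.denseRange_toLpCLM ENNReal.ofNat_ne_top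

/-- The unitary group generated by the dilation operators acts on the Schwartz space by
dilations. -/
theorem IsExpGroup.apply_toHilb {a : Pt n} {U : Pt n → (Hilb n ≃ₗᵢ[ℂ] Hilb n)}
    (h : IsExpGroup (coordOp a) U) (p : Pt n) (Φ : Sch n) :
    U p (toHilb Φ) = toHilb (dilSch a p Φ) := by
  -- Pull the dilated function back by U. At every time the dilated function is again Schwartz, so
  -- the generators of the two groups can be compared there; they agree, and `g` has zero
  -- derivative.
  let g : ℝ → Hilb n := fun t => U (-(t • p)) (toHilb (dilSch a (t • p) Φ))
  have hg : ∀ t, HasDerivAt g 0 t := by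
    intro t
    set Φt := dilSch a (t • p) Φ
    have h1 := hasDerivAt_toHilb_dilSch a p Φt
    have h2 := h.generator p Φt
    rw [← genSch_apply] at h2
    have h3 := (hasDerivAt_iff_isLittleO_nhds_zero.1 (h1.sub h2))
    simp only [zero_add, sub_self, smul_zero, Pi.sub_apply, zero_smul, dilSch_zero, h.apply_zero,
      sub_zero] at h3
    rw [hasDerivAt_iff_isLittleO_nhds_zero]
    refine (h3.norm_left.congr_left fun s => ?_).of_norm_left
    simp only [g, smul_zero, sub_zero, add_smul]
    rw [add_comm (t • p), dilSch_add, neg_add_rev, h.map_add, ← map_sub,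
      LinearIsometryEquiv.norm_map, ← (U (s • p)).norm_map (U (-(s • p)) _ - _), map_sub,
      ← h.map_add, add_neg_cancel, h.apply_zero]
  have hc : g 1 = g 0 :=
    is_const_of_deriv_eq_zero (fun t => (hg t).differentiableAt) (fun t => (hg t).deriv) 1 0
  simp only [g, one_smul, zero_smul, neg_zero, dilSch_zero, h.apply_zero] at hc
  rw [← hc, ← h.map_add, add_neg_cancel, h.apply_zero]

theorem rep_dx (a q : Pt n) (μ : Fin (n + 1)) : rep a q (dx a μ) = diffOp a q μ := by
  rw [rep, dx, RingQuot.liftAlgHom_mkAlgHom_apply, FreeAlgebra.lift_ι_apply]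
  rfl

/-- The second-order operator `dX^μ dX^ν`. -/
def diffSq (a q : Pt n) (μ ν : Fin (n + 1)) : SchOp n := diffOp a q μ * diffOp a q ν

theorem diffOp_dilSch (a q p : Pt n) (μ : Fin (n + 1)) (Φ : Sch n) :
    diffOp a q μ (dilSch a p Φ) = (Real.exp (a μ * p μ) : ℂ) • dilSch a p (diffOp a q μ Φ) := by
  simp only [diffOp_eq, LinearMap.smul_apply, momOp_dilSch, map_smul]
  rw [smul_comm]

theorem diffSq_dilSch (a q p : Pt n) (μ ν : Fin (n + 1)) (Φ : Sch n) :
    diffSq a q μ ν (dilSch a p Φ)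
      = (Real.exp (a μ * p μ + a ν * p ν) : ℂ) • dilSch a p (diffSq a q μ ν Φ) := by
  simp only [diffSq, Module.End.mul_apply, diffOp_dilSch, map_smul, smul_smul, Real.exp_add,
    Complex.ofReal_mul]
  rw [mul_comm]

theorem rep_lineElement (a q : Pt n) :
    rep a q (lineElement a) = ∑ μ, ((eta n μ μ : ℝ) : ℂ) • diffSq a q μ μ := by
  rw [lineElement, map_sum]
  refine Finset.sum_congr rfl fun μ _ => ?_
  rw [map_sum, Finset.sum_eq_single μ]
  · rw [map_smul, map_mul, rep_dx, diffSq]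
  · intro ν _ hν
    rw [eta, Matrix.diagonal_apply_ne _ hν.symm]
    simp
  · simp

/-- `α_p(A)` on the orbit of a Schwartz vector. -/
theorem IsExpGroup.conjApply_iff {a : Pt n} {U : Pt n → (Hilb n ≃ₗᵢ[ℂ] Hilb n)}
    (h : IsExpGroup (coordOp a) U) (p y : Pt n) (A : SchOp n) (Φ : Sch n) (v : Hilb n) :
    ConjApply U p A (U y (toHilb Φ)) v ↔ v = U p (toHilb (A (dilSch a (y - p) Φ))) := by
  have h1 : (U p).symm (U y (toHilb Φ)) = toHilb (dilSch a (y - p) Φ) := by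
    rw [h.symm_apply, ← h.map_add, h.apply_toHilb]
    congr 2
    abel_nf
  constructor
  · rintro ⟨Φ', h2, rfl⟩
    rw [h1] at h2
    rw [toHilb_injective h2]
  · rintro rfl
    exact ⟨_, h1.symm, rfl⟩

/-- Moving the second-order operator past the dilation by y - p costs a number, and the group
elements then recombine to U(y). -/
theorem IsExpGroup.conjApply_diffSq {a q : Pt n} {U : Pt n → (Hilb n ≃ₗᵢ[ℂ] Hilb n)}
    (h : IsExpGroup (coordOp a) U) (p y : Pt n) (μ ν : Fin (n + 1)) (Φ : Sch n) :
    U p (toHilb (diffSq a q μ ν (dilSch a (y - p) Φ)))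
      = (Real.exp (a μ * (y - p) μ + a ν * (y - p) ν) : ℂ) •
        U y (toHilb (diffSq a q μ ν Φ)) := by
  rw [diffSq_dilSch, map_smul, map_smul, ← h.apply_toHilb, ← h.map_add, add_sub_cancel]

end Dilations

/-! ### Gaussian oscillatory integrals -/

section Gaussian

variable {n : ℕ}

open scoped ENNReal ComplexConjugate

/-- The regularized kernel `exp(-S|x|² - T|y|² - i xy + wx + by)`. -/
def gaussKernel (S T : ℝ) (w b x y : Pt n) : ℂ :=
  Complex.exp (-(S : ℂ) * ∑ i, (x i : ℂ) ^ 2 + ∑ i, ((w i : ℂ) - Complex.I * y i) * x i) *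
    Complex.exp (-(T : ℂ) * ∑ i, (y i : ℂ) ^ 2 + ∑ i, (b i : ℂ) * y i)

/-- The function of the commuting operators `X^μ` produced by the kernel `gaussKernel`. -/
def weylSymbol (S T : ℝ) (w b z : Pt n) : ℂ :=
  (((1 + 4 * S * T) ^ (-((n + 1 : ℝ) / 2)) : ℝ) : ℂ) *
    Complex.exp ((S * ∑ i, ((b i : ℂ) + Complex.I * z i) ^ 2 + ∑ i, (w i : ℂ) * z i
      + T * ∑ i, (w i : ℂ) ^ 2) / ((1 + 4 * S * T : ℝ) : ℂ))

theorem oscKernel_mul_exp (s t ε : ℝ) (w b x y : Pt n) :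
    oscKernel s t ε x y * (Real.exp (w ⬝ᵥ x + b ⬝ᵥ y) : ℂ)
      = gaussKernel (s * ε ^ 2) (t * ε ^ 2) w b x y := by
  rw [oscKernel, gaussKernel, Complex.ofReal_exp, ← Complex.exp_add, ← Complex.exp_add]
  congr 1
  simp only [dotProduct, Pi.smul_apply, smul_eq_mul]
  push_cast
  simp only [Finset.mul_sum, sub_mul, Finset.sum_sub_distrib]
  have h1 : ∀ i, (s : ℂ) * (ε * x i * (ε * x i)) = s * ε ^ 2 * x i ^ 2 := fun i => by ring
  have h2 : ∀ i, (t : ℂ) * (ε * y i * (ε * y i)) = t * ε ^ 2 * y i ^ 2 := fun i => by ring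
  have h3 : ∀ i, Complex.I * (x i * y i) = Complex.I * y i * x i := fun i => by ring
  simp only [h1, h2, h3, neg_mul, Finset.sum_neg_distrib]
  ring

theorem continuous_gaussKernel (S T : ℝ) (w b : Pt n) :
    Continuous fun q : Pt n × Pt n => gaussKernel S T w b q.1 q.2 := by
  unfold gaussKernel
  fun_prop

/-- The coupling exp(-ixy) has modulus one, so in norm the two variables separate. -/
theorem norm_gaussKernel (S T : ℝ) (w b x y : Pt n) :
    ‖gaussKernel S T w b x y‖
      = ‖Complex.exp (-(S : ℂ) * ∑ i, (x i : ℂ) ^ 2 + ∑ i, (w i : ℂ) * x i)‖ *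
        ‖Complex.exp (-(T : ℂ) * ∑ i, (y i : ℂ) ^ 2 + ∑ i, (b i : ℂ) * y i)‖ := by
  rw [gaussKernel, norm_mul]
  congr 1
  rw [Complex.norm_exp, Complex.norm_exp]
  congr 1
  simp only [sub_mul, Finset.sum_sub_distrib, Complex.add_re, Complex.sub_re]
  have : (∑ i, Complex.I * (y i : ℂ) * x i).re = 0 := by
    rw [Complex.re_sum]
    refine Finset.sum_eq_zero fun i _ => ?_
    simp
  rw [this, sub_zero]

theorem integrable_gaussKernel {S T : ℝ} (hS : 0 < S) (hT : 0 < T) (w b : Pt n) :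
    Integrable fun q : Pt n × Pt n => gaussKernel S T w b q.1 q.2 := by
  have h1 := (GaussianFourier.integrable_cexp_neg_mul_sum_add (b := (S : ℂ)) (by simpa using hS)
    (fun i => (w i : ℂ))).norm
  have h2 := (GaussianFourier.integrable_cexp_neg_mul_sum_add (b := (T : ℂ)) (by simpa using hT)
    (fun i => (b i : ℂ))).norm
  refine (h1.mul_prod h2).mono' (continuous_gaussKernel S T w b).aestronglyMeasurable
    (ae_of_all _ fun q => ?_)
  rw [norm_gaussKernel]

/-- The product of the two Gaussian variances is (2π)²/(1 + 4ST): the powers of 2π cancel and the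
rest tends to 1 with the regulator. -/
theorem gaussian_prefactor {S T : ℝ} (hS : 0 < S) (hT : 0 < T) :
    ((((2 * Real.pi) ^ (n + 1))⁻¹ : ℝ) : ℂ) *
      (((Real.pi : ℂ) / S) ^ ((Fintype.card (Fin (n + 1)) : ℂ) / 2) *
        ((Real.pi : ℂ) / ((T + 1 / (4 * S) : ℝ) : ℂ)) ^ ((Fintype.card (Fin (n + 1)) : ℂ) / 2))
      = (((1 + 4 * S * T) ^ (-((n + 1 : ℝ) / 2)) : ℝ) : ℂ) := by
  have hB : 0 < T + 1 / (4 * S) := by positivity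
  have hD : 0 < 1 + 4 * S * T := by positivity
  have e : ((Fintype.card (Fin (n + 1)) : ℂ) / 2) = (((n + 1 : ℝ) / 2 : ℝ) : ℂ) := by
    rw [Fintype.card_fin]; push_cast; ring
  rw [e, ← Complex.ofReal_div, ← Complex.ofReal_div, ← Complex.ofReal_cpow (by positivity),
    ← Complex.ofReal_cpow (by positivity), ← Complex.ofReal_mul, ← Complex.ofReal_mul]
  congr 1
  rw [← Real.mul_rpow (by positivity) (by positivity)]
  have h1 : Real.pi / S * (Real.pi / (T + 1 / (4 * S)))
      = (2 * Real.pi) ^ (2 : ℝ) * (1 + 4 * S * T)⁻¹ := by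
    rw [Real.rpow_two]
    field_simp
    ring
  rw [h1, Real.mul_rpow (by positivity) (by positivity), ← Real.rpow_mul (by positivity),
    Real.inv_rpow hD.le, Real.rpow_neg hD.le]
  have h2 : (2 : ℝ) * ((n + 1) / 2) = ((n + 1 : ℕ) : ℝ) := by push_cast; ring
  rw [h2, Real.rpow_natCast]
  have := Real.pi_pos
  field_simp

/-- Complete the square in x, then in y. The cross term of w and b would contribute a phase exp(-i
w·b/(1 + 4ST)), surviving in the limit; `hwb` removes it. -/
theorem integral_gaussKernel {S T : ℝ} (hS : 0 < S) (hT : 0 < T) {w b : Pt n} (hwb : w ⬝ᵥ b = 0)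
    (z : Pt n) :
    ((((2 * Real.pi) ^ (n + 1))⁻¹ : ℝ) : ℂ) * ∫ q : Pt n × Pt n,
      gaussKernel S T w b q.1 q.2 * Complex.exp (Complex.I * ((q.2 ⬝ᵥ z : ℝ) : ℂ))
      = weylSymbol S T w b z := by
  have hB : 0 < T + 1 / (4 * S) := by positivity
  have hD : (1 + 4 * S * T : ℂ) ≠ 0 := by
    have : 0 < 1 + 4 * S * T := by positivity
    exact_mod_cast this.ne'
  have hSc : (S : ℂ) ≠ 0 := by exact_mod_cast hS.ne'
  have hint : Integrable fun q : Pt n × Pt n =>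
      gaussKernel S T w b q.1 q.2 * Complex.exp (Complex.I * ((q.2 ⬝ᵥ z : ℝ) : ℂ)) := by
    refine (integrable_gaussKernel hS hT w b).mul_bdd (c := 1) ?_
      (ae_of_all _ fun q => norm_character _ _)
    refine Continuous.aestronglyMeasurable ?_
    simp only [dotProduct]
    fun_prop
  -- Integrating out x produces the extra |y|²/(4S), hence the new width T + 1/(4S).
  have hx : ∀ y : Pt n, ∫ x : Pt n,
      gaussKernel S T w b x y * Complex.exp (Complex.I * ((y ⬝ᵥ z : ℝ) : ℂ))
      = ((Real.pi : ℂ) / S) ^ ((Fintype.card (Fin (n + 1)) : ℂ) / 2) *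
        Complex.exp ((∑ i, (w i : ℂ) ^ 2) / (4 * S)) *
        Complex.exp (-((T + 1 / (4 * S) : ℝ) : ℂ) * ∑ i, (y i : ℂ) ^ 2
          + ∑ i, ((b i : ℂ) + Complex.I * z i - Complex.I * w i / (2 * S)) * y i) := by
    intro y
    simp only [gaussKernel, mul_assoc]
    rw [integral_mul_const, GaussianFourier.integral_cexp_neg_mul_sum_add (b := (S : ℂ))
      (by simpa using hS) (fun i => (w i : ℂ) - Complex.I * y i), mul_assoc, ← Complex.exp_add,
      ← Complex.exp_add, ← Complex.exp_add]
    congr 2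
    simp only [dotProduct]
    push_cast
    simp only [Finset.mul_sum, Finset.sum_div, ← Finset.sum_add_distrib]
    refine Finset.sum_congr rfl fun i _ => ?_
    field_simp
    linear_combination (2 * (y i : ℂ) ^ 2) * Complex.I_sq
  rw [Measure.volume_eq_prod] at hint ⊢
  rw [integral_prod_symm _ hint]
  simp only [hx]
  rw [integral_const_mul, GaussianFourier.integral_cexp_neg_mul_sum_add
    (b := ((T + 1 / (4 * S) : ℝ) : ℂ)) (by rw [Complex.ofReal_re]; exact hB)]
  rw [weylSymbol, ← gaussian_prefactor hS hT]
  have hexp : (S * ∑ i, ((b i : ℂ) + Complex.I * z i) ^ 2 + ∑ i, (w i : ℂ) * z i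
      + T * ∑ i, (w i : ℂ) ^ 2) / ((1 + 4 * S * T : ℝ) : ℂ)
      = (∑ i, (w i : ℂ) ^ 2) / (4 * S)
        + (∑ i, ((b i : ℂ) + Complex.I * z i - Complex.I * w i / (2 * S)) ^ 2)
          / (4 * ((T + 1 / (4 * S) : ℝ) : ℂ)) := by
    have h0 : (∑ i, (w i : ℂ) * b i) = 0 := by
      have := congrArg (fun r : ℝ => (r : ℂ)) hwb
      simpa [dotProduct] using this
    have h1 : ∀ i, ((b i : ℂ) + Complex.I * z i - Complex.I * w i / (2 * S)) ^ 2
        = ((b i : ℂ) + Complex.I * z i) ^ 2 - (Complex.I / S) * (w i * b i)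
          + (1 / S) * (w i * z i) - (1 / (4 * S ^ 2)) * (w i : ℂ) ^ 2 := by
      intro i
      field_simp
      linear_combination (4 * (w i : ℂ) ^ 2 - 16 * S * (w i * z i)) * Complex.I_sq
    simp only [h1, Finset.sum_sub_distrib, Finset.sum_add_distrib, ← Finset.mul_sum, h0]
    have h4 : (4 : ℂ) * ((T + 1 / (4 * S) : ℝ) : ℂ) = (1 + 4 * S * T) / S := by
      push_cast
      field_simp
      ring
    have h5 : ((1 + 4 * S * T : ℝ) : ℂ) = 1 + 4 * S * T := by push_cast; ring
    rw [h4, h5]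
    generalize (∑ i, ((b i : ℂ) + Complex.I * z i) ^ 2) = A₁
    generalize (∑ i, (w i : ℂ) * z i) = A₂
    generalize (∑ i, (w i : ℂ) ^ 2) = A₃
    generalize hd : (1 + 4 * S * T : ℂ) = D at hD
    have hT' : (T : ℂ) = (D - 1) / (4 * S) := by rw [← hd]; field_simp; ring
    rw [hT']
    field_simp
    ring
  rw [hexp, Complex.exp_add]
  ring

theorem continuous_weylSymbol (S T : ℝ) (w b : Pt n) : Continuous (weylSymbol S T w b) := by
  unfold weylSymbol
  fun_prop

/-- The bound is uniform in the regulator. Division by 1 + 4ST ≥ 1 can bring w·z closer to 0 but not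
beyond it, so exp(max(0, w·z)) ≤ 1 + exp(w·z) is a majorant that is in L² together with the
exponential. -/
theorem norm_weylSymbol_le {S T : ℝ} (hS : 0 ≤ S) (hS1 : S ≤ 1) (hT : 0 ≤ T) (hT1 : T ≤ 1)
    (w b z : Pt n) :
    ‖weylSymbol S T w b z‖ ≤ Real.exp (∑ i, b i ^ 2 + ∑ i, w i ^ 2) * (1 + ‖expFun w z‖) := by
  have hD : 1 ≤ 1 + 4 * S * T := by have := mul_nonneg hS hT; linarith
  have h1 : (1 + 4 * S * T) ^ (-((n + 1 : ℝ) / 2)) ≤ 1 :=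
    Real.rpow_le_one_of_one_le_of_nonpos hD (by rw [neg_nonpos]; positivity)
  have h0 : 0 ≤ (1 + 4 * S * T) ^ (-((n + 1 : ℝ) / 2)) := Real.rpow_nonneg (by linarith) _
  have hre : ((S * ∑ i, ((b i : ℂ) + Complex.I * z i) ^ 2 + ∑ i, (w i : ℂ) * z i
      + T * ∑ i, (w i : ℂ) ^ 2) / ((1 + 4 * S * T : ℝ) : ℂ)).re
      = (S * ∑ i, (b i ^ 2 - z i ^ 2) + w ⬝ᵥ z + T * ∑ i, w i ^ 2) / (1 + 4 * S * T) := by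
    have e1 : (∑ i, ((b i : ℂ) + Complex.I * z i) ^ 2).re = ∑ i, (b i ^ 2 - z i ^ 2) := by
      rw [Complex.re_sum]
      refine Finset.sum_congr rfl fun i _ => ?_
      simp [pow_two]
    have e2 : (∑ i, (w i : ℂ) * z i).re = w ⬝ᵥ z := by
      rw [Complex.re_sum]
      refine Finset.sum_congr rfl fun i _ => ?_
      simp
    have e3 : (∑ i, (w i : ℂ) ^ 2).re = ∑ i, w i ^ 2 := by
      rw [Complex.re_sum]
      refine Finset.sum_congr rfl fun i _ => ?_
      rw [← Complex.ofReal_pow, Complex.ofReal_re]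
    rw [Complex.div_ofReal_re]
    simp only [Complex.add_re, Complex.re_ofReal_mul, e1, e2, e3]
  rw [weylSymbol, norm_mul, Complex.norm_real, Real.norm_eq_abs, abs_of_nonneg h0,
    Complex.norm_exp, hre, norm_expFun]
  have hb : 0 ≤ ∑ i, b i ^ 2 := Finset.sum_nonneg fun i _ => sq_nonneg _
  have hw : 0 ≤ ∑ i, w i ^ 2 := Finset.sum_nonneg fun i _ => sq_nonneg _
  have hz : 0 ≤ ∑ i, z i ^ 2 := Finset.sum_nonneg fun i _ => sq_nonneg _
  have h3 : (S * ∑ i, (b i ^ 2 - z i ^ 2) + w ⬝ᵥ z + T * ∑ i, w i ^ 2) / (1 + 4 * S * T)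
      ≤ (∑ i, b i ^ 2 + ∑ i, w i ^ 2) + max 0 (w ⬝ᵥ z) := by
    rw [div_le_iff₀ (by linarith), Finset.sum_sub_distrib]
    have hm : 0 ≤ max 0 (w ⬝ᵥ z) := le_max_left _ _
    have hm2 : w ⬝ᵥ z ≤ max 0 (w ⬝ᵥ z) := le_max_right _ _
    have := mul_le_of_le_one_left hb hS1
    have := mul_le_of_le_one_left hw hT1
    have := mul_nonneg hS hz
    have : 0 ≤ (∑ i, b i ^ 2 + ∑ i, w i ^ 2 + max 0 (w ⬝ᵥ z)) * (4 * S * T) := by positivity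
    linarith
  calc (1 + 4 * S * T) ^ (-((n + 1 : ℝ) / 2)) *
        Real.exp ((S * ∑ i, (b i ^ 2 - z i ^ 2) + w ⬝ᵥ z + T * ∑ i, w i ^ 2) / (1 + 4 * S * T))
      ≤ 1 * Real.exp ((∑ i, b i ^ 2 + ∑ i, w i ^ 2) + max 0 (w ⬝ᵥ z)) := by gcongr
    _ = Real.exp (∑ i, b i ^ 2 + ∑ i, w i ^ 2) * Real.exp (max 0 (w ⬝ᵥ z)) := by
        rw [one_mul, Real.exp_add]
    _ ≤ _ := by
        gcongr
        rcases max_choice 0 (w ⬝ᵥ z) with h | h <;> rw [h]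
        · rw [Real.exp_zero]; linarith [Real.exp_pos (w ⬝ᵥ z)]
        · linarith

theorem tendsto_weylSymbol (s t : ℝ) (w b z : Pt n) :
    Tendsto (fun ε : ℝ => weylSymbol (s * ε ^ 2) (t * ε ^ 2) w b z) (𝓝[>] 0)
      (𝓝 (expFun w z)) := by
  have h : ContinuousAt (fun ε : ℝ => weylSymbol (s * ε ^ 2) (t * ε ^ 2) w b z) 0 := by
    unfold weylSymbol
    have h1 : ContinuousAt (fun ε : ℝ =>
        (1 + 4 * (s * ε ^ 2) * (t * ε ^ 2)) ^ (-((n + 1 : ℝ) / 2))) 0 := by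
      refine ContinuousAt.rpow_const (by fun_prop) (Or.inl (by simp))
    refine ContinuousAt.mul (Complex.continuous_ofReal.continuousAt.comp h1) ?_
    refine Complex.continuous_exp.continuousAt.comp ?_
    refine ContinuousAt.div (by fun_prop) (by fun_prop) (by simp)
  have h2 : weylSymbol (s * 0 ^ 2) (t * 0 ^ 2) w b z = expFun w z := by
    simp [weylSymbol, expFun, dotProduct]
  rw [← h2]
  exact h.tendsto.mono_left nhdsWithin_le_nhds

theorem PVM.tendsto_integ_weylSymbol (E : PVM n) {s t : ℝ} (hs : 0 < s) (ht : 0 < t)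
    {w : Pt n} (b : Pt n) {ψ : Hilb n} (h : MemLp (expFun w) 2 (E.measure ψ)) :
    Tendsto (fun ε : ℝ => E.integ (weylSymbol (s * ε ^ 2) (t * ε ^ 2) w b) ψ) (𝓝[>] 0)
      (𝓝 (E.integ (expFun w) ψ)) := by
  -- For ε ≤ δ both regularization parameters are at most 1, where the uniform bound is valid.
  obtain ⟨δ, hδ, hδs, hδt⟩ : ∃ δ : ℝ, 0 < δ ∧ s * δ ^ 2 ≤ 1 ∧ t * δ ^ 2 ≤ 1 := by
    refine ⟨min (Real.sqrt s⁻¹) (Real.sqrt t⁻¹), by positivity, ?_, ?_⟩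
    · calc s * min (Real.sqrt s⁻¹) (Real.sqrt t⁻¹) ^ 2 ≤ s * Real.sqrt s⁻¹ ^ 2 := by
            gcongr; exact min_le_left _ _
        _ = 1 := by rw [Real.sq_sqrt (by positivity)]; field_simp
    · calc t * min (Real.sqrt s⁻¹) (Real.sqrt t⁻¹) ^ 2 ≤ t * Real.sqrt t⁻¹ ^ 2 := by
            gcongr; exact min_le_right _ _
        _ = 1 := by rw [Real.sq_sqrt (by positivity)]; field_simp
  -- Clamping ε to [0, δ] changes nothing near 0 and makes the majorant valid for every index, as
  -- dominated convergence is set up here.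
  have hev : ∀ᶠ ε : ℝ in 𝓝[>] 0, ε = max 0 (min ε δ) := by
    filter_upwards [Ioo_mem_nhdsGT hδ] with ε hε
    rw [min_eq_left hε.2.le, max_eq_right hε.1.le]
  have key : Tendsto (fun ε : ℝ => E.integ
      (weylSymbol (s * max 0 (min ε δ) ^ 2) (t * max 0 (min ε δ) ^ 2) w b) ψ) (𝓝[>] 0)
      (𝓝 (E.integ (expFun w) ψ)) := by
    have hb1 : ∀ ε : ℝ, max 0 (min ε δ) ^ 2 ≤ δ ^ 2 := fun ε => by
      have : max 0 (min ε δ) ≤ δ := max_le hδ.le (min_le_right _ _)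
      gcongr
    have hb : MemLp (fun z => Real.exp (∑ i, b i ^ 2 + ∑ i, w i ^ 2) * (1 + ‖expFun w z‖)) 2
        (E.measure ψ) := ((memLp_const (1 : ℝ)).add h.norm).const_mul _
    have hfm : ∀ ε : ℝ, Measurable
        (weylSymbol (s * max 0 (min ε δ) ^ 2) (t * max 0 (min ε δ) ^ 2) w b) :=
      fun ε => (continuous_weylSymbol _ _ w b).measurable
    refine E.tendsto_integ_of_dominated
      (f := fun ε : ℝ => weylSymbol (s * max 0 (min ε δ) ^ 2) (t * max 0 (min ε δ) ^ 2) w b)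
      (fun z => Real.exp (∑ i, b i ^ 2 + ∑ i, w i ^ 2) * (1 + ‖expFun w z‖))
      hfm (continuous_expFun w).measurable hb (fun ε z => ?_) (fun z => ?_) (fun z => ?_)
    · refine norm_weylSymbol_le (by positivity) ?_ (by positivity) ?_ w b z
      · exact (mul_le_mul_of_nonneg_left (hb1 ε) hs.le).trans hδs
      · exact (mul_le_mul_of_nonneg_left (hb1 ε) ht.le).trans hδt
    · have h1 : 1 ≤ Real.exp (∑ i, b i ^ 2 + ∑ i, w i ^ 2) :=
        Real.one_le_exp (add_nonneg (Finset.sum_nonneg fun i _ => sq_nonneg _)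
          (Finset.sum_nonneg fun i _ => sq_nonneg _))
      have h2 := norm_nonneg (expFun w z)
      nlinarith
    · refine (tendsto_weylSymbol s t w b z).congr' ?_
      filter_upwards [hev] with ε hε
      rw [← hε]
  refine key.congr' ?_
  filter_upwards [hev] with ε hε
  rw [← hε]

/-- Fatou: the L² norms of the symbols are the norms of convergent vectors, and the symbols converge
pointwise to the exponential along ε = 1/(k + 1). -/
theorem PVM.memLp_expFun_of_tendsto (E : PVM n) {s t : ℝ} {w : Pt n} (b : Pt n) {ψ v : Hilb n}
    (hm : ∀ ε : ℝ, 0 < ε → MemLp (weylSymbol (s * ε ^ 2) (t * ε ^ 2) w b) 2 (E.measure ψ))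
    (h : Tendsto (fun ε : ℝ => E.integ (weylSymbol (s * ε ^ 2) (t * ε ^ 2) w b) ψ) (𝓝[>] 0)
      (𝓝 v)) : MemLp (expFun w) 2 (E.measure ψ) := by
  have hε : Tendsto (fun k : ℕ => ((k : ℝ) + 1)⁻¹) atTop (𝓝[>] 0) := by
    refine tendsto_nhdsWithin_iff.2 ⟨?_, Eventually.of_forall fun k => ?_⟩
    · simpa using tendsto_one_div_add_atTop_nhds_zero_nat (𝕜 := ℝ)
    · exact Set.mem_Ioi.2 (by positivity)
  refine ⟨(continuous_expFun w).measurable.aestronglyMeasurable, ?_⟩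
  refine (Lp.eLpNorm_lim_le_liminf_eLpNorm
    (f := fun k : ℕ => weylSymbol (s * ((k : ℝ) + 1)⁻¹ ^ 2) (t * ((k : ℝ) + 1)⁻¹ ^ 2) w b)
    (fun k => (continuous_weylSymbol _ _ w b).aestronglyMeasurable) _
    (ae_of_all _ fun z => (tendsto_weylSymbol s t w b z).comp hε)).trans_lt ?_
  have h2 := (continuous_enorm.tendsto v).comp (h.comp hε)
  have h3 : Tendsto (fun k : ℕ => eLpNorm
      (weylSymbol (s * ((k : ℝ) + 1)⁻¹ ^ 2) (t * ((k : ℝ) + 1)⁻¹ ^ 2) w b) 2 (E.measure ψ))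
      atTop (𝓝 ‖v‖ₑ) := by
    refine h2.congr fun k => ?_
    exact E.enorm_integ (hm _ (by positivity))
  rw [h3.liminf_eq]
  exact enorm_lt_top

/-- As the Fourier transform of an integrable kernel the symbol is bounded for each fixed regulator.
The regularized operators are therefore defined on every vector. -/
theorem exists_norm_weylSymbol_le {S T : ℝ} (hS : 0 < S) (hT : 0 < T) {w b : Pt n}
    (hwb : w ⬝ᵥ b = 0) : ∃ C, ∀ z, ‖weylSymbol S T w b z‖ ≤ C := by
  refine ⟨‖((((2 * Real.pi) ^ (n + 1))⁻¹ : ℝ) : ℂ)‖ *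
    ∫ q : Pt n × Pt n, ‖gaussKernel S T w b q.1 q.2‖, fun z => ?_⟩
  rw [← integral_gaussKernel hS hT hwb, norm_mul]
  gcongr
  refine norm_integral_le_of_norm_le (integrable_gaussKernel hS hT w b).norm
    (ae_of_all _ fun q => ?_)
  rw [norm_mul]
  exact mul_le_of_le_one_right (norm_nonneg _) (norm_character _ _)

variable {U : Pt n → (Hilb n ≃ₗᵢ[ℂ] Hilb n)} {E : PVM n}

theorem IsSpectralResolution.integral_gaussKernel_smul (h : IsSpectralResolution U E)
    (hU : ∀ ψ, Continuous fun p => U p ψ) {S T : ℝ} (hS : 0 < S) (hT : 0 < T) {w b : Pt n}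
    (hwb : w ⬝ᵥ b = 0) (ψ : Hilb n) :
    ((((2 * Real.pi) ^ (n + 1))⁻¹ : ℝ) : ℂ) •
      ∫ q : Pt n × Pt n, gaussKernel S T w b q.1 q.2 • U q.2 ψ
      = E.integ (weylSymbol S T w b) ψ := by
  obtain ⟨C, hC⟩ := exists_norm_weylSymbol_le hS hT hwb
  have hm := E.memLp_of_bound (continuous_weylSymbol S T w b).measurable hC ψ
  set c : ℂ := ((((2 * Real.pi) ^ (n + 1))⁻¹ : ℝ) : ℂ) with hc
  have hp : c ≠ 0 := by
    rw [hc, Complex.ofReal_ne_zero]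
    have := Real.pi_pos
    positivity
  rw [h.integral_smul hU (continuous_gaussKernel S T w b).measurable
    (integrable_gaussKernel hS hT w b) measurable_snd]
  have hw : (fun z => ∫ q : Pt n × Pt n,
        gaussKernel S T w b q.1 q.2 * Complex.exp (Complex.I * ((q.2 ⬝ᵥ z : ℝ) : ℂ)))
      = fun z => c⁻¹ * weylSymbol S T w b z := by
    funext z
    rw [← integral_gaussKernel hS hT hwb z, inv_mul_cancel_left₀ hp]
  rw [hw, E.integ_const_mul _ hm, smul_inv_smul₀ hp]

/-- `b` enters only through the squares (b + iz)², whose conjugates are (-b + iz)². -/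
theorem conj_weylSymbol (S T : ℝ) (w b z : Pt n) :
    conj (weylSymbol S T w b z) = weylSymbol S T w (-b) z := by
  simp only [weylSymbol, map_mul, Complex.conj_ofReal, ← Complex.exp_conj, map_div₀, map_add,
    map_sum, map_pow, Complex.conj_I, Pi.neg_apply, Complex.ofReal_neg]
  congr 6
  refine Finset.sum_congr rfl fun i _ => ?_
  ring

/-- The bounded symbol is moved onto `Ψ`, which reverses b; the limit does not see b, so only `Ψ`
has to lie in a domain. -/
theorem PVM.tendsto_inner_weylSymbol (E : PVM n) {s t : ℝ} (hs : 0 < s) (ht : 0 < t)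
    {w b : Pt n} (hwb : w ⬝ᵥ b = 0) {Ψ : Hilb n} (ψ : Hilb n)
    (h : MemLp (expFun w) 2 (E.measure Ψ)) :
    Tendsto (fun ε : ℝ => ⟪Ψ, E.integ (weylSymbol (s * ε ^ 2) (t * ε ^ 2) w b) ψ⟫_ℂ) (𝓝[>] 0)
      (𝓝 ⟪E.integ (expFun w) Ψ, ψ⟫_ℂ) := by
  refine ((E.tendsto_integ_weylSymbol hs ht (-b) h).inner tendsto_const_nhds).congr' ?_
  filter_upwards [self_mem_nhdsWithin] with ε hε
  have hε : 0 < ε := hε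
  obtain ⟨C, hC⟩ := exists_norm_weylSymbol_le (S := s * ε ^ 2) (T := t * ε ^ 2) (w := w) (b := -b)
    (by positivity) (by positivity) (by rw [dotProduct_neg, hwb, neg_zero])
  rw [E.inner_integ_left (continuous_weylSymbol _ _ w (-b)).measurable hC]
  simp only [conj_weylSymbol, neg_neg]

end Gaussian

/-! ### Integrals of families of Schwartz functions -/

section SchwartzIntegral

variable {n : ℕ} {P : Type*} [MeasurableSpace P]

/-- A family of Schwartz functions whose seminorms are dominated by integrable functions. -/
structure IntegrableFamily (ν : Measure P) (G : P → Sch n) : Prop where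
  aestronglyMeasurable : ∀ m x, AEStronglyMeasurable (fun p => iteratedFDeriv ℝ m (G p) x) ν
  bound : ∀ k m, ∃ B : P → ℝ, Integrable B ν ∧
    ∀ p x, ‖x‖ ^ k * ‖iteratedFDeriv ℝ m (G p) x‖ ≤ B p

variable {ν : Measure P} {G : P → Sch n}

theorem IntegrableFamily.integrable (h : IntegrableFamily ν G) (m : ℕ) (x : Pt n) :
    Integrable (fun p => iteratedFDeriv ℝ m (G p) x) ν := by
  obtain ⟨B, hB, hle⟩ := h.bound 0 m
  exact hB.mono' (h.aestronglyMeasurable m x) (ae_of_all _ fun p => by simpa using hle p x)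

theorem IntegrableFamily.hasFDerivAt (h : IntegrableFamily ν G) (m : ℕ) (x : Pt n) :
    HasFDerivAt (fun x => ∫ p, iteratedFDeriv ℝ m (G p) x ∂ν)
      (∫ p, iteratedFDeriv ℝ (m + 1) (G p) x ∂ν).curryLeft x := by
  obtain ⟨B, hB, hle⟩ := h.bound 0 (m + 1)
  let L := continuousMultilinearCurryLeftEquiv ℝ (fun _ : Fin (m + 1) => Pt n) ℂ
  have hd := hasFDerivAt_integral_of_dominated_of_fderiv_le (𝕜 := ℝ) (μ := ν)
    (F := fun x p => iteratedFDeriv ℝ m (G p) x)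
    (F' := fun x p => L (iteratedFDeriv ℝ (m + 1) (G p) x)) (x₀ := x) (s := Set.univ)
    (bound := B) univ_mem (Eventually.of_forall fun y => h.aestronglyMeasurable m y)
    (h.integrable m x)
    (L.continuous.comp_aestronglyMeasurable (h.aestronglyMeasurable (m + 1) x))
    (ae_of_all _ fun p y _ => by
      rw [LinearIsometryEquiv.norm_map]; simpa using hle p y) hB
    (ae_of_all _ fun p y _ => by
      have hdiff : DifferentiableAt ℝ (iteratedFDeriv ℝ m (G p)) y :=
        ((G p).smooth ⊤).differentiable_iteratedFDeriv (by exact_mod_cast ENat.natCast_lt_top m) y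
      have := hdiff.hasFDerivAt
      rwa [fderiv_iteratedFDeriv] at this)
  have hc : ∫ p, L (iteratedFDeriv ℝ (m + 1) (G p) x) ∂ν
      = L (∫ p, iteratedFDeriv ℝ (m + 1) (G p) x ∂ν) := by
    let L' : (Pt n [×(m + 1)]→L[ℝ] ℂ) →L[ℝ] (Pt n →L[ℝ] (Pt n [×m]→L[ℝ] ℂ)) :=
      L.toContinuousLinearEquiv.toContinuousLinearMap
    exact ContinuousLinearMap.integral_comp_comm (𝕜 := ℝ)
      (Fₗ := Pt n →L[ℝ] (Pt n [×m]→L[ℝ] ℂ)) L' (h.integrable (m + 1) x)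
  rw [hc] at hd
  exact hd

/-- Differentiation under the integral at every order. A formal Taylor series gives smoothness and
identifies all derivatives together. -/
theorem IntegrableFamily.hasFTaylorSeries (h : IntegrableFamily ν G) :
    HasFTaylorSeriesUpTo (⊤ : ℕ∞) (fun x => ∫ p, G p x ∂ν)
      (fun x m => ∫ p, iteratedFDeriv ℝ m (G p) x ∂ν) where
  zero_eq x := by
    rw [ContinuousMultilinearMap.curry0_apply, ContinuousMultilinearMap.integral_apply
      (h.integrable 0 x)]
    rfl
  fderiv m _ x := h.hasFDerivAt m x
  cont m _ := continuous_iff_continuousAt.2 fun x => (h.hasFDerivAt m x).continuousAt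

theorem IntegrableFamily.iteratedFDeriv_eq (h : IntegrableFamily ν G) (m : ℕ) (x : Pt n) :
    iteratedFDeriv ℝ m (fun x => ∫ p, G p x ∂ν) x = ∫ p, iteratedFDeriv ℝ m (G p) x ∂ν :=
  (h.hasFTaylorSeries.eq_iteratedFDeriv (by exact_mod_cast le_top) x).symm

/-- The integral of an integrable family of Schwartz functions. -/
def IntegrableFamily.integral (h : IntegrableFamily ν G) : Sch n where
  toFun x := ∫ p, G p x ∂ν
  smooth' := h.hasFTaylorSeries.contDiff
  decay' k m := by
    obtain ⟨B, hB, hle⟩ := h.bound k m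
    refine ⟨∫ p, B p ∂ν, fun x => ?_⟩
    rw [h.iteratedFDeriv_eq]
    calc ‖x‖ ^ k * ‖∫ p, iteratedFDeriv ℝ m (G p) x ∂ν‖
        ≤ ‖x‖ ^ k * ∫ p, ‖iteratedFDeriv ℝ m (G p) x‖ ∂ν := by
          gcongr; exact norm_integral_le_integral_norm _
      _ = ∫ p, ‖x‖ ^ k * ‖iteratedFDeriv ℝ m (G p) x‖ ∂ν := (integral_const_mul _ _).symm
      _ ≤ ∫ p, B p ∂ν :=
          integral_mono ((h.integrable m x).norm.const_mul _) hB (fun p => hle p x)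

theorem IntegrableFamily.momOp_integral_apply (h : IntegrableFamily ν G) (μ : Fin (n + 1))
    (x : Pt n) : momOp μ h.integral x = ∫ p, momOp μ (G p) x ∂ν := by
  simp only [momOp_apply]
  rw [integral_const_mul]
  congr 1
  have e : ∀ f : Pt n → ℂ, fderiv ℝ f x (Pi.single μ 1)
      = iteratedFDeriv ℝ 1 f x (fun _ => Pi.single μ 1) := fun f => by
    rw [iteratedFDeriv_one_apply]
  rw [e, show (⇑h.integral) = fun x => ∫ p, G p x ∂ν from rfl, h.iteratedFDeriv_eq,
    ContinuousMultilinearMap.integral_apply (h.integrable 1 x)]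
  simp only [e]

end SchwartzIntegral

/-! ### Smoothing along the dilations -/

section Smoothing

variable {n : ℕ}

open scoped ENNReal

/-- Weights that decay faster than all exponentials. -/
structure RapidWeight (a : Pt n) (k : Pt n → ℂ) : Prop where
  continuous : Continuous k
  integrable : ∀ c : ℝ, Integrable fun p => ‖k p‖ * Real.exp (c * growth a p)

theorem RapidWeight.integrable_self {a : Pt n} {k : Pt n → ℂ} (hk : RapidWeight a k) :
    Integrable k := by
  have := hk.integrable 0
  simp only [zero_mul, Real.exp_zero, mul_one] at this
  exact (integrable_norm_iff hk.continuous.aestronglyMeasurable).1 this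

/-- A derivative of a smoothed function reappears with its weight multiplied by such an exponential,
so the class of weights has to be closed under this. -/
theorem RapidWeight.mul_exp {a : Pt n} {k : Pt n → ℂ} (hk : RapidWeight a k) (μ : Fin (n + 1)) :
    RapidWeight a fun p => k p * (Real.exp (a μ * p μ) : ℂ) := by
  have hc : Continuous fun p => k p * (Real.exp (a μ * p μ) : ℂ) := by
    have := hk.continuous
    fun_prop
  refine ⟨hc, fun c => (hk.integrable (c + 1)).mono' ?_ (ae_of_all _ fun p => ?_)⟩
  · have := continuous_growth a
    exact Continuous.aestronglyMeasurable (by fun_prop)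
  · have h1 : a μ * p μ ≤ growth a p := (le_abs_self _).trans
      (Finset.single_le_sum (f := fun μ => |a μ * p μ|) (fun _ _ => abs_nonneg _)
        (Finset.mem_univ μ))
    simp only [norm_mul, abs_norm, Complex.norm_real, Real.norm_eq_abs, Real.abs_exp]
    rw [mul_assoc, ← Real.exp_add]
    gcongr
    linarith

theorem iteratedFDeriv_dilSch (a p : Pt n) (Φ : Sch n) (m : ℕ) (x : Pt n) :
    iteratedFDeriv ℝ m (dilSch a p Φ) x = (Real.exp (a ⬝ᵥ p / 2) : ℂ) •
      (iteratedFDeriv ℝ m Φ (dilate a p x)).compContinuousLinearMap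
        (fun _ => (dilate a p : Pt n →L[ℝ] Pt n)) := by
  have h1 : (⇑(dilSch a p Φ) : Pt n → ℂ)
      = (Real.exp (a ⬝ᵥ p / 2) : ℂ) • (Φ ∘ (dilate a p : Pt n →L[ℝ] Pt n)) := rfl
  rw [h1, iteratedFDeriv_const_smul_apply, ContinuousLinearMap.iteratedFDeriv_comp_right _
    (Φ.smooth m) x le_rfl]
  · rfl
  · exact (((Φ.smooth m).comp (dilate a p : Pt n →L[ℝ] Pt n).contDiff)).contDiffAt

theorem opNorm_dilate_le (a p : Pt n) :
    ‖(dilate a p : Pt n →L[ℝ] Pt n)‖ ≤ Real.exp (growth a p) :=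
  ContinuousLinearMap.opNorm_le_bound _ (Real.exp_pos _).le (norm_dilate_le a p)

/-- In the exponent, 1 pays for the prefactor, k for the polynomial weight and m for the chain rule.
-/
theorem norm_iteratedFDeriv_dilSch_le (a : Pt n) (Φ : Sch n) (k m : ℕ) : ∃ C, ∀ p x,
    ‖x‖ ^ k * ‖iteratedFDeriv ℝ m (dilSch a p Φ) x‖
      ≤ C * Real.exp ((1 + k + m) * growth a p) := by
  obtain ⟨C, hC⟩ := Φ.decay' k m
  refine ⟨C, fun p x => ?_⟩
  rw [iteratedFDeriv_dilSch, norm_smul, Complex.norm_real, Real.norm_eq_abs, Real.abs_exp]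
  have h1 := half_dotProduct_le_growth a p
  have h2 := ContinuousMultilinearMap.norm_compContinuousLinearMap_le
    (iteratedFDeriv ℝ m Φ (dilate a p x)) (fun _ => (dilate a p : Pt n →L[ℝ] Pt n))
  rw [Finset.prod_const, Finset.card_univ, Fintype.card_fin] at h2
  have h3 := opNorm_dilate_le a p
  have h4 := norm_le_exp_mul_dilate a p x
  set g := growth a p
  calc ‖x‖ ^ k * (Real.exp (a ⬝ᵥ p / 2) * ‖(iteratedFDeriv ℝ m Φ
          (dilate a p x)).compContinuousLinearMap (fun _ => (dilate a p : Pt n →L[ℝ] Pt n))‖)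
      ≤ (Real.exp g * ‖dilate a p x‖) ^ k *
          (Real.exp g * (‖iteratedFDeriv ℝ m Φ (dilate a p x)‖ * Real.exp g ^ m)) := by
        gcongr
        exact h2.trans (by gcongr)
    _ = (‖dilate a p x‖ ^ k * ‖iteratedFDeriv ℝ m Φ (dilate a p x)‖) *
          (Real.exp g * Real.exp g ^ k * Real.exp g ^ m) := by ring
    _ ≤ C * (Real.exp g * Real.exp g ^ k * Real.exp g ^ m) := by
        gcongr
        exact hC _
    _ = C * Real.exp ((1 + k + m) * g) := by
        rw [← Real.exp_nat_mul, ← Real.exp_nat_mul, ← Real.exp_add, ← Real.exp_add]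
        ring_nf

theorem continuous_dilate (a : Pt n) : Continuous fun p => (dilate a p : Pt n →L[ℝ] Pt n) := by
  rw [continuous_clm_apply]
  intro x
  refine continuous_pi fun μ => ?_
  simp only [ContinuousLinearEquiv.coe_coe, dilate_apply]
  fun_prop

theorem continuous_iteratedFDeriv_dilSch (a : Pt n) (Φ : Sch n) (m : ℕ) (x : Pt n) :
    Continuous fun p => iteratedFDeriv ℝ m (dilSch a p Φ) x := by
  simp only [iteratedFDeriv_dilSch]
  have h1 : Continuous fun p => (ContinuousMultilinearMap.compContinuousLinearMapContinuousMultilinear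
      ℝ (fun _ : Fin m => Pt n) (fun _ : Fin m => Pt n) ℂ)
        (fun _ => (dilate a p : Pt n →L[ℝ] Pt n)) :=
    (ContinuousMultilinearMap.cont _).comp (continuous_pi fun _ => continuous_dilate a)
  have h2 : Continuous fun p => iteratedFDeriv ℝ m Φ (dilate a p x) :=
    ((Φ.smooth m).continuous_iteratedFDeriv le_rfl).comp
      ((continuous_dilate a).clm_apply continuous_const)
  have h3 := h1.clm_apply h2
  simp only [ContinuousMultilinearMap.compContinuousLinearMapContinuousMultilinear_apply_apply]
    at h3
  have h4 : Continuous fun p : Pt n => ((Real.exp (a ⬝ᵥ p / 2) : ℝ) : ℂ) := by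
    simp only [dotProduct]
    fun_prop
  exact h4.smul h3

theorem RapidWeight.family {a : Pt n} {k : Pt n → ℂ} (hk : RapidWeight a k) (Φ : Sch n) :
    IntegrableFamily (volume : Measure (Pt n)) fun p => k p • dilSch a p Φ := by
  have e : ∀ m x p, iteratedFDeriv ℝ m (⇑(k p • dilSch a p Φ)) x
      = k p • iteratedFDeriv ℝ m (dilSch a p Φ) x := fun m x p => by
    rw [show (⇑(k p • dilSch a p Φ) : Pt n → ℂ) = k p • ⇑(dilSch a p Φ) from rfl,
      iteratedFDeriv_const_smul_apply ((dilSch a p Φ).smooth m).contDiffAt]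
  refine ⟨fun m x => ?_, fun l m => ?_⟩
  · simp only [e]
    exact (hk.continuous.smul (continuous_iteratedFDeriv_dilSch a Φ m x)).aestronglyMeasurable
  · obtain ⟨C, hC⟩ := norm_iteratedFDeriv_dilSch_le a Φ l m
    refine ⟨fun p => C * (‖k p‖ * Real.exp ((1 + l + m) * growth a p)),
      (hk.integrable _).const_mul C, fun p x => ?_⟩
    rw [e, norm_smul]
    calc ‖x‖ ^ l * (‖k p‖ * ‖iteratedFDeriv ℝ m (dilSch a p Φ) x‖)
        = ‖k p‖ * (‖x‖ ^ l * ‖iteratedFDeriv ℝ m (dilSch a p Φ) x‖) := by ring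
      _ ≤ ‖k p‖ * (C * Real.exp ((1 + l + m) * growth a p)) := by
          exact mul_le_mul_of_nonneg_left (hC p x) (norm_nonneg _)
      _ = _ := by ring

/-- The Schwartz function `∫ k(p) U(p)Φ dp`. -/
def RapidWeight.smooth {a : Pt n} {k : Pt n → ℂ} (hk : RapidWeight a k) (Φ : Sch n) : Sch n :=
  (hk.family Φ).integral

theorem RapidWeight.smooth_apply {a : Pt n} {k : Pt n → ℂ} (hk : RapidWeight a k) (Φ : Sch n)
    (x : Pt n) : hk.smooth Φ x = ∫ p, k p * dilSch a p Φ x := rfl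

theorem RapidWeight.momOp_smooth {a : Pt n} {k : Pt n → ℂ} (hk : RapidWeight a k) (Φ : Sch n)
    (μ : Fin (n + 1)) : momOp μ (hk.smooth Φ) = (hk.mul_exp μ).smooth (momOp μ Φ) := by
  ext x
  rw [RapidWeight.smooth, IntegrableFamily.momOp_integral_apply, RapidWeight.smooth_apply]
  refine integral_congr_ae (ae_of_all _ fun p => ?_)
  simp only
  rw [map_smul, momOp_dilSch]
  change k p * ((Real.exp (a μ * p μ) : ℂ) * dilSch a p (momOp μ Φ) x) = _
  rw [mul_assoc]

theorem RapidWeight.smooth_smul {a : Pt n} {k : Pt n → ℂ} (hk : RapidWeight a k) (c : ℂ)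
    (Φ : Sch n) : hk.smooth (c • Φ) = c • hk.smooth Φ := by
  ext x
  change hk.smooth (c • Φ) x = c * hk.smooth Φ x
  rw [smooth_apply, smooth_apply, ← integral_const_mul]
  refine integral_congr_ae (ae_of_all _ fun p => ?_)
  simp only [map_smul]
  change k p * (c * dilSch a p Φ x) = _
  ring

theorem RapidWeight.diffSq_smooth {a : Pt n} {k : Pt n → ℂ} (hk : RapidWeight a k) (q : Pt n)
    (μ ν : Fin (n + 1)) (Φ : Sch n) :
    diffSq a q μ ν (hk.smooth Φ) = ((hk.mul_exp ν).mul_exp μ).smooth (diffSq a q μ ν Φ) := by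
  simp only [diffSq, diffOp_eq, Module.End.mul_apply, LinearMap.smul_apply, momOp_smooth,
    map_smul, smooth_smul]

theorem toHilb_coeFn (Φ : Sch n) : toHilb Φ =ᵐ[volume] Φ := SchwartzMap.coeFn_toLp Φ 2 volume

theorem inner_toHilb (φ : Hilb n) (Φ : Sch n) :
    ⟪φ, toHilb Φ⟫_ℂ = ∫ x, Φ x * starRingEnd ℂ (φ x) := by
  rw [L2.inner_def]
  refine integral_congr_ae ?_
  filter_upwards [toHilb_coeFn Φ] with x hx
  rw [hx]
  rfl

/-- Identifies the pointwise integral with the Hilbert-space integral, by Fubini after pairing with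
an arbitrary vector. -/
theorem RapidWeight.toHilb_smooth {a : Pt n} {k : Pt n → ℂ} (hk : RapidWeight a k) (Φ : Sch n) :
    Integrable (fun p => k p • toHilb (dilSch a p Φ)) ∧
      toHilb (hk.smooth Φ) = ∫ p, k p • toHilb (dilSch a p Φ) := by
  obtain ⟨C, h0, hC⟩ := exists_norm_le_decay Φ
  have hnorm : ∃ K, ∀ p, ‖toHilb (dilSch a p Φ)‖ ≤ K * Real.exp ((n + 3) * growth a p) := by
    let d : Hilb n := memLp_decay.ofReal.toLp _
    refine ⟨C * ‖d‖, fun p => ?_⟩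
    rw [mul_right_comm]
    refine Lp.norm_le_mul_norm_of_ae_le_mul ?_
    filter_upwards [toHilb_coeFn (dilSch a p Φ), memLp_decay.ofReal (K := ℂ).coeFn_toLp]
      with x hx hd
    rw [hx, hd]
    refine (norm_dilSch_le a p hC h0 x).trans ?_
    simp [abs_of_pos (decay_pos x)]
  have hint : Integrable (fun p => k p • toHilb (dilSch a p Φ)) := by
    obtain ⟨K, hK⟩ := hnorm
    refine ((hk.integrable (n + 3)).const_mul K).mono'
      (hk.continuous.smul (continuous_toHilb_dilSch a Φ)).aestronglyMeasurable
      (ae_of_all _ fun p => ?_)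
    rw [norm_smul]
    calc ‖k p‖ * ‖toHilb (dilSch a p Φ)‖
        ≤ ‖k p‖ * (K * Real.exp ((n + 3) * growth a p)) := by gcongr; exact hK p
      _ = _ := by ring
  refine ⟨hint, ?_⟩
  refine ext_inner_left ℂ fun φ => ?_
  rw [inner_toHilb, ← integral_inner hint]
  simp only [inner_smul_right, inner_toHilb, smooth_apply, ← integral_const_mul,
    ← integral_mul_const]
  rw [integral_integral_swap]
  · simp only [mul_assoc]
  · have hφ : Integrable fun x => decay x * ‖φ x‖ :=
      memLp_decay.integrable_mul (Lp.memLp φ).norm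
    refine (hφ.mul_prod ((hk.integrable (n + 3)).const_mul C)).mono' ?_ (ae_of_all _ fun z => ?_)
    · have hk1 : Continuous fun z : Pt n × Pt n => k z.2 := hk.continuous.comp continuous_snd
      have hsw : Continuous fun z : Pt n × Pt n => (z.2, z.1) :=
        continuous_snd.prodMk continuous_fst
      have hd1 : Continuous fun z : Pt n × Pt n => dilSch a z.2 Φ z.1 := by
        have := (continuous_dilSch_apply a Φ).comp hsw
        exact this
      have h1 : Continuous fun z : Pt n × Pt n => k z.2 * dilSch a z.2 Φ z.1 := hk1.mul hd1
      have h2 : AEStronglyMeasurable (fun x => starRingEnd ℂ (φ x)) volume :=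
        Complex.continuous_conj.comp_aestronglyMeasurable (Lp.aestronglyMeasurable φ)
      have h3 : AEStronglyMeasurable (fun z : Pt n × Pt n => starRingEnd ℂ (φ z.1))
        (volume.prod volume) := h2.comp_fst
      have h4 : AEStronglyMeasurable (fun z : Pt n × Pt n => k z.2 * dilSch a z.2 Φ z.1)
        (volume.prod volume) := h1.aestronglyMeasurable
      exact h4.mul h3
    · simp only [Function.uncurry]
      rw [norm_mul, norm_mul, RCLike.norm_conj]
      calc ‖k z.2‖ * ‖dilSch a z.2 Φ z.1‖ * ‖φ z.1‖
          ≤ ‖k z.2‖ * (C * Real.exp ((n + 3) * growth a z.2) * decay z.1) * ‖φ z.1‖ := by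
            gcongr; exact norm_dilSch_le a z.2 hC h0 z.1
        _ = _ := by ring

/-- The normalized Gaussian weight whose transform is `exp(-δ|x|²)`. -/
def gaussWeight (n : ℕ) (δ : ℝ) (p : Pt n) : ℂ :=
  (((Real.pi : ℂ) / ((1 / (4 * δ) : ℝ) : ℂ)) ^ ((Fintype.card (Fin (n + 1)) : ℂ) / 2))⁻¹ *
    Complex.exp (-((1 / (4 * δ) : ℝ) : ℂ) * ∑ i, (p i : ℂ) ^ 2)

/-- The exponential of c∑|a_i p_i| always equals one of finitely many exponentials of linear forms,
one per choice of signs. A Gaussian times each of them is integrable, and the sum over all choices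
is a majorant. -/
theorem rapidWeight_gaussWeight (a : Pt n) {δ : ℝ} (hδ : 0 < δ) :
    RapidWeight a (gaussWeight n δ) := by
  have hc : Continuous (gaussWeight n δ) := by unfold gaussWeight; fun_prop
  refine ⟨hc, fun c => ?_⟩
  have hB : 0 < 1 / (4 * δ) := by positivity
  set N := (((Real.pi : ℂ) / ((1 / (4 * δ) : ℝ) : ℂ)) ^ ((Fintype.card (Fin (n + 1)) : ℂ) / 2))⁻¹
  have h1 : ∀ σ : Fin (n + 1) → Bool, Integrable fun p : Pt n =>
      ‖N‖ * ‖Complex.exp (-((1 / (4 * δ) : ℝ) : ℂ) * ∑ i, (p i : ℂ) ^ 2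
        + ∑ i, (((if σ i then c * a i else -(c * a i)) : ℝ) : ℂ) * p i)‖ := fun σ =>
    ((GaussianFourier.integrable_cexp_neg_mul_sum_add (b := ((1 / (4 * δ) : ℝ) : ℂ))
      (by rw [Complex.ofReal_re]; exact hB)
      (fun i => (((if σ i then c * a i else -(c * a i)) : ℝ) : ℂ))).norm).const_mul _
  refine (integrable_finsetSum Finset.univ fun σ _ => h1 σ).mono' ?_ (ae_of_all _ fun p => ?_)
  · have := continuous_growth a
    exact Continuous.aestronglyMeasurable (by fun_prop)
  · rw [Real.norm_eq_abs, abs_of_nonneg (by positivity)]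
    -- The signs for which the linear form attains the absolute values at this `p`.
    let σ : Fin (n + 1) → Bool := fun i => decide (0 ≤ a i * p i)
    refine le_trans (le_of_eq ?_) (Finset.single_le_sum (f := fun σ : Fin (n + 1) → Bool =>
      ‖N‖ * ‖Complex.exp (-((1 / (4 * δ) : ℝ) : ℂ) * ∑ i, (p i : ℂ) ^ 2
        + ∑ i, (((if σ i then c * a i else -(c * a i)) : ℝ) : ℂ) * p i)‖)
      (fun _ _ => by positivity) (Finset.mem_univ σ))
    simp only [gaussWeight, norm_mul]
    rw [mul_assoc, Complex.exp_add, norm_mul]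
    congr 2
    rw [Complex.norm_exp, Complex.re_sum]
    congr 1
    simp only [growth, Finset.mul_sum]
    refine Finset.sum_congr rfl fun i _ => ?_
    rw [Complex.re_ofReal_mul, Complex.ofReal_re]
    by_cases h : 0 ≤ a i * p i
    · simp only [σ, h, decide_true, if_true, abs_of_nonneg h]; ring
    · simp only [σ, h, decide_false, Bool.false_eq_true, if_false, abs_of_neg (not_le.1 h)]; ring

theorem integral_gaussWeight {δ : ℝ} (hδ : 0 < δ) (b x : Pt n) :
    ∫ p, gaussWeight n δ p * (Real.exp (b ⬝ᵥ p) : ℂ) * Complex.exp (Complex.I * ((p ⬝ᵥ x : ℝ) : ℂ))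
      = Complex.exp (δ * ∑ i, ((b i : ℂ) + Complex.I * x i) ^ 2) := by
  have hB : 0 < 1 / (4 * δ) := by positivity
  have h := GaussianFourier.integral_cexp_neg_mul_sum_add (b := ((1 / (4 * δ) : ℝ) : ℂ))
      (by rw [Complex.ofReal_re]; exact hB) (fun i => (b i : ℂ) + Complex.I * x i)
  have hN : ((Real.pi : ℂ) / ((1 / (4 * δ) : ℝ) : ℂ)) ^ ((Fintype.card (Fin (n + 1)) : ℂ) / 2)
      ≠ 0 := by
    rw [Complex.cpow_ne_zero_iff]
    left
    rw [← Complex.ofReal_div, Complex.ofReal_ne_zero]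
    have := Real.pi_pos
    positivity
  have e : ∀ p : Pt n, gaussWeight n δ p * (Real.exp (b ⬝ᵥ p) : ℂ) *
      Complex.exp (Complex.I * ((p ⬝ᵥ x : ℝ) : ℂ))
      = (((Real.pi : ℂ) / ((1 / (4 * δ) : ℝ) : ℂ)) ^ ((Fintype.card (Fin (n + 1)) : ℂ) / 2))⁻¹ *
        Complex.exp (-((1 / (4 * δ) : ℝ) : ℂ) * ∑ i, (p i : ℂ) ^ 2
          + ∑ i, ((b i : ℂ) + Complex.I * x i) * p i) := by
    intro p
    rw [gaussWeight, Complex.ofReal_exp, mul_assoc, mul_assoc, ← Complex.exp_add,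
      ← Complex.exp_add]
    congr 3
    simp only [dotProduct, Complex.ofReal_sum, Complex.ofReal_mul, Finset.mul_sum,
      ← Finset.sum_add_distrib]
    refine Finset.sum_congr rfl fun i _ => ?_
    ring
  simp only [e]
  rw [integral_const_mul, h, inv_mul_cancel_left₀ hN]
  congr 1
  push_cast
  have : (δ : ℂ) ≠ 0 := by exact_mod_cast hδ.ne'
  field_simp

end Smoothing

/-! ### The domain of the curved line-element -/

section Domain

variable {n : ℕ}

open scoped ENNReal ComplexConjugate

/-- The exponent of the `μ`-th diagonal entry of the deformed metric. -/
def warpExp (a : Pt n) (Θ : Matrix (Fin (n + 1)) (Fin (n + 1)) ℝ) (μ : Fin (n + 1)) : Pt n :=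
  fun ν => -2 * a μ * Θ μ ν

theorem warpExp_dotProduct (a : Pt n) (Θ : Matrix (Fin (n + 1)) (Fin (n + 1)) ℝ)
    (μ : Fin (n + 1)) (x : Pt n) : warpExp a Θ μ ⬝ᵥ x = -2 * a μ * (Θ *ᵥ x) μ := by
  simp only [warpExp, dotProduct, Matrix.mulVec, Finset.mul_sum, mul_assoc]

theorem deformedMetric_eq (a : Pt n) (Θ : Matrix (Fin (n + 1)) (Fin (n + 1)) ℝ) (x : Pt n)
    (μ ν : Fin (n + 1)) :
    (deformedMetric a Θ x μ ν : ℂ) = (eta n μ ν : ℂ) * expFun (warpExp a Θ μ) x := by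
  rw [deformedMetric, Matrix.of_apply, expFun, warpExp_dotProduct, mul_comm, Complex.ofReal_mul]

theorem eta_self_ne_zero (μ : Fin (n + 1)) : (eta n μ μ : ℂ) ≠ 0 := by
  rw [eta, Matrix.diagonal_apply_eq]
  split_ifs <;> simp

theorem eta_of_ne {μ ν : Fin (n + 1)} (h : μ ≠ ν) : eta n μ ν = 0 :=
  Matrix.diagonal_apply_ne _ h

theorem eta_ne_zero_iff {μ ν : Fin (n + 1)} : eta n μ ν ≠ 0 ↔ μ = ν := by
  refine ⟨fun h => by_contra fun h' => h (eta_of_ne h'), ?_⟩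
  rintro rfl
  exact_mod_cast eta_self_ne_zero μ

theorem continuous_deformedMetric (a : Pt n) (Θ : Matrix (Fin (n + 1)) (Fin (n + 1)) ℝ) :
    Continuous (deformedMetric a Θ) := by
  refine continuous_matrix fun μ ν => ?_
  simp only [deformedMetric, Matrix.of_apply, Matrix.mulVec, dotProduct]
  fun_prop

/-- Off-diagonal entries of the deformed metric vanish identically; they put no condition on the
domain. -/
theorem PVM.hasApply_zero_iff (E : PVM n) (ψ v : Hilb n) :
    E.HasApply (fun _ => 0) ψ v ↔ v = 0 := by
  rw [E.hasApply_iff measurable_const, E.integ_const, zero_smul]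
  exact and_iff_right (memLp_const 0)

theorem PVM.hasApply_const_mul_iff (E : PVM n) {c : ℂ} (hc : c ≠ 0) {f : Pt n → ℂ}
    (hf : Measurable f) (ψ v : Hilb n) :
    E.HasApply (fun x => c * f x) ψ v ↔ MemLp f 2 (E.measure ψ) ∧ v = c • E.integ f ψ := by
  rw [E.hasApply_iff (hf.const_mul c)]
  constructor
  · rintro ⟨h, rfl⟩
    have h' : MemLp f 2 (E.measure ψ) := by
      refine (h.const_mul c⁻¹).ae_eq (ae_of_all _ fun x => ?_)
      exact inv_mul_cancel_left₀ hc (f x)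
    exact ⟨h', E.integ_const_mul c h'⟩
  · rintro ⟨h, rfl⟩
    exact ⟨h.const_mul c, (E.integ_const_mul c h).symm⟩

/-- The domain and the values of the curved line-element. -/
theorem hasLineElement_deformedMetric_iff (a q : Pt n) (E : PVM n)
    (Θ : Matrix (Fin (n + 1)) (Fin (n + 1)) ℝ) (Φ : Sch n) (v : Hilb n) :
    HasLineElement a q E (deformedMetric a Θ) Φ v ↔
      (∀ μ, MemLp (expFun (warpExp a Θ μ)) 2 (E.measure (toHilb (diffSq a q μ μ Φ)))) ∧
        v = ∑ μ, (eta n μ μ : ℂ) • E.integ (expFun (warpExp a Θ μ)) (toHilb (diffSq a q μ μ Φ)) := by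
  simp only [HasLineElement, rep_dx, deformedMetric_eq]
  constructor
  · rintro ⟨w, hw, rfl⟩
    have hd : ∀ μ, MemLp (expFun (warpExp a Θ μ)) 2 (E.measure (toHilb (diffSq a q μ μ Φ))) ∧
        w μ μ = (eta n μ μ : ℂ) • E.integ (expFun (warpExp a Θ μ)) (toHilb (diffSq a q μ μ Φ)) :=
      fun μ => (E.hasApply_const_mul_iff (eta_self_ne_zero μ)
        (continuous_expFun _).measurable _ _).1 (hw μ μ)
    refine ⟨fun μ => (hd μ).1, Finset.sum_congr rfl fun μ _ => ?_⟩
    rw [← (hd μ).2]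
    refine Finset.sum_eq_single μ (fun ν _ h => ?_) (by simp)
    have := hw μ ν
    simp only [eta_of_ne h.symm, Complex.ofReal_zero, zero_mul] at this
    exact (E.hasApply_zero_iff _ _).1 this
  · rintro ⟨hd, rfl⟩
    refine ⟨fun μ ν => if μ = ν then (eta n μ μ : ℂ) •
      E.integ (expFun (warpExp a Θ μ)) (toHilb (diffSq a q μ μ Φ)) else 0, fun μ ν => ?_, ?_⟩
    · by_cases h : μ = ν
      · subst h
        simp only [if_true]
        exact (E.hasApply_const_mul_iff (eta_self_ne_zero μ)
          (continuous_expFun _).measurable _ _).2 ⟨hd μ, rfl⟩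
      · simp only [eta_of_ne h, Complex.ofReal_zero, zero_mul, if_neg h]
        exact (E.hasApply_zero_iff _ _).2 rfl
    · simp

/-- The transform of the Gaussian weight. -/
def smoothSymbol (δ : ℝ) (b x : Pt n) : ℂ :=
  Complex.exp (δ * ∑ i, ((b i : ℂ) + Complex.I * x i) ^ 2)

theorem continuous_smoothSymbol (δ : ℝ) (b : Pt n) : Continuous (smoothSymbol δ b) := by
  unfold smoothSymbol
  fun_prop

theorem norm_smoothSymbol (δ : ℝ) (b x : Pt n) :
    ‖smoothSymbol δ b x‖ = Real.exp (δ * (∑ i, (b i ^ 2 - x i ^ 2))) := by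
  rw [smoothSymbol, Complex.norm_exp, Complex.re_ofReal_mul, Complex.re_sum]
  congr 2
  refine Finset.sum_congr rfl fun i _ => ?_
  simp [pow_two]

theorem norm_smoothSymbol_le {δ : ℝ} (h0 : 0 ≤ δ) (h1 : δ ≤ 1) (b x : Pt n) :
    ‖smoothSymbol δ b x‖ ≤ Real.exp (∑ i, b i ^ 2) := by
  rw [norm_smoothSymbol, Real.exp_le_exp]
  have h2 : ∑ i, (b i ^ 2 - x i ^ 2) ≤ ∑ i, b i ^ 2 :=
    Finset.sum_le_sum fun i _ => by nlinarith [sq_nonneg (x i)]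
  have h3 : 0 ≤ ∑ i, b i ^ 2 := Finset.sum_nonneg fun i _ => sq_nonneg _
  calc δ * ∑ i, (b i ^ 2 - x i ^ 2) ≤ δ * ∑ i, b i ^ 2 := by gcongr
    _ ≤ 1 * ∑ i, b i ^ 2 := by gcongr
    _ = _ := one_mul _

theorem exists_norm_smoothSymbol_mul_expFun_le {δ : ℝ} (hδ : 0 < δ) (b w : Pt n) :
    ∃ C, ∀ x, ‖smoothSymbol δ b x * expFun w x‖ ≤ C := by
  -- The maximum of -δx² + wx is w²/(4δ), attained at x = w/(2δ).
  refine ⟨Real.exp (∑ i, (δ * b i ^ 2 + w i ^ 2 / (4 * δ))), fun x => ?_⟩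
  rw [norm_mul, norm_smoothSymbol, norm_expFun, ← Real.exp_add, Real.exp_le_exp, dotProduct,
    Finset.mul_sum, ← Finset.sum_add_distrib]
  refine Finset.sum_le_sum fun i _ => ?_
  have : 0 ≤ (2 * δ * x i - w i) ^ 2 / (4 * δ) := by positivity
  have h : (2 * δ * x i - w i) ^ 2 / (4 * δ) = δ * x i ^ 2 - w i * x i + w i ^ 2 / (4 * δ) := by
    field_simp
    ring
  nlinarith

/-- The spectral measure of f(X)ψ has density |f|², so the square of `g` is integrated against |f|²:
decay of `f` compensates growth of `g`. -/
theorem PVM.memLp_integ (E : PVM n) {f g : Pt n → ℂ} (hf : Measurable f) (hg : Measurable g)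
    {C : ℝ} {ψ : Hilb n} (hfL : MemLp f 2 (E.measure ψ)) (h : ∀ x, ‖f x * g x‖ ≤ C) :
    MemLp g 2 (E.measure (E.integ f ψ)) := by
  refine ⟨hg.aestronglyMeasurable, ?_⟩
  have h2 : eLpNorm g 2 (E.measure (E.integ f ψ)) ^ 2
      = eLpNorm (fun x => f x * g x) 2 (E.measure ψ) ^ 2 := by
    rw [eLpNorm_two_sq, eLpNorm_two_sq, E.measure_integ hfL,
      lintegral_withDensity_eq_lintegral_mul _ (hf.enorm.pow_const 2) (hg.enorm.pow_const 2)]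
    simp only [Pi.mul_apply, enorm_mul, mul_pow]
  rw [enorm_eq_of_sq h2]
  exact (E.memLp_of_bound (hf.mul hg) h ψ).2

theorem PVM.tendsto_integ_smoothSymbol (E : PVM n) (b : Pt n) (ψ : Hilb n) :
    Tendsto (fun k : ℕ => E.integ (smoothSymbol (1 / ((k : ℝ) + 1)) b) ψ) atTop (𝓝 ψ) := by
  have h := E.tendsto_integ_of_dominated (l := atTop) (ψ := ψ)
    (f := fun k : ℕ => smoothSymbol (1 / ((k : ℝ) + 1)) b) (g := fun _ => 1)
    (fun _ => Real.exp (∑ i, b i ^ 2)) (fun k => (continuous_smoothSymbol _ b).measurable)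
    measurable_const (memLp_const _)
    (fun k x => norm_smoothSymbol_le (by positivity)
      (by rw [div_le_one (by positivity)]; linarith [k.cast_nonneg (α := ℝ)]) b x)
    (fun x => by
      rw [norm_one]
      exact Real.one_le_exp (Finset.sum_nonneg fun i _ => sq_nonneg _))
    (fun x => by
      have : Continuous fun δ : ℝ => smoothSymbol δ b x := by unfold smoothSymbol; fun_prop
      have h2 := (this.tendsto 0).comp (tendsto_one_div_add_atTop_nhds_zero_nat (𝕜 := ℝ))
      simpa [smoothSymbol, Function.comp_def] using h2)
  rwa [E.integ_const, one_smul] at h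

variable {a q : Pt n} {U : Pt n → (Hilb n ≃ₗᵢ[ℂ] Hilb n)} {E : PVM n}

theorem toHilb_smooth_of_transform (hU : IsExpGroup (coordOp a) U)
    (hE : IsSpectralResolution U E) {k : Pt n → ℂ} (hk : RapidWeight a k) (Φ : Sch n) :
    toHilb (hk.smooth Φ)
      = E.integ (fun x => ∫ p, k p * Complex.exp (Complex.I * ((p ⬝ᵥ x : ℝ) : ℂ)))
        (toHilb Φ) := by
  rw [(hk.toHilb_smooth Φ).2]
  simp only [← hU.apply_toHilb]
  exact hE.integral_smul hU.continuous hk.continuous.measurable hk.integrable_self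
    measurable_id _

/-- Smoothing along the dilation group. -/
def smoothSeq (a : Pt n) (k : ℕ) (Φ : Sch n) : Sch n :=
  (rapidWeight_gaussWeight a (δ := 1 / ((k : ℝ) + 1)) (by positivity)).smooth Φ

theorem toHilb_smoothSeq (hU : IsExpGroup (coordOp a) U) (hE : IsSpectralResolution U E) (k : ℕ)
    (Φ : Sch n) :
    toHilb (smoothSeq a k Φ) = E.integ (smoothSymbol (1 / ((k : ℝ) + 1)) 0) (toHilb Φ) := by
  rw [smoothSeq, toHilb_smooth_of_transform hU hE]
  congr 1
  funext x
  have := integral_gaussWeight (δ := 1 / ((k : ℝ) + 1)) (by positivity) 0 x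
  simpa [smoothSymbol] using this

/-- The two derivatives multiply the Gaussian weight by exp(a_μ p_μ + a_ν p_ν), which shifts its
Fourier transform into the complex domain. -/
theorem toHilb_diffSq_smoothSeq (hU : IsExpGroup (coordOp a) U)
    (hE : IsSpectralResolution U E) (μ ν : Fin (n + 1)) (k : ℕ) (Φ : Sch n) :
    toHilb (diffSq a q μ ν (smoothSeq a k Φ))
      = E.integ (smoothSymbol (1 / ((k : ℝ) + 1)) (Pi.single μ (a μ) + Pi.single ν (a ν)))
        (toHilb (diffSq a q μ ν Φ)) := by
  rw [smoothSeq, RapidWeight.diffSq_smooth, toHilb_smooth_of_transform hU hE]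
  congr 1
  funext x
  rw [smoothSymbol, ← integral_gaussWeight (by positivity)]
  refine integral_congr_ae (ae_of_all _ fun p => ?_)
  simp only [add_dotProduct, single_dotProduct, Real.exp_add, Complex.ofReal_mul]
  ring

theorem tendsto_toHilb_smoothSeq (hU : IsExpGroup (coordOp a) U)
    (hE : IsSpectralResolution U E) (Φ : Sch n) :
    Tendsto (fun k => toHilb (smoothSeq a k Φ)) atTop (𝓝 (toHilb Φ)) := by
  simp only [toHilb_smoothSeq hU hE]
  exact E.tendsto_integ_smoothSymbol _ _

theorem tendsto_toHilb_diffSq_smoothSeq (hU : IsExpGroup (coordOp a) U)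
    (hE : IsSpectralResolution U E) (μ ν : Fin (n + 1)) (Φ : Sch n) :
    Tendsto (fun k => toHilb (diffSq a q μ ν (smoothSeq a k Φ))) atTop
      (𝓝 (toHilb (diffSq a q μ ν Φ))) := by
  simp only [toHilb_diffSq_smoothSeq hU hE]
  exact E.tendsto_integ_smoothSymbol _ _

/-- After smoothing the vector is a Gaussian function of X applied to a vector, hence in the domain
of every exponential. -/
theorem memLp_expFun_smoothSeq (hU : IsExpGroup (coordOp a) U)
    (hE : IsSpectralResolution U E) (w : Pt n) (μ ν : Fin (n + 1)) (k : ℕ) (Φ : Sch n) :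
    MemLp (expFun w) 2 (E.measure (toHilb (diffSq a q μ ν (smoothSeq a k Φ)))) := by
  rw [toHilb_diffSq_smoothSeq hU hE]
  have hk : (0 : ℝ) < 1 / ((k : ℝ) + 1) := by positivity
  obtain ⟨C, hC⟩ := exists_norm_smoothSymbol_mul_expFun_le hk
    (Pi.single μ (a μ) + Pi.single ν (a ν)) w
  refine E.memLp_integ (continuous_smoothSymbol _ _).measurable (continuous_expFun w).measurable
    (E.memLp_of_bound (continuous_smoothSymbol _ _).measurable
      (norm_smoothSymbol_le hk.le ?_ _) _) hC
  rw [div_le_one (by positivity)]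
  linarith [k.cast_nonneg (α := ℝ)]

theorem hasLineElement_smoothSeq (hU : IsExpGroup (coordOp a) U)
    (hE : IsSpectralResolution U E) (Θ : Matrix (Fin (n + 1)) (Fin (n + 1)) ℝ) (k : ℕ)
    (Φ : Sch n) : ∃ v, HasLineElement a q E (deformedMetric a Θ) (smoothSeq a k Φ) v :=
  ⟨_, (hasLineElement_deformedMetric_iff a q E Θ _ _).2
    ⟨fun _ => memLp_expFun_smoothSeq hU hE _ _ _ k Φ, rfl⟩⟩

theorem dense_lineElement_domain (hU : IsExpGroup (coordOp a) U)
    (hE : IsSpectralResolution U E) (Θ : Matrix (Fin (n + 1)) (Fin (n + 1)) ℝ) :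
    Dense {ψ : Hilb n | ∃ Φ v, toHilb Φ = ψ ∧
      HasLineElement a q E (deformedMetric a Θ) Φ v} := by
  refine dense_iff_closure_eq.2 (Set.eq_univ_of_univ_subset ?_)
  rw [← denseRange_toHilb.closure_range]
  refine closure_minimal ?_ isClosed_closure
  rintro _ ⟨Φ, rfl⟩
  refine mem_closure_of_tendsto (tendsto_toHilb_smoothSeq hU hE Φ) (Eventually.of_forall fun k => ?_)
  obtain ⟨v, hv⟩ := hasLineElement_smoothSeq (q := q) hU hE Θ k Φ
  exact ⟨_, v, rfl, hv⟩

end Domain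

/-! ### The warped convolution of the line-element -/

section Warped

variable {n : ℕ} {a q : Pt n} {U : Pt n → (Hilb n ≃ₗᵢ[ℂ] Hilb n)} {E : PVM n}

open scoped ENNReal ComplexConjugate

/-- The exponent of the second variable in the twisted matrix elements. -/
def shiftExp (a : Pt n) (μ : Fin (n + 1)) : Pt n := Pi.single μ (2 * a μ)

/-- Here skew-symmetry enters, through the vanishing diagonal entries of `Θ`. It is what makes the
regularized oscillatory integral free of a residual phase. -/
theorem warpExp_dotProduct_shiftExp (a : Pt n) {Θ : Matrix (Fin (n + 1)) (Fin (n + 1)) ℝ}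
    (hΘ : Θᵀ = -Θ) (μ : Fin (n + 1)) : warpExp a Θ μ ⬝ᵥ shiftExp a μ = 0 := by
  have h : Θ μ μ = 0 := by
    have := congrFun (congrFun hΘ μ) μ
    simp only [Matrix.transpose_apply, Matrix.neg_apply] at this
    linarith
  rw [shiftExp, dotProduct_single, warpExp, h, mul_zero, zero_mul]

theorem warp_factor (a : Pt n) (Θ : Matrix (Fin (n + 1)) (Fin (n + 1)) ℝ) (μ : Fin (n + 1))
    (x y : Pt n) :
    a μ * (y - Θ *ᵥ x) μ + a μ * (y - Θ *ᵥ x) μ = warpExp a Θ μ ⬝ᵥ x + shiftExp a μ ⬝ᵥ y := by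
  rw [warpExp_dotProduct, shiftExp, single_dotProduct, Pi.sub_apply]
  ring

/-- The conjugated diagonal operator on the orbit of a Schwartz function. -/
theorem IsExpGroup.conj_diffSq_self (h : IsExpGroup (coordOp a) U)
    (Θ : Matrix (Fin (n + 1)) (Fin (n + 1)) ℝ) (μ : Fin (n + 1)) (Φ : Sch n) (x y : Pt n) :
    U (Θ *ᵥ x) (toHilb (diffSq a q μ μ (dilSch a (y - Θ *ᵥ x) Φ)))
      = (Real.exp (warpExp a Θ μ ⬝ᵥ x + shiftExp a μ ⬝ᵥ y) : ℂ) •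
        U y (toHilb (diffSq a q μ μ Φ)) := by
  rw [h.conjApply_diffSq, warp_factor]

theorem IsExpGroup.conjApply_zero_iff (h : IsExpGroup (coordOp a) U) (p : Pt n) (A : SchOp n)
    (Φ : Sch n) (v : Hilb n) :
    ConjApply U p A (toHilb Φ) v ↔ v = U p (toHilb (A (dilSch a (0 - p) Φ))) := by
  rw [← h.conjApply_iff, h.apply_zero]

/-- The integrand in the definition is unique, because a vector of L² comes from at most one
Schwartz function. -/
theorem hasWarped_iff (h : IsExpGroup (coordOp a) U) (E : PVM n)
    (Θ : Matrix (Fin (n + 1)) (Fin (n + 1)) ℝ) (A : SchOp n) (Φ : Sch n) (v : Hilb n) :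
    HasWarped U E Θ A Φ v ↔ E.HasIntegral
      (fun x => U (Θ *ᵥ x) (toHilb (A (dilSch a (0 - Θ *ᵥ x) Φ)))) v := by
  simp only [HasWarped, h.conjApply_zero_iff]
  constructor
  · rintro ⟨F, hF, hv⟩
    rwa [funext hF] at hv
  · exact fun hv => ⟨_, fun _ => rfl, hv⟩

/-- The integrand is a scalar exponential times the fixed vector dX^μ dX^μ Φ, so the operator
integral is an exponential of X. -/
theorem hasWarped_diffSq_iff (h : IsExpGroup (coordOp a) U) (E : PVM n)
    (Θ : Matrix (Fin (n + 1)) (Fin (n + 1)) ℝ) (μ : Fin (n + 1)) (Φ : Sch n) (v : Hilb n) :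
    HasWarped U E Θ (diffSq a q μ μ) Φ v ↔
      MemLp (expFun (warpExp a Θ μ)) 2 (E.measure (toHilb (diffSq a q μ μ Φ))) ∧
        v = E.integ (expFun (warpExp a Θ μ)) (toHilb (diffSq a q μ μ Φ)) := by
  rw [hasWarped_iff h, ← E.hasApply_iff (continuous_expFun _).measurable,
    ← E.hasIntegral_expFun_iff]
  simp only [h.conj_diffSq_self, h.apply_zero, dotProduct_zero, add_zero]
  rfl

theorem hasOscWarped_iff (h : IsExpGroup (coordOp a) U)
    (Θ : Matrix (Fin (n + 1)) (Fin (n + 1)) ℝ) (A : SchOp n) (Φ : Sch n) (v : Hilb n) :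
    HasOscWarped U Θ A Φ v ↔ ∀ s t : ℝ, 0 < s → 0 < t →
      (∀ ε : ℝ, 0 < ε → Integrable (fun z : Pt n × Pt n => oscKernel s t ε z.1 z.2 •
        U (Θ *ᵥ z.1) (toHilb (A (dilSch a (z.2 - Θ *ᵥ z.1) Φ))))) ∧
      Tendsto (fun ε : ℝ => (((2 * Real.pi) ^ (n + 1))⁻¹ : ℝ) •
          ∫ z : Pt n × Pt n, oscKernel s t ε z.1 z.2 •
            U (Θ *ᵥ z.1) (toHilb (A (dilSch a (z.2 - Θ *ᵥ z.1) Φ)))) (𝓝[>] 0) (𝓝 v) := by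
  simp only [HasOscWarped, h.conjApply_iff]
  constructor
  · rintro ⟨F, hF, hv⟩
    rwa [show F = _ from funext fun x => funext (hF x)] at hv
  · exact fun hv => ⟨_, fun _ _ => rfl, hv⟩

theorem oscKernel_smul_diffSq (h : IsExpGroup (coordOp a) U)
    (Θ : Matrix (Fin (n + 1)) (Fin (n + 1)) ℝ) (μ : Fin (n + 1)) (Φ : Sch n) (s t ε : ℝ)
    (x y : Pt n) :
    oscKernel s t ε x y • U (Θ *ᵥ x) (toHilb (diffSq a q μ μ (dilSch a (y - Θ *ᵥ x) Φ)))
      = gaussKernel (s * ε ^ 2) (t * ε ^ 2) (warpExp a Θ μ) (shiftExp a μ) x y •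
        U y (toHilb (diffSq a q μ μ Φ)) := by
  rw [h.conj_diffSq_self, smul_smul, oscKernel_mul_exp]

theorem integrable_oscKernel_diffSq (h : IsExpGroup (coordOp a) U)
    (Θ : Matrix (Fin (n + 1)) (Fin (n + 1)) ℝ) (μ : Fin (n + 1)) (Φ : Sch n) {s t ε : ℝ}
    (hs : 0 < s) (ht : 0 < t) (hε : 0 < ε) :
    Integrable (fun z : Pt n × Pt n => oscKernel s t ε z.1 z.2 •
      U (Θ *ᵥ z.1) (toHilb (diffSq a q μ μ (dilSch a (z.2 - Θ *ᵥ z.1) Φ)))) := by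
  simp only [oscKernel_smul_diffSq h]
  exact integrable_smul_unitary h.continuous
    (integrable_gaussKernel (by positivity) (by positivity) _ _) measurable_snd _

theorem integral_oscKernel_diffSq (h : IsExpGroup (coordOp a) U)
    (hE : IsSpectralResolution U E) {Θ : Matrix (Fin (n + 1)) (Fin (n + 1)) ℝ} (hΘ : Θᵀ = -Θ)
    (μ : Fin (n + 1)) (Φ : Sch n) {s t ε : ℝ} (hs : 0 < s) (ht : 0 < t) (hε : 0 < ε) :
    ((((2 * Real.pi) ^ (n + 1))⁻¹ : ℝ) : ℂ) • ∫ z : Pt n × Pt n, oscKernel s t ε z.1 z.2 •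
      U (Θ *ᵥ z.1) (toHilb (diffSq a q μ μ (dilSch a (z.2 - Θ *ᵥ z.1) Φ)))
      = E.integ (weylSymbol (s * ε ^ 2) (t * ε ^ 2) (warpExp a Θ μ) (shiftExp a μ))
        (toHilb (diffSq a q μ μ Φ)) := by
  simp only [oscKernel_smul_diffSq h]
  exact hE.integral_gaussKernel_smul h.continuous (by positivity) (by positivity)
    (warpExp_dotProduct_shiftExp a hΘ μ) _

/-- Each regularized integral is `weylSymbol` applied to dX^μ dX^μ Φ. Convergence for one regulator
forces membership in the domain by Fatou; membership gives convergence for all regulators by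
domination. -/
theorem hasOscWarped_diffSq_iff (h : IsExpGroup (coordOp a) U)
    (hE : IsSpectralResolution U E) {Θ : Matrix (Fin (n + 1)) (Fin (n + 1)) ℝ} (hΘ : Θᵀ = -Θ)
    (μ : Fin (n + 1)) (Φ : Sch n) (v : Hilb n) :
    HasOscWarped U Θ (diffSq a q μ μ) Φ v ↔
      MemLp (expFun (warpExp a Θ μ)) 2 (E.measure (toHilb (diffSq a q μ μ Φ))) ∧
        v = E.integ (expFun (warpExp a Θ μ)) (toHilb (diffSq a q μ μ Φ)) := by
  have hlim : ∀ s t : ℝ, 0 < s → 0 < t → ∀ u : Hilb n,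
      (Tendsto (fun ε : ℝ => (((2 * Real.pi) ^ (n + 1))⁻¹ : ℝ) •
          ∫ z : Pt n × Pt n, oscKernel s t ε z.1 z.2 •
            U (Θ *ᵥ z.1) (toHilb (diffSq a q μ μ (dilSch a (z.2 - Θ *ᵥ z.1) Φ)))) (𝓝[>] 0) (𝓝 u)
      ↔ Tendsto (fun ε : ℝ => E.integ (weylSymbol (s * ε ^ 2) (t * ε ^ 2) (warpExp a Θ μ)
          (shiftExp a μ)) (toHilb (diffSq a q μ μ Φ))) (𝓝[>] 0) (𝓝 u)) := by
    intro s t hs ht u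
    refine tendsto_congr' ?_
    filter_upwards [self_mem_nhdsWithin] with ε hε
    rw [← integral_oscKernel_diffSq h hE hΘ μ Φ hs ht hε, Complex.coe_smul]
    rfl
  rw [hasOscWarped_iff h]
  constructor
  · intro hv
    have h1 := (hlim 1 1 one_pos one_pos v).1 (hv 1 1 one_pos one_pos).2
    have hm := E.memLp_expFun_of_tendsto (shiftExp a μ) (fun ε hε => by
      obtain ⟨C, hC⟩ := exists_norm_weylSymbol_le (S := 1 * ε ^ 2) (T := 1 * ε ^ 2)
        (by positivity) (by positivity) (warpExp_dotProduct_shiftExp a hΘ μ)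
      exact E.memLp_of_bound (continuous_weylSymbol _ _ _ _).measurable hC _) h1
    exact ⟨hm, tendsto_nhds_unique h1
      (E.tendsto_integ_weylSymbol one_pos one_pos (shiftExp a μ) hm)⟩
  · rintro ⟨hm, rfl⟩ s t hs ht
    exact ⟨fun ε hε => integrable_oscKernel_diffSq h Θ μ Φ hs ht hε,
      (hlim s t hs ht _).2 (E.tendsto_integ_weylSymbol hs ht (shiftExp a μ) hm)⟩

/-- Stated for an abstract deformation `W`, so that both forms of the warped convolution are covered
by one argument about diagonal sums. -/
theorem hasDeformedLineElement_iff {W : SchOp n → Sch n → Hilb n → Prop}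
    {Θ : Matrix (Fin (n + 1)) (Fin (n + 1)) ℝ} {Φ : Sch n}
    (hW : ∀ μ v, W (diffSq a q μ μ) Φ v ↔
      MemLp (expFun (warpExp a Θ μ)) 2 (E.measure (toHilb (diffSq a q μ μ Φ))) ∧
        v = E.integ (expFun (warpExp a Θ μ)) (toHilb (diffSq a q μ μ Φ))) (v : Hilb n) :
    HasDeformedLineElement a q W Φ v ↔ HasLineElement a q E (deformedMetric a Θ) Φ v := by
  rw [hasLineElement_deformedMetric_iff, HasDeformedLineElement]
  have hsum : ∀ w : Fin (n + 1) → Fin (n + 1) → Hilb n,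
      ∑ μ, ∑ ν, (eta n μ ν : ℂ) • w μ ν = ∑ μ, (eta n μ μ : ℂ) • w μ μ := by
    refine fun w => Finset.sum_congr rfl fun μ _ =>
      Finset.sum_eq_single μ (fun ν _ h => ?_) (by simp)
    rw [eta_of_ne h.symm, Complex.ofReal_zero, zero_smul]
  simp only [hsum, eta_ne_zero_iff, rep_dx]
  constructor
  · rintro ⟨w, hw, rfl⟩
    have := fun μ => (hW μ (w μ μ)).1 (hw μ μ rfl)
    exact ⟨fun μ => (this μ).1, Finset.sum_congr rfl fun μ _ => by rw [← (this μ).2]⟩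
  · rintro ⟨hm, rfl⟩
    refine ⟨fun μ _ => E.integ (expFun (warpExp a Θ μ)) (toHilb (diffSq a q μ μ Φ)), ?_, rfl⟩
    rintro μ _ rfl
    exact (hW μ _).2 ⟨hm μ, rfl⟩

theorem conj_lineElement (Θ : Matrix (Fin (n + 1)) (Fin (n + 1)) ℝ) (Φ : Sch n) (x y : Pt n) :
    U (Θ *ᵥ x) (toHilb (rep a q (lineElement a) (dilSch a (y - Θ *ᵥ x) Φ)))
      = ∑ μ, (eta n μ μ : ℂ) •
        U (Θ *ᵥ x) (toHilb (diffSq a q μ μ (dilSch a (y - Θ *ᵥ x) Φ))) := by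
  simp only [rep_lineElement, LinearMap.sum_apply, LinearMap.smul_apply, map_sum, map_smul]

/-- Additivity of the operator integral over the diagonal terms; it yields an implication, since it
starts from convergence of each term. -/
theorem hasWarped_lineElement (h : IsExpGroup (coordOp a) U)
    {Θ : Matrix (Fin (n + 1)) (Fin (n + 1)) ℝ} {Φ : Sch n} {v : Hilb n}
    (hv : HasLineElement a q E (deformedMetric a Θ) Φ v) :
    HasWarped U E Θ (rep a q (lineElement a)) Φ v := by
  obtain ⟨hm, rfl⟩ := (hasLineElement_deformedMetric_iff a q E Θ Φ v).1 hv
  rw [hasWarped_iff h]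
  simp only [conj_lineElement]
  refine PVM.HasIntegral.sum_smul Finset.univ _ fun μ _ => ?_
  exact (hasWarped_iff h E Θ _ _ _).1 ((hasWarped_diffSq_iff h E Θ μ Φ _).2 ⟨hm μ, rfl⟩)

theorem integrable_oscKernel_lineElement (h : IsExpGroup (coordOp a) U)
    (Θ : Matrix (Fin (n + 1)) (Fin (n + 1)) ℝ) (Φ : Sch n) {s t ε : ℝ}
    (hs : 0 < s) (ht : 0 < t) (hε : 0 < ε) :
    Integrable (fun z : Pt n × Pt n => oscKernel s t ε z.1 z.2 • U (Θ *ᵥ z.1)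
      (toHilb (rep a q (lineElement a) (dilSch a (z.2 - Θ *ᵥ z.1) Φ)))) := by
  simp only [conj_lineElement, Finset.smul_sum]
  refine integrable_finsetSum _ fun μ _ => ?_
  simp only [smul_comm (oscKernel _ _ _ _ _)]
  exact (integrable_oscKernel_diffSq h Θ μ Φ hs ht hε).smul (eta n μ μ : ℂ)

theorem integral_oscKernel_lineElement (h : IsExpGroup (coordOp a) U)
    (hE : IsSpectralResolution U E) {Θ : Matrix (Fin (n + 1)) (Fin (n + 1)) ℝ} (hΘ : Θᵀ = -Θ)
    (Φ : Sch n) {s t ε : ℝ} (hs : 0 < s) (ht : 0 < t) (hε : 0 < ε) :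
    ((((2 * Real.pi) ^ (n + 1))⁻¹ : ℝ) : ℂ) • ∫ z : Pt n × Pt n, oscKernel s t ε z.1 z.2 •
      U (Θ *ᵥ z.1) (toHilb (rep a q (lineElement a) (dilSch a (z.2 - Θ *ᵥ z.1) Φ)))
      = ∑ μ, (eta n μ μ : ℂ) •
        E.integ (weylSymbol (s * ε ^ 2) (t * ε ^ 2) (warpExp a Θ μ) (shiftExp a μ))
          (toHilb (diffSq a q μ μ Φ)) := by
  simp only [conj_lineElement, Finset.smul_sum, smul_comm (oscKernel _ _ _ _ _)]
  have hi : ∀ μ ∈ Finset.univ, Integrable fun z : Pt n × Pt n => (eta n μ μ : ℂ) •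
      oscKernel s t ε z.1 z.2 •
        U (Θ *ᵥ z.1) (toHilb (diffSq a q μ μ (dilSch a (z.2 - Θ *ᵥ z.1) Φ))) := fun μ _ =>
    (integrable_oscKernel_diffSq h Θ μ Φ hs ht hε).smul (eta n μ μ : ℂ)
  rw [integral_finsetSum _ hi, Finset.smul_sum]
  refine Finset.sum_congr rfl fun μ _ => ?_
  rw [integral_smul, smul_comm, integral_oscKernel_diffSq h hE hΘ μ Φ hs ht hε]

theorem hasOscWarped_lineElement (h : IsExpGroup (coordOp a) U)
    (hE : IsSpectralResolution U E) {Θ : Matrix (Fin (n + 1)) (Fin (n + 1)) ℝ} (hΘ : Θᵀ = -Θ)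
    {Φ : Sch n} {v : Hilb n} (hv : HasLineElement a q E (deformedMetric a Θ) Φ v) :
    HasOscWarped U Θ (rep a q (lineElement a)) Φ v := by
  obtain ⟨hm, rfl⟩ := (hasLineElement_deformedMetric_iff a q E Θ Φ v).1 hv
  refine (hasOscWarped_iff h Θ _ Φ _).2 fun s t hs ht =>
    ⟨fun ε hε => integrable_oscKernel_lineElement h Θ Φ hs ht hε, ?_⟩
  refine (tendsto_finsetSum Finset.univ fun μ _ =>
    (E.tendsto_integ_weylSymbol hs ht (shiftExp a μ) (hm μ)).const_smul (eta n μ μ : ℂ)).congr' ?_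
  filter_upwards [self_mem_nhdsWithin] with ε hε
  rw [← integral_oscKernel_lineElement h hE hΘ Φ hs ht hε, Complex.coe_smul]
  rfl

/-- The regularized integrals exist for every Schwartz `Φ`, and in the limit the unbounded
exponentials act on `Ψ` only. -/
theorem hasOscWarpedElement_lineElement (h : IsExpGroup (coordOp a) U)
    (hE : IsSpectralResolution U E) {Θ : Matrix (Fin (n + 1)) (Fin (n + 1)) ℝ} (hΘ : Θᵀ = -Θ)
    (Φ : Sch n) (Ψ : Hilb n) (w : Fin (n + 1) → Fin (n + 1) → Hilb n)
    (hw : ∀ μ ν, E.HasApply (fun x => (deformedMetric a Θ x μ ν : ℂ)) Ψ (w μ ν)) :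
    HasOscWarpedElement U Θ (rep a q (lineElement a)) Ψ Φ
      (∑ μ, ∑ ν, ⟪w μ ν, toHilb (rep a q (dx a μ) (rep a q (dx a ν) Φ))⟫_ℂ) := by
  simp only [deformedMetric_eq] at hw
  have hd : ∀ μ, MemLp (expFun (warpExp a Θ μ)) 2 (E.measure Ψ) ∧
      w μ μ = (eta n μ μ : ℂ) • E.integ (expFun (warpExp a Θ μ)) Ψ := fun μ =>
    (E.hasApply_const_mul_iff (eta_self_ne_zero μ) (continuous_expFun _).measurable _ _).1 (hw μ μ)
  have hsum : ∑ μ, ∑ ν, ⟪w μ ν, toHilb (rep a q (dx a μ) (rep a q (dx a ν) Φ))⟫_ℂ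
      = ∑ μ, (eta n μ μ : ℂ) *
        ⟪E.integ (expFun (warpExp a Θ μ)) Ψ, toHilb (diffSq a q μ μ Φ)⟫_ℂ := by
    refine Finset.sum_congr rfl fun μ _ => ?_
    rw [Finset.sum_eq_single μ (fun ν _ hν => ?_) (by simp)]
    · rw [(hd μ).2, inner_smul_left, Complex.conj_ofReal, rep_dx]
      rfl
    · have := hw μ ν
      simp only [eta_of_ne hν.symm, Complex.ofReal_zero, zero_mul] at this
      rw [(E.hasApply_zero_iff _ _).1 this, inner_zero_left]
  rw [hsum]
  refine ⟨fun x y => U (Θ *ᵥ x) (toHilb (rep a q (lineElement a) (dilSch a (y - Θ *ᵥ x) Φ))),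
    fun x y => (h.conjApply_iff _ _ _ _ _).2 rfl, fun s t hs ht => ?_⟩
  simp only [← inner_smul_right Ψ]
  refine ⟨fun ε hε => (integrable_oscKernel_lineElement h Θ Φ hs ht hε).const_inner Ψ, ?_⟩
  refine (tendsto_finsetSum Finset.univ fun μ _ => (E.tendsto_inner_weylSymbol hs ht
    (warpExp_dotProduct_shiftExp a hΘ μ) (toHilb (diffSq a q μ μ Φ)) (hd μ).1).const_mul
      (eta n μ μ : ℂ)).congr' ?_
  filter_upwards [self_mem_nhdsWithin] with ε hε
  rw [integral_inner (integrable_oscKernel_lineElement h Θ Φ hs ht hε), ← inner_smul_right,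
    integral_oscKernel_lineElement h hE hΘ Φ hs ht hε, inner_sum]
  simp only [inner_smul_right]

end Warped

/-! ### Translations and the range of the momentum operators -/

section Translation

variable {n : ℕ}

open scoped ENNReal ComplexConjugate

/-- Translation by `t` in the direction of the `μ`-th axis. -/
def shift (μ : Fin (n + 1)) (t : ℝ) : SchOp n :=
  (SchwartzMap.compSubConstCLM ℂ (t • (Pi.single μ 1 : Pt n))).toLinearMap

theorem shift_apply (μ : Fin (n + 1)) (t : ℝ) (Φ : Sch n) (x : Pt n) :
    shift μ t Φ x = Φ (x - t • (Pi.single μ 1 : Pt n)) := rfl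

theorem shift_zero (μ : Fin (n + 1)) (Φ : Sch n) : shift μ 0 Φ = Φ := by
  ext x
  rw [shift_apply, zero_smul, sub_zero]

theorem shift_shift (μ : Fin (n + 1)) (s t : ℝ) (Φ : Sch n) :
    shift μ s (shift μ t Φ) = shift μ (s + t) Φ := by
  ext x
  rw [shift_apply, shift_apply, shift_apply, add_smul, sub_sub]

theorem momOp_shift (μ ν : Fin (n + 1)) (t : ℝ) (Φ : Sch n) :
    momOp ν (shift μ t Φ) = shift μ t (momOp ν Φ) := by
  ext x
  rw [shift_apply, momOp_apply, momOp_apply]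
  congr 2
  exact fderiv_comp_sub (𝕜 := ℝ) (f := Φ) (x := x) (t • (Pi.single μ 1 : Pt n))

theorem norm_le_add_norm_shift (μ : Fin (n + 1)) (t : ℝ) (x : Pt n) :
    ‖x‖ ≤ ‖x - t • (Pi.single μ 1 : Pt n)‖ + |t| := by
  have h : ‖t • (Pi.single μ 1 : Pt n)‖ = |t| := by
    rw [norm_smul, Pi.norm_single, norm_one, mul_one, Real.norm_eq_abs]
  calc ‖x‖ = ‖(x - t • (Pi.single μ 1 : Pt n)) + t • (Pi.single μ 1 : Pt n)‖ := by
        rw [sub_add_cancel]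
    _ ≤ _ := by rw [← h]; exact norm_add_le _ _

theorem decay_shift_le (μ : Fin (n + 1)) {t : ℝ} (ht : |t| ≤ 1) (x : Pt n) :
    decay (x - t • (Pi.single μ 1 : Pt n)) ≤ 2 ^ (n + 2) * decay x := by
  have h := norm_le_add_norm_shift μ t x
  have h2 : 1 + ‖x‖ ≤ 2 * (1 + ‖x - t • (Pi.single μ 1 : Pt n)‖) := by
    linarith [norm_nonneg (x - t • (Pi.single μ 1 : Pt n))]
  have h3 : (1 + ‖x‖) ^ (n + 2) ≤ 2 ^ (n + 2) * (1 + ‖x - t • (Pi.single μ 1 : Pt n)‖) ^ (n + 2) := by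
    rw [← mul_pow]
    gcongr
  rw [decay, decay, ← div_eq_mul_inv, le_div_iff₀ (by positivity), mul_comm, ← div_eq_mul_inv,
    div_le_iff₀ (by positivity)]
  exact h3

/-- At time 0 by domination for |s| ≤ 1; the group law transports this to every time. -/
theorem hasDerivAt_toHilb_shift (μ : Fin (n + 1)) (Φ : Sch n) (t : ℝ) :
    HasDerivAt (fun s => toHilb (shift μ s Φ))
      ((-Complex.I) • toHilb (momOp μ (shift μ t Φ))) t := by
  have h0 : ∀ Φ : Sch n, HasDerivAt (fun s => toHilb (shift μ s Φ))
      ((-Complex.I) • toHilb (momOp μ Φ)) 0 := by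
    intro Φ
    obtain ⟨C, hC0, hC⟩ := exists_norm_le_decay (momOp μ Φ)
    have := hasDerivAt_toHilb (F := fun s => shift μ s Φ)
      (F' := fun s => (-Complex.I) • shift μ s (momOp μ Φ))
      (b := fun x => C * 2 ^ (n + 2) * decay x) (memLp_decay.const_mul _) (fun x s => ?_)
      fun s hs x => ?_
    · simpa [shift_zero] using this
    · have h1 : HasDerivAt (fun s : ℝ => x - s • (Pi.single μ 1 : Pt n))
          (-(Pi.single μ 1 : Pt n)) s := by
        simpa using ((hasDerivAt_id s).smul_const (Pi.single μ 1 : Pt n)).const_sub x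
      have h2 := (Φ.differentiableAt (x := x - s • (Pi.single μ 1 : Pt n))).hasFDerivAt.comp_hasDerivAt
        s h1
      have e : ((-Complex.I) • shift μ s (momOp μ Φ)) x
          = fderiv ℝ Φ (x - s • (Pi.single μ 1 : Pt n)) (-(Pi.single μ 1 : Pt n)) := by
        change (-Complex.I) * shift μ s (momOp μ Φ) x = _
        rw [shift_apply, momOp_apply, map_neg]
        linear_combination (fderiv ℝ Φ (x - s • (Pi.single μ 1 : Pt n)) (Pi.single μ 1)) *
          Complex.I_mul_I
      rw [e]
      exact h2
    · change ‖(-Complex.I) * shift μ s (momOp μ Φ) x‖ ≤ _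
      rw [norm_mul, norm_neg, Complex.norm_I, one_mul, shift_apply, mul_assoc]
      exact (hC _).trans (mul_le_mul_of_nonneg_left (decay_shift_le μ hs x) hC0)
  have h1 := h0 (shift μ t Φ)
  simp only [shift_shift] at h1
  rw [← sub_self t] at h1
  have h2 := h1.comp_sub_const t t
  simpa using h2

theorem norm_toHilb_shift (μ : Fin (n + 1)) (t : ℝ) (Φ : Sch n) :
    ‖toHilb (shift μ t Φ)‖ = ‖toHilb Φ‖ := by
  have h : ‖toHilb (shift μ t Φ)‖ₑ = ‖toHilb Φ‖ₑ := by
    refine enorm_eq_of_sq ?_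
    rw [enorm_toHilb_sq, enorm_toHilb_sq]
    exact lintegral_sub_right_eq_self (fun x => ‖Φ x‖ₑ ^ 2) _
  rw [← toReal_enorm, h, toReal_enorm]

theorem tendsto_shift_apply (μ : Fin (n + 1)) (Φ : Sch n) (x : Pt n) :
    Tendsto (fun t => shift μ t Φ x) atTop (𝓝 0) := by
  simp only [shift_apply]
  refine (Φ.toZeroAtInfty.zero_at_infty' : Tendsto Φ (cocompact _) (𝓝 0)).comp ?_
  rw [← Metric.cobounded_eq_cocompact, ← tendsto_norm_atTop_iff_cobounded]
  refine tendsto_atTop_mono (fun t => ?_) (tendsto_atTop_add_const_right atTop (-‖x‖) tendsto_id)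
  have h := norm_sub_norm_le (t • (Pi.single μ 1 : Pt n)) x
  rw [norm_sub_rev, norm_smul, Pi.norm_single, norm_one, mul_one, Real.norm_eq_abs] at h
  simp only [id]
  linarith [le_abs_self t]

/-- Against a Schwartz function, translates vanish pointwise at infinity under a fixed majorant.
Constancy of the norm extends this weak convergence to all of L² by density. -/
theorem tendsto_inner_shift (μ : Fin (n + 1)) (ψ : Hilb n) (Φ : Sch n) :
    Tendsto (fun t => ⟪ψ, toHilb (shift μ t Φ)⟫_ℂ) atTop (𝓝 0) := by
  have hS : ∀ χ : Sch n, Tendsto (fun t => ⟪toHilb χ, toHilb (shift μ t Φ)⟫_ℂ) atTop (𝓝 0) := by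
    intro χ
    obtain ⟨C, hC0, hC⟩ := exists_norm_le_decay Φ
    obtain ⟨C', hC0', hC'⟩ := exists_norm_le_decay χ
    have e : ∀ t, ⟪toHilb χ, toHilb (shift μ t Φ)⟫_ℂ = ∫ x, shift μ t Φ x * conj (χ x) := by
      intro t
      rw [inner_toHilb]
      refine integral_congr_ae ?_
      filter_upwards [toHilb_coeFn χ] with x hx
      rw [hx]
    simp only [e]
    rw [show (0 : ℂ) = ∫ _ : Pt n, (0 : ℂ) by simp]
    refine tendsto_integral_filter_of_dominated_convergence (fun x => C * (C' * decay x))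
      (Eventually.of_forall fun t => ?_) (Eventually.of_forall fun t => ae_of_all _ fun x => ?_)
      ((integrable_decay.const_mul _).const_mul _) (ae_of_all _ fun x => ?_)
    · exact ((shift μ t Φ).continuous.mul
        (Complex.continuous_conj.comp χ.continuous)).aestronglyMeasurable
    · rw [norm_mul, RCLike.norm_conj, shift_apply]
      refine mul_le_mul ((hC _).trans ?_) (hC' x) (norm_nonneg _) hC0
      exact mul_le_of_le_one_right hC0 (decay_le_one _)
    · simpa using (tendsto_shift_apply μ Φ x).mul_const (conj (χ x))
  rw [Metric.tendsto_atTop]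
  intro ε hε
  set K := ‖toHilb Φ‖ + 1 with hK
  have hKpos : 0 < K := by positivity
  obtain ⟨χ, hχ⟩ := denseRange_toHilb.exists_dist_lt ψ (ε := ε / (2 * K)) (by positivity)
  obtain ⟨N, hN⟩ := Metric.tendsto_atTop.1 (hS χ) (ε / 2) (by positivity)
  refine ⟨N, fun t ht => ?_⟩
  have h1 := hN t ht
  rw [dist_zero_right] at h1 ⊢
  have h2 : ‖⟪ψ - toHilb χ, toHilb (shift μ t Φ)⟫_ℂ‖ ≤ ε / (2 * K) * K := by
    refine (norm_inner_le_norm _ _).trans ?_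
    rw [norm_toHilb_shift, ← dist_eq_norm]
    exact mul_le_mul hχ.le (by linarith) (norm_nonneg _) (by positivity)
  have h3 : ε / (2 * K) * K = ε / 2 := by field_simp
  calc ‖⟪ψ, toHilb (shift μ t Φ)⟫_ℂ‖
      = ‖⟪ψ - toHilb χ, toHilb (shift μ t Φ)⟫_ℂ + ⟪toHilb χ, toHilb (shift μ t Φ)⟫_ℂ‖ := by
        rw [← inner_add_left, sub_add_cancel]
    _ ≤ _ := norm_add_le _ _
    _ < ε := by linarith

/-- The pairing of `ψ` with the translates of AΦ has zero derivative, hence is constant, and it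
tends to 0. A translation-invariant `A` is carried along so that the two derivatives can be stripped
off one after the other. -/
theorem inner_eq_zero_of_momOp {ψ : Hilb n} {A : SchOp n} (μ : Fin (n + 1))
    (hA : ∀ t Φ, A (shift μ t Φ) = shift μ t (A Φ))
    (h : ∀ Φ, ⟪ψ, toHilb (momOp μ (A Φ))⟫_ℂ = 0) (Φ : Sch n) : ⟪ψ, toHilb (A Φ)⟫_ℂ = 0 := by
  have hd : ∀ t, HasDerivAt (fun t => ⟪ψ, toHilb (shift μ t (A Φ))⟫_ℂ) 0 t := by
    intro t
    have := (hasDerivAt_const t ψ).inner ℂ (hasDerivAt_toHilb_shift μ (A Φ) t)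
    simpa [inner_smul_right, ← hA, h] using this
  have hc : ∀ t, ⟪ψ, toHilb (shift μ t (A Φ))⟫_ℂ = ⟪ψ, toHilb (A Φ)⟫_ℂ := by
    intro t
    have := is_const_of_deriv_eq_zero (fun t => (hd t).differentiableAt)
      (fun t => (hd t).deriv) t 0
    simpa [shift_zero] using this
  have := tendsto_inner_shift μ ψ (A Φ)
  simp only [hc] at this
  exact tendsto_nhds_unique tendsto_const_nhds this

/-- A vector that is orthogonal to the range of `dX^μ dX^ν` vanishes. -/
theorem eq_zero_of_inner_diffSq {a q : Pt n} (ha : ∀ μ, a μ ≠ 0) (hq : ∀ μ, q μ ≠ 0)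
    (μ ν : Fin (n + 1)) {ψ : Hilb n} (h : ∀ Φ, ⟪ψ, toHilb (diffSq a q μ ν Φ)⟫_ℂ = 0) : ψ = 0 := by
  have h1 : ∀ Φ, ⟪ψ, toHilb (momOp μ (momOp ν Φ))⟫_ℂ = 0 := by
    intro Φ
    have := h Φ
    simp only [diffSq, diffOp_eq, Module.End.mul_apply, LinearMap.smul_apply, map_smul,
      inner_smul_right, mul_eq_zero, Complex.ofReal_eq_zero, ha, hq, false_or, or_self] at this
    exact this
  have h2 := inner_eq_zero_of_momOp μ (fun t Φ => momOp_shift μ ν t Φ) h1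
  have h3 := inner_eq_zero_of_momOp (A := 1) ν (fun t Φ => rfl) h2
  exact denseRange_toHilb.eq_zero_of_inner_left ℂ h3

end Translation

/-! ### The spectral resolution has full support -/

section Support

variable {n : ℕ}

open scoped ENNReal ComplexConjugate

/-- A smooth bump in the open positive orthant. -/
def orthantBump (n : ℕ) : ContDiffBump (fun _ => 1 : Pt n) :=
  ⟨1 / 4, 1 / 2, by norm_num, by norm_num⟩

theorem pos_of_orthantBump {x : Pt n} (hx : x ∈ tsupport (orthantBump n)) (i : Fin (n + 1)) :
    0 < x i := by
  rw [ContDiffBump.tsupport_eq, Metric.mem_closedBall] at hx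
  have hx' : dist x (fun _ => 1 : Pt n) ≤ 1 / 2 := hx
  have h := (dist_pi_le_iff (by norm_num)).1 hx' i
  rw [Real.dist_eq, abs_le] at h
  linarith [h.1]

/-- The bump multiplied by `∏ |x_μ| ^ (i r_μ)`. -/
def phaseBump (r x : Pt n) : ℂ :=
  Complex.exp (Complex.I * ((∑ i, r i * Real.log (x i) : ℝ) : ℂ)) * (orthantBump n x : ℂ)

theorem phaseBump_eq_zero (r : Pt n) {x : Pt n} (hx : x ∉ tsupport (orthantBump n)) :
    phaseBump r x = 0 := by
  rw [phaseBump, image_eq_zero_of_notMem_tsupport hx, Complex.ofReal_zero, mul_zero]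

theorem contDiff_phaseBump (r : Pt n) : ContDiff ℝ (⊤ : ℕ∞) (phaseBump r) := by
  rw [contDiff_iff_contDiffAt]
  intro x
  by_cases hx : x ∈ tsupport (orthantBump n)
  · have h1 : ContDiffAt ℝ (⊤ : ℕ∞) (fun x : Pt n => ∑ i, r i * Real.log (x i)) x :=
      ContDiffAt.sum fun i _ => contDiffAt_const.mul
        ((contDiff_apply ℝ ℝ i).contDiffAt.log (pos_of_orthantBump hx i).ne')
    have h2 : ContDiffAt ℝ (⊤ : ℕ∞) (fun x : Pt n => (orthantBump n x : ℂ)) x :=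
      Complex.ofRealCLM.contDiff.contDiffAt.comp x (orthantBump n).contDiffAt
    exact (contDiffAt_const.mul (Complex.ofRealCLM.contDiff.contDiffAt.comp x h1)).cexp.mul h2
  · refine (contDiffAt_const (c := (0 : ℂ))).congr_of_eventuallyEq ?_
    filter_upwards [(isClosed_tsupport _).isOpen_compl.mem_nhds hx] with y hy
    exact phaseBump_eq_zero r hy

theorem hasCompactSupport_phaseBump (r : Pt n) : HasCompactSupport (phaseBump r) := by
  refine HasCompactSupport.intro (orthantBump n).hasCompactSupport fun x hx => ?_
  exact phaseBump_eq_zero r hx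

/-- The bump with a phase as a Schwartz function. -/
def phaseSch (r : Pt n) : Sch n :=
  (hasCompactSupport_phaseBump r).toSchwartzMap (contDiff_phaseBump r)

theorem phaseSch_apply (r x : Pt n) : phaseSch r x = phaseBump r x := rfl

/-- Under a dilation log x_i moves by a_i p_i, so the phase changes by a constant. Support in the
positive orthant keeps the logarithms meaningful. -/
theorem dilSch_phaseSch_mul (a p r x : Pt n) :
    dilSch a p (phaseSch r) x * conj (phaseSch r x)
      = Complex.exp (Complex.I * ((∑ i, r i * (a i * p i) : ℝ) : ℂ)) *
        (dilSch a p (phaseSch 0) x * conj (phaseSch 0 x)) := by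
  simp only [dilSch_apply, phaseSch_apply]
  by_cases hx : x ∈ tsupport (orthantBump n)
  · have hlog : ∑ i, r i * Real.log (dilate a p x i)
        = ∑ i, r i * (a i * p i) + ∑ i, r i * Real.log (x i) := by
      rw [← Finset.sum_add_distrib]
      refine Finset.sum_congr rfl fun i _ => ?_
      rw [dilate_apply, Real.log_mul (Real.exp_pos _).ne' (pos_of_orthantBump hx i).ne',
        Real.log_exp]
      ring
    simp only [phaseBump, hlog, map_mul, ← Complex.exp_conj, Complex.conj_I, Complex.conj_ofReal,
      Complex.ofReal_add, mul_add, Complex.exp_add, Pi.zero_apply, zero_mul,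
      Finset.sum_const_zero, Complex.ofReal_zero, mul_zero, Complex.exp_zero, one_mul]
    have e : Complex.exp (Complex.I * ((∑ i, r i * Real.log (x i) : ℝ) : ℂ)) *
        Complex.exp (-Complex.I * ((∑ i, r i * Real.log (x i) : ℝ) : ℂ)) = 1 := by
      rw [← Complex.exp_add, neg_mul, add_neg_cancel, Complex.exp_zero]
    linear_combination (Complex.exp (Complex.I * ((∑ i, r i * (a i * p i) : ℝ) : ℂ)) *
      ((Real.exp (a ⬝ᵥ p / 2) : ℂ) * (orthantBump n (dilate a p x) : ℂ) *
        (orthantBump n x : ℂ))) * e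
  · simp only [phaseBump_eq_zero _ hx, map_zero, mul_zero]

variable {a : Pt n} {U : Pt n → (Hilb n ≃ₗᵢ[ℂ] Hilb n)} {E : PVM n}

theorem inner_phaseSch (hU : IsExpGroup (coordOp a) U) (p r : Pt n) :
    ⟪toHilb (phaseSch r), U p (toHilb (phaseSch r))⟫_ℂ
      = Complex.exp (Complex.I * ((∑ i, r i * (a i * p i) : ℝ) : ℂ)) *
        ⟪toHilb (phaseSch 0), U p (toHilb (phaseSch 0))⟫_ℂ := by
  have e : ∀ χ Φ : Sch n, ⟪toHilb χ, toHilb Φ⟫_ℂ = ∫ x, Φ x * conj (χ x) := by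
    intro χ Φ
    rw [inner_toHilb]
    refine integral_congr_ae ?_
    filter_upwards [toHilb_coeFn χ] with x hx
    rw [hx]
  rw [hU.apply_toHilb, hU.apply_toHilb, e, e, ← integral_const_mul]
  exact integral_congr_ae (ae_of_all _ fun x => dilSch_phaseSch_mul a p r x)

/-- A finite measure on `ℝ^d` is determined by its Fourier transform. -/
theorem measure_ext_of_integral_exp {μ ν : Measure (Pt n)} [IsFiniteMeasure μ]
    [IsFiniteMeasure ν] (h : ∀ p : Pt n,
      ∫ x, Complex.exp (Complex.I * ((p ⬝ᵥ x : ℝ) : ℂ)) ∂μ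
        = ∫ x, Complex.exp (Complex.I * ((p ⬝ᵥ x : ℝ) : ℂ)) ∂ν) : μ = ν := by
  refine Measure.ext_of_charFunDual (funext fun L => ?_)
  have hL : ∀ x : Pt n, Complex.exp (L x * Complex.I)
      = Complex.exp (Complex.I * (((fun i => L (Pi.single i 1)) ⬝ᵥ x : ℝ) : ℂ)) := by
    intro x
    rw [mul_comm]
    congr 3
    conv_lhs => rw [pi_eq_sum_univ' x]
    rw [map_sum, dotProduct]
    refine Finset.sum_congr rfl fun i _ => ?_
    rw [map_smul, smul_eq_mul, mul_comm]
  rw [charFunDual_apply, charFunDual_apply]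
  simp only [hL]
  exact h _

/-- A character factor in the Fourier transform of a measure is a translation of the measure. -/
theorem measure_phaseSch (hU : IsExpGroup (coordOp a) U) (hE : IsSpectralResolution U E)
    (r : Pt n) : E.measure (toHilb (phaseSch r))
      = (E.measure (toHilb (phaseSch 0))).map fun x => x + fun i => r i * a i := by
  refine measure_ext_of_integral_exp fun p => ?_
  rw [← hE, inner_phaseSch hU, hE, integral_map (by fun_prop)
    (measurable_character p).aestronglyMeasurable, ← integral_const_mul]
  refine integral_congr_ae (ae_of_all _ fun x => ?_)
  simp only
  rw [dotProduct_add, Complex.ofReal_add, mul_add, Complex.exp_add, mul_comm]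
  congr 4
  simp only [dotProduct]
  exact Finset.sum_congr rfl fun i _ => by ring

theorem toHilb_phaseSch_zero_ne : toHilb (phaseSch (0 : Pt n)) ≠ 0 := by
  intro h
  have h1 : phaseSch (0 : Pt n) = 0 := toHilb_injective (h.trans (map_zero _).symm)
  have h2 : phaseSch (0 : Pt n) (fun _ => 1) = 1 := by
    rw [phaseSch_apply, phaseBump, ContDiffBump.one_of_mem_closedBall]
    · simp
    · exact Metric.mem_closedBall_self (orthantBump n).rIn_pos.le
  rw [h1] at h2
  exact zero_ne_one h2

/-- Nonempty open sets have nonzero spectral projections. -/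
theorem eq_empty_of_proj_eq_zero (ha : ∀ μ, a μ ≠ 0) (hU : IsExpGroup (coordOp a) U)
    (hE : IsSpectralResolution U E) {N : Set (Pt n)} (hN : IsOpen N)
    (h : ∀ ψ, E.proj N ψ = 0) : N = ∅ := by
  by_contra hne
  obtain ⟨x₀, hx₀⟩ := Set.nonempty_iff_ne_empty.2 hne
  -- Taking r_i = s_i/a_i realizes every translation `s`; this is where a_i ≠ 0 is needed.
  have h1 : ∀ s : Pt n, E.measure (toHilb (phaseSch 0)) ((fun x => x + s) ⁻¹' N) = 0 := by
    intro s
    have h2 := measure_phaseSch hU hE fun i => s i / a i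
    have h3 : E.measure (toHilb (phaseSch fun i => s i / a i)) N = 0 := by
      rw [E.measure_apply _ hN.measurableSet, h, enorm_zero, zero_pow two_ne_zero]
    rw [h2, Measure.map_apply (by fun_prop) hN.measurableSet] at h3
    simpa only [div_mul_cancel₀ _ (ha _)] using h3
  -- Countably many translates of a nonempty open set cover the space, so the spectral measure of a
  -- nonzero vector would vanish.
  have hcov : (⋃ k : ℕ, (fun x => x + TopologicalSpace.denseSeq (Pt n) k) ⁻¹' N)
      = Set.univ := by
    refine Set.eq_univ_of_forall fun x => ?_
    have ho : IsOpen ((fun s => x + s) ⁻¹' N) := hN.preimage (by fun_prop)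
    obtain ⟨k, hk⟩ := (TopologicalSpace.denseRange_denseSeq (Pt n)).exists_mem_open ho
      ⟨x₀ - x, by simpa using hx₀⟩
    exact Set.mem_iUnion.2 ⟨k, hk⟩
  have h4 : E.measure (toHilb (phaseSch 0)) Set.univ = 0 := by
    rw [← hcov]
    exact measure_iUnion_null fun k => h1 _
  rw [E.measure_univ] at h4
  have h5 : ‖toHilb (phaseSch (0 : Pt n))‖ₑ = 0 := pow_eq_zero_iff two_ne_zero |>.1 h4
  exact toHilb_phaseSch_zero_ne (enorm_eq_zero.1 h5)

end Support

/-! ### The metric is determined by the line-element -/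

section Uniqueness

variable {n : ℕ} {a q : Pt n} {U : Pt n → (Hilb n ≃ₗᵢ[ℂ] Hilb n)} {E : PVM n}

open scoped ENNReal ComplexConjugate

/-- A quadratic form with symmetric vector-valued coefficients that vanishes on `(0, 1]^d` is
zero. -/
theorem coeff_eq_zero_of_quadratic {ι H : Type*} [Fintype ι] [DecidableEq ι]
    [AddCommGroup H] [Module ℝ H] {x : ι → ι → H} (hx : ∀ μ ν, x μ ν = x ν μ)
    (h : ∀ y : ι → ℝ, (∀ i, 0 < y i ∧ y i ≤ 1) → ∑ μ, ∑ ν, (y μ * y ν) • x μ ν = 0) (μ ν : ι) :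
    x μ ν = 0 := by
  let B : (ι → ℝ) → (ι → ℝ) → H := fun y z => ∑ μ, ∑ ν, (y μ * z ν) • x μ ν
  have hl : ∀ y y' z, B (y + y') z = B y z + B y' z := fun y y' z => by
    simp only [B, Pi.add_apply, add_mul, add_smul, Finset.sum_add_distrib]
  have hr : ∀ y z z', B y (z + z') = B y z + B y z' := fun y z z' => by
    simp only [B, Pi.add_apply, mul_add, add_smul, Finset.sum_add_distrib]
  -- Base point and increments of size 1/4 keep all four sample points inside (0, 1]^d, even when μ
  -- = ν.
  let u : ι → ℝ := fun _ => 1 / 4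
  let e : ι → ι → ℝ := fun i => Pi.single i (1 / 4)
  have he : ∀ i j, 0 ≤ e i j ∧ e i j ≤ 1 / 4 := fun i j => by
    simp only [e, Pi.single_apply]
    split_ifs <;> norm_num
  have h1 := h u fun i => by norm_num [u]
  have h2 := h (u + e μ) fun i => by
    have := he μ i
    simp only [u, Pi.add_apply]
    constructor <;> linarith
  have h3 := h (u + e ν) fun i => by
    have := he ν i
    simp only [u, Pi.add_apply]
    constructor <;> linarith
  have h4 := h (u + e μ + e ν) fun i => by
    have := he μ i
    have := he ν i
    simp only [u, Pi.add_apply]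
    constructor <;> linarith
  change B u u = 0 at h1
  change B (u + e μ) (u + e μ) = 0 at h2
  change B (u + e ν) (u + e ν) = 0 at h3
  change B (u + e μ + e ν) (u + e μ + e ν) = 0 at h4
  have hB : ∀ i j, B (e i) (e j) = (1 / 16 : ℝ) • x i j := fun i j => by
    simp only [B, e, Pi.single_apply, mul_ite, ite_mul, zero_mul, mul_zero, ite_smul, zero_smul,
      Finset.sum_ite_eq', Finset.mem_univ, if_true]
    norm_num
  simp only [hl, hr] at h2 h3 h4
  -- The mixed second difference of the quadratic form.
  have h5 : B (e μ) (e ν) + B (e ν) (e μ) = 0 := by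
    have : B (e μ) (e ν) + B (e ν) (e μ)
      = (B u u + B u (e μ) + B u (e ν) + (B (e μ) u + B (e μ) (e μ) + B (e μ) (e ν))
          + (B (e ν) u + B (e ν) (e μ) + B (e ν) (e ν)))
        - (B u u + B u (e μ) + (B (e μ) u + B (e μ) (e μ)))
        - (B u u + B u (e ν) + (B (e ν) u + B (e ν) (e ν))) + B u u := by abel
    rw [this, h4, h2, h3, h1]
    simp
  rw [hB, hB, hx ν μ, ← add_smul] at h5
  exact (smul_eq_zero.1 h5).resolve_left (by norm_num)

theorem diffSq_comm (μ ν : Fin (n + 1)) : diffSq a q μ ν = diffSq a q ν μ := by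
  simp only [diffSq, diffOp_eq, smul_mul_smul_comm]
  rw [(momOp_comm μ ν).eq, mul_comm]

/-- Unitaries of the group, shrunk by a factor, act on the unbounded functional calculus. -/
theorem IsSpectralResolution.smul_integ (hE : IsSpectralResolution U E) {c : ℝ} (h0 : 0 ≤ c)
    (h1 : c ≤ 1) (p : Pt n) {f : Pt n → ℂ} {ψ : Hilb n} (hf : MemLp f 2 (E.measure ψ)) :
    MemLp f 2 (E.measure ((c : ℂ) • U p ψ)) ∧
      E.integ f ((c : ℂ) • U p ψ) = (c : ℂ) • U p (E.integ f ψ) := by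
  -- The factor c ≤ 1 makes `T` a contraction, as `PVM.map_integ` requires.
  let T : Hilb n →L[ℂ] Hilb n := (c : ℂ) • (U p).toLinearIsometry.toContinuousLinearMap
  have hTn : ∀ ψ, ‖T ψ‖ ≤ ‖ψ‖ := fun ψ => by
    change ‖(c : ℂ) • U p ψ‖ ≤ _
    rw [norm_smul, LinearIsometryEquiv.norm_map, Complex.norm_real, Real.norm_eq_abs,
      abs_of_nonneg h0]
    exact mul_le_of_le_one_left (norm_nonneg _) h1
  have hTc : ∀ B, MeasurableSet B → ∀ ψ, T (E.proj B ψ) = E.proj B (T ψ) := fun B hB ψ => by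
    change (c : ℂ) • U p (E.proj B ψ) = E.proj B ((c : ℂ) • U p ψ)
    rw [map_smul, hE.comm p hB]
  exact ⟨hf.mono_measure (E.measure_map_le hTn hTc ψ), (E.map_integ hTn hTc hf).symm⟩

theorem hasLineElement_iff (a q : Pt n) (E : PVM n)
    {g : Pt n → Matrix (Fin (n + 1)) (Fin (n + 1)) ℝ} (hg : Continuous g) (Φ : Sch n)
    (v : Hilb n) : HasLineElement a q E g Φ v ↔
      (∀ μ ν, MemLp (fun x => (g x μ ν : ℂ)) 2 (E.measure (toHilb (diffSq a q μ ν Φ)))) ∧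
        v = ∑ μ, ∑ ν, E.integ (fun x => (g x μ ν : ℂ)) (toHilb (diffSq a q μ ν Φ)) := by
  have hm : ∀ μ ν, Measurable fun x => (g x μ ν : ℂ) := fun μ ν =>
    (Complex.continuous_ofReal.comp (hg.matrix_elem μ ν)).measurable
  simp only [HasLineElement, rep_dx]
  constructor
  · rintro ⟨w, hw, rfl⟩
    have := fun μ ν => (E.hasApply_iff (hm μ ν) _ _).1 (hw μ ν)
    exact ⟨fun μ ν => (this μ ν).1,
      Finset.sum_congr rfl fun μ _ => Finset.sum_congr rfl fun ν _ => (this μ ν).2⟩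
  · rintro ⟨h, rfl⟩
    exact ⟨_, fun μ ν => (E.hasApply_iff (hm μ ν) _ _).2 ⟨h μ ν, rfl⟩, rfl⟩

/-- If two metrics have the same line-element, their difference annihilates every second
derivative of a function in the domain. -/
theorem integ_sub_eq_zero (ha : ∀ μ, a μ ≠ 0) (hU : IsExpGroup (coordOp a) U)
    (hE : IsSpectralResolution U E) {g h : Pt n → Matrix (Fin (n + 1)) (Fin (n + 1)) ℝ}
    (hg : Continuous g) (hh : Continuous h) (hgs : ∀ x, (g x).IsSymm) (hhs : ∀ x, (h x).IsSymm)
    (heq : ∀ Φ v, HasLineElement a q E g Φ v ↔ HasLineElement a q E h Φ v) {Φ : Sch n}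
    {v : Hilb n} (hv : HasLineElement a q E h Φ v) (μ ν : Fin (n + 1)) :
    MemLp (fun x => ((g x μ ν : ℂ) - h x μ ν)) 2 (E.measure (toHilb (diffSq a q μ ν Φ))) ∧
      E.integ (fun x => ((g x μ ν : ℂ) - h x μ ν)) (toHilb (diffSq a q μ ν Φ)) = 0 := by
  have hmem : ∀ {Φ v}, HasLineElement a q E h Φ v → ∀ μ ν,
      MemLp (fun x => ((g x μ ν : ℂ) - h x μ ν)) 2 (E.measure (toHilb (diffSq a q μ ν Φ))) :=
    fun hv μ ν => (((hasLineElement_iff a q E hg _ _).1 ((heq _ _).2 hv)).1 μ ν).sub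
      (((hasLineElement_iff a q E hh _ _).1 hv).1 μ ν)
  have hsum : ∀ {Φ v}, HasLineElement a q E h Φ v → ∑ μ, ∑ ν,
      E.integ (fun x => ((g x μ ν : ℂ) - h x μ ν)) (toHilb (diffSq a q μ ν Φ)) = 0 := by
    intro Φ v hv
    obtain ⟨hm1, h1⟩ := (hasLineElement_iff a q E hg _ _).1 ((heq _ _).2 hv)
    obtain ⟨hm2, h2⟩ := (hasLineElement_iff a q E hh _ _).1 hv
    have e : ∀ μ ν, E.integ (fun x => ((g x μ ν : ℂ) - h x μ ν)) (toHilb (diffSq a q μ ν Φ))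
        = E.integ (fun x => (g x μ ν : ℂ)) (toHilb (diffSq a q μ ν Φ))
          - E.integ (fun x => (h x μ ν : ℂ)) (toHilb (diffSq a q μ ν Φ)) := fun μ ν =>
      E.integ_sub (hm1 μ ν) (hm2 μ ν)
    simp only [e, Finset.sum_sub_distrib]
    rw [← h1, ← h2, sub_self]
  refine ⟨hmem hv μ ν, ?_⟩
  refine coeff_eq_zero_of_quadratic (x := fun μ ν =>
    E.integ (fun x => ((g x μ ν : ℂ) - h x μ ν)) (toHilb (diffSq a q μ ν Φ)))
    (fun μ ν => ?_) (fun y hy => ?_) μ ν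
  · simp only [diffSq_comm μ ν, (hgs _).apply, (hhs _).apply]
  -- The dilation that scales the i-th derivative by y_i. Restricting to y_i ≤ 1 keeps all scalars
  -- at most 1, so the dilated function stays in the domain.
  · let p : Pt n := fun i => Real.log (y i) / a i
    have hp : ∀ i, Real.exp (a i * p i) = y i := fun i => by
      rw [mul_div_cancel₀ _ (ha i), Real.exp_log (hy i).1]
    have hd : ∀ μ ν, toHilb (diffSq a q μ ν (dilSch a p Φ))
        = ((y μ * y ν : ℝ) : ℂ) • U p (toHilb (diffSq a q μ ν Φ)) := fun μ ν => by
      rw [diffSq_dilSch, map_smul, hU.apply_toHilb, Real.exp_add, hp, hp]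
    have h0 : ∀ μ ν, 0 ≤ y μ * y ν := fun μ ν => (mul_pos (hy μ).1 (hy ν).1).le
    have h1 : ∀ μ ν, y μ * y ν ≤ 1 := fun μ ν =>
      mul_le_one₀ (hy μ).2 (hy ν).1.le (hy ν).2
    have hdom : HasLineElement a q E h (dilSch a p Φ) _ :=
      (hasLineElement_iff a q E hh _ _).2 ⟨fun μ ν => by
        rw [hd]
        exact (hE.smul_integ (h0 μ ν) (h1 μ ν) p
          (((hasLineElement_iff a q E hh _ _).1 hv).1 μ ν)).1, rfl⟩
    have h2 := hsum hdom
    simp only [hd, (hE.smul_integ (h0 _ _) (h1 _ _) p (hmem hv _ _)).2] at h2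
    refine (U p).injective ?_
    simp only [map_sum, map_zero]
    rw [← h2]
    refine Finset.sum_congr rfl fun μ _ => Finset.sum_congr rfl fun ν _ => ?_
    rw [Complex.coe_smul]
    exact map_smul ((U p).toLinearIsometry.toLinearMap.restrictScalars ℝ) _ _

/-- On the open set where an entry differs, the spectral projection annihilates the corresponding
second derivatives of functions in the domain, hence all of them by smoothing. These span a dense
subspace, so the projection is 0, and full support makes the set empty. -/
theorem metric_unique (ha : ∀ μ, a μ ≠ 0) (hq : ∀ μ, q μ ≠ 0) (hU : IsExpGroup (coordOp a) U)
    (hE : IsSpectralResolution U E) (Θ : Matrix (Fin (n + 1)) (Fin (n + 1)) ℝ)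
    {g : Pt n → Matrix (Fin (n + 1)) (Fin (n + 1)) ℝ} (hg : Continuous g)
    (hgs : ∀ x, (g x).IsSymm)
    (heq : ∀ Φ v, HasLineElement a q E g Φ v ↔
      HasLineElement a q E (deformedMetric a Θ) Φ v) : g = deformedMetric a Θ := by
  have hh := continuous_deformedMetric a Θ
  have hhs : ∀ x, (deformedMetric a Θ x).IsSymm := by
    intro x
    refine Matrix.IsSymm.ext fun i j => ?_
    by_cases hij : i = j
    · rw [hij]
    · simp only [deformedMetric, Matrix.of_apply, eta_of_ne hij, eta_of_ne (Ne.symm hij), mul_zero]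
  suffices H : ∀ μ ν, {x | g x μ ν - deformedMetric a Θ x μ ν ≠ 0} = ∅ by
    funext x
    ext μ ν
    by_contra hne
    exact Set.eq_empty_iff_forall_notMem.1 (H μ ν) x (sub_ne_zero.2 hne)
  intro μ ν
  have hopen : IsOpen {x | g x μ ν - deformedMetric a Θ x μ ν ≠ 0} :=
    isOpen_ne_fun ((hg.matrix_elem μ ν).sub (hh.matrix_elem μ ν)) continuous_const
  set N := {x | g x μ ν - deformedMetric a Θ x μ ν ≠ 0} with hN
  have h1 : ∀ Φ v, HasLineElement a q E (deformedMetric a Θ) Φ v →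
      E.proj N (toHilb (diffSq a q μ ν Φ)) = 0 := by
    intro Φ v hv
    obtain ⟨hm, h0⟩ := integ_sub_eq_zero ha hU hE hg hh hgs hhs heq hv μ ν
    have h2 := E.enorm_integ hm
    rw [h0, enorm_zero, eq_comm, eLpNorm_eq_zero_iff hm.1 two_ne_zero] at h2
    have h3 : E.measure (toHilb (diffSq a q μ ν Φ)) N = 0 := by
      refine measure_mono_null (fun x hx => ?_) (ae_iff.1 h2)
      change ¬ ((g x μ ν : ℂ) - deformedMetric a Θ x μ ν = 0)
      rw [← Complex.ofReal_sub, Complex.ofReal_eq_zero]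
      exact hx
    rw [E.measure_apply _ hopen.measurableSet] at h3
    exact enorm_eq_zero.1 (pow_eq_zero_iff two_ne_zero |>.1 h3)
  -- Smoothing converges to Φ together with its second derivatives, not only in L².
  have h2 : ∀ Φ, E.proj N (toHilb (diffSq a q μ ν Φ)) = 0 := by
    intro Φ
    have h3 := ((E.proj N).continuous.tendsto _).comp
      (tendsto_toHilb_diffSq_smoothSeq (q := q) hU hE μ ν Φ)
    refine tendsto_nhds_unique h3 (tendsto_const_nhds.congr fun k => ?_)
    obtain ⟨v, hv⟩ := hasLineElement_smoothSeq (q := q) hU hE Θ k Φ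
    exact (h1 _ v hv).symm
  refine eq_empty_of_proj_eq_zero ha hU hE hopen fun ψ => ?_
  refine eq_zero_of_inner_diffSq ha hq μ ν fun Φ => ?_
  have h4 := (E.selfAdjoint N hopen.measurableSet).isSymmetric ψ (toHilb (diffSq a q μ ν Φ))
  simp only [ContinuousLinearMap.coe_coe] at h4
  rw [h4, h2, inner_zero_right]

end Uniqueness

/-! ### Existence of the unitary group -/

section UnitaryGroup

variable {n : ℕ}

open scoped ENNReal ComplexConjugate

/-- The square of the prefactor exp(a·p/2) is the Jacobian of the dilation. -/
theorem norm_toHilb_dilSch (a p : Pt n) (Φ : Sch n) : ‖toHilb (dilSch a p Φ)‖ = ‖toHilb Φ‖ := by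
  have hdet : (Matrix.diagonal fun i => Real.exp (a i * p i)).det = Real.exp (a ⬝ᵥ p) := by
    rw [Matrix.det_diagonal, dotProduct, Real.exp_sum]
  have hmap : ∀ x, Matrix.toLin' (Matrix.diagonal fun i => Real.exp (a i * p i)) x
      = dilate a p x := fun x => by
    ext i
    rw [Matrix.toLin'_apply, Matrix.mulVec_diagonal, dilate_apply]
  have hvol := Real.smul_map_diagonal_volume_pi (D := fun i => Real.exp (a i * p i))
    (by rw [hdet]; exact (Real.exp_pos _).ne')
  rw [hdet, Real.abs_exp] at hvol
  have hΦ : Measurable fun x => ‖Φ x‖ₑ ^ 2 := Φ.continuous.measurable.enorm.pow_const 2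
  have h : ‖toHilb (dilSch a p Φ)‖ₑ = ‖toHilb Φ‖ₑ := by
    refine enorm_eq_of_sq ?_
    rw [enorm_toHilb_sq, enorm_toHilb_sq]
    conv_rhs => rw [← hvol]
    rw [lintegral_smul_measure, lintegral_map hΦ
      (LinearMap.continuous_of_finiteDimensional _).measurable, smul_eq_mul,
      ← lintegral_const_mul' _ _ ENNReal.ofReal_ne_top]
    refine lintegral_congr fun x => ?_
    rw [hmap, dilSch_apply, enorm_mul, mul_pow]
    congr 1
    rw [← ofReal_norm, Complex.norm_real, Real.norm_eq_abs, Real.abs_exp,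
      ← ENNReal.ofReal_pow (Real.exp_pos _).le, ← Real.exp_nat_mul]
    congr 2
    push_cast
    ring
  rw [← toReal_enorm, h, toReal_enorm]

/-- The unitary operators given by dilations. -/
def dilUnitary (a p : Pt n) : Hilb n ≃ₗᵢ[ℂ] Hilb n :=
  (dilEquiv a p).extendOfIsometry (toHilb (n := n)).toLinearMap (toHilb (n := n)).toLinearMap
    denseRange_toHilb denseRange_toHilb (norm_toHilb_dilSch a p)

theorem dilUnitary_toHilb (a p : Pt n) (Φ : Sch n) :
    dilUnitary a p (toHilb Φ) = toHilb (dilSch a p Φ) := by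
  have := LinearEquiv.extendOfIsometry_eq (dilEquiv a p) (toHilb (n := n)).toLinearMap
    (toHilb (n := n)).toLinearMap denseRange_toHilb denseRange_toHilb (norm_toHilb_dilSch a p) Φ
  exact this

/-- The group law extends by density from Schwartz functions. Strong continuity extends because
approximating a vector is uniform in p under isometries. -/
theorem isExpGroup_dilUnitary (a : Pt n) : IsExpGroup (coordOp a) (dilUnitary a) where
  map_add p r ψ := by
    refine denseRange_toHilb.induction_on ψ
      (isClosed_eq (dilUnitary a (p + r)).continuous
        ((dilUnitary a p).continuous.comp (dilUnitary a r).continuous)) fun Φ => ?_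
    rw [dilUnitary_toHilb, dilUnitary_toHilb, dilUnitary_toHilb, dilSch_add]
  continuous ψ := by
    refine continuous_of_uniform_approx_of_continuous fun u hu => ?_
    obtain ⟨ε, hε, hεu⟩ := Metric.mem_uniformity_dist.1 hu
    obtain ⟨Φ, hΦ⟩ := denseRange_toHilb.exists_dist_lt ψ hε
    refine ⟨fun p => dilUnitary a p (toHilb Φ), ?_, fun p => hεu ?_⟩
    · simp only [dilUnitary_toHilb]
      exact continuous_toHilb_dilSch a Φ
    · rwa [LinearIsometryEquiv.dist_map]
  generator p Φ := by
    simp only [dilUnitary_toHilb]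
    exact genSch_apply a p Φ ▸ hasDerivAt_toHilb_dilSch a p Φ

end UnitaryGroup

/-! ### Multiplication operators and spectral resolutions -/

section MulOp

open scoped ENNReal ComplexConjugate

variable {X K : Type*} [MeasurableSpace X] {ν : Measure X} [NormedAddCommGroup K]
  [InnerProductSpace ℂ K]

/-- Measurable functions bounded by one. -/
def IsMultiplier (m : X → ℂ) : Prop := Measurable m ∧ ∀ x, ‖m x‖ ≤ 1

theorem IsMultiplier.memLp {m : X → ℂ} (hm : IsMultiplier m) (f : Lp K 2 ν) :
    MemLp (fun x => m x • f x) 2 ν :=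
  (Lp.memLp f).of_le (hm.1.aestronglyMeasurable.smul (Lp.aestronglyMeasurable f))
    (ae_of_all _ fun x => by
      rw [norm_smul]
      exact mul_le_of_le_one_left (norm_nonneg _) (hm.2 x))

/-- Multiplication by a bounded function on `L²`. -/
def IsMultiplier.op {m : X → ℂ} (hm : IsMultiplier m) : Lp K 2 ν →L[ℂ] Lp K 2 ν :=
  LinearMap.mkContinuous
    { toFun := fun f => (hm.memLp f).toLp _
      map_add' := fun f g => by
        rw [← MemLp.toLp_add]
        refine MemLp.toLp_congr _ _ ?_
        filter_upwards [Lp.coeFn_add f g] with x hx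
        rw [hx, Pi.add_apply, smul_add]
        rfl
      map_smul' := fun c f => by
        rw [RingHom.id_apply, ← MemLp.toLp_const_smul]
        refine MemLp.toLp_congr _ _ ?_
        filter_upwards [Lp.coeFn_smul c f] with x hx
        rw [hx, Pi.smul_apply, smul_comm]
        rfl } 1 fun f => by
    refine Lp.norm_le_mul_norm_of_ae_le_mul ?_
    filter_upwards [(hm.memLp f).coeFn_toLp] with x hx
    change ‖((hm.memLp f).toLp _ : X → K) x‖ ≤ _
    rw [hx, norm_smul]
    exact mul_le_mul_of_nonneg_right (hm.2 x) (norm_nonneg _)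

theorem IsMultiplier.op_coeFn {m : X → ℂ} (hm : IsMultiplier m) (f : Lp K 2 ν) :
    hm.op f =ᵐ[ν] fun x => m x • f x := (hm.memLp f).coeFn_toLp

theorem IsMultiplier.op_op {m m' : X → ℂ} (hm : IsMultiplier m) (hm' : IsMultiplier m')
    {m'' : X → ℂ} (hm'' : IsMultiplier m'') (h : ∀ x, m'' x = m x * m' x) (f : Lp K 2 ν) :
    hm.op (hm'.op f) = hm''.op f := by
  refine Lp.ext ?_
  filter_upwards [hm.op_coeFn (hm'.op f), hm'.op_coeFn f, hm''.op_coeFn f] with x h1 h2 h3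
  rw [h1, h2, h3, h, smul_smul]

theorem IsMultiplier.op_add {m m' : X → ℂ} (hm : IsMultiplier m) (hm' : IsMultiplier m')
    {m'' : X → ℂ} (hm'' : IsMultiplier m'') (h : ∀ x, m'' x = m x + m' x) (f : Lp K 2 ν) :
    hm''.op f = hm.op f + hm'.op f := by
  refine Lp.ext ?_
  filter_upwards [hm.op_coeFn f, hm'.op_coeFn f, hm''.op_coeFn f,
    Lp.coeFn_add (hm.op f) (hm'.op f)] with x h1 h2 h3 h4
  rw [h4, Pi.add_apply, h1, h2, h3, h, add_smul]

theorem IsMultiplier.op_one {m : X → ℂ} (hm : IsMultiplier m) (h : ∀ x, m x = 1)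
    (f : Lp K 2 ν) : hm.op f = f := by
  refine Lp.ext ?_
  filter_upwards [hm.op_coeFn f] with x h1
  rw [h1, h, one_smul]

theorem IsMultiplier.inner_op {m : X → ℂ} (hm : IsMultiplier m) (f g : Lp K 2 ν) :
    ⟪f, hm.op g⟫_ℂ = ∫ x, m x * ⟪f x, g x⟫_ℂ ∂ν := by
  rw [L2.inner_def]
  refine integral_congr_ae ?_
  filter_upwards [hm.op_coeFn g] with x hx
  rw [hx, inner_smul_right]

theorem IsMultiplier.inner_op_left {m m' : X → ℂ} (hm : IsMultiplier m) (hm' : IsMultiplier m')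
    (h : ∀ x, m' x = conj (m x)) (f g : Lp K 2 ν) : ⟪hm.op f, g⟫_ℂ = ⟪f, hm'.op g⟫_ℂ := by
  rw [hm'.inner_op, L2.inner_def]
  refine integral_congr_ae ?_
  filter_upwards [hm.op_coeFn f] with x hx
  rw [hx, inner_smul_left, h]

variable {n : ℕ}

/-- The distribution of `|f|² ν` under `Λ`. -/
def densityMeasure (Λ : X → Pt n) (f : Lp K 2 ν) : Measure (Pt n) :=
  (ν.withDensity fun x => ‖f x‖ₑ ^ 2).map Λ

instance (Λ : X → Pt n) (f : Lp K 2 ν) : IsFiniteMeasure (densityMeasure Λ f) := by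
  have : IsFiniteMeasure (ν.withDensity fun x => ‖f x‖ₑ ^ 2) := by
    refine isFiniteMeasure_withDensity ?_
    rw [← eLpNorm_two_sq]
    exact ENNReal.pow_ne_top (Lp.eLpNorm_ne_top f)
  exact inferInstanceAs (IsFiniteMeasure (Measure.map _ _))

theorem integral_densityMeasure {Λ : X → Pt n} (hΛ : Measurable Λ) {k : Pt n → ℂ}
    (hk : Measurable k) (hm : IsMultiplier fun x => k (Λ x)) (f : Lp K 2 ν) :
    ∫ y, k y ∂(densityMeasure Λ f) = ⟪f, hm.op f⟫_ℂ := by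
  have hf : AEMeasurable (fun x => ‖f x‖₊ ^ 2) ν :=
    (Lp.aestronglyMeasurable f).nnnorm.aemeasurable.pow_const 2
  have e : (fun x => ‖f x‖ₑ ^ 2) = fun x => ((‖f x‖₊ ^ 2 : NNReal) : ℝ≥0∞) := by
    funext x
    rw [ENNReal.coe_pow]
    rfl
  rw [densityMeasure, integral_map hΛ.aemeasurable hk.aestronglyMeasurable, e,
    integral_withDensity_eq_integral_smul₀ hf, hm.inner_op]
  refine integral_congr_ae (ae_of_all _ fun x => ?_)
  simp only
  rw [inner_self_eq_norm_sq_to_K, NNReal.smul_def, mul_comm, Complex.real_smul]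
  push_cast
  rfl

theorem isMultiplier_indicator {B : Set X} (hB : MeasurableSet B) :
    IsMultiplier (B.indicator fun _ => (1 : ℂ)) := by
  refine ⟨measurable_const.indicator hB, fun x => ?_⟩
  refine (norm_indicator_le_norm_self _ _).trans ?_
  simp

theorem isMultiplier_character {Λ : X → Pt n} (hΛ : Measurable Λ) (p : Pt n) :
    IsMultiplier fun x => Complex.exp (Complex.I * ((p ⬝ᵥ Λ x : ℝ) : ℂ)) :=
  ⟨(measurable_character p).comp hΛ, fun x => norm_character p (Λ x)⟩

/-- Multiplication by the indicator of a preimage. -/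
def cutOp {Λ : X → Pt n} (hΛ : Measurable Λ) {B : Set (Pt n)} (hB : MeasurableSet B) :
    Lp K 2 ν →L[ℂ] Lp K 2 ν := (isMultiplier_indicator (hΛ hB)).op

theorem inner_cutOp {Λ : X → Pt n} (hΛ : Measurable Λ) {B : Set (Pt n)} (hB : MeasurableSet B)
    (f : Lp K 2 ν) : ⟪f, cutOp hΛ hB f⟫_ℂ = ((densityMeasure Λ f).real B : ℂ) := by
  have h := integral_densityMeasure (f := f) hΛ (k := B.indicator fun _ => (1 : ℂ))
    (measurable_const.indicator hB) (isMultiplier_indicator (hΛ hB))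
  rw [integral_indicator_const _ hB] at h
  rw [Complex.real_smul, mul_one] at h
  exact h.symm

theorem cutOp_cutOp {Λ : X → Pt n} (hΛ : Measurable Λ) {B C : Set (Pt n)} (hB : MeasurableSet B)
    (hC : MeasurableSet C) (f : Lp K 2 ν) :
    cutOp hΛ hB (cutOp hΛ hC f) = cutOp hΛ (hB.inter hC) f :=
  IsMultiplier.op_op _ _ _ (fun x => by
    by_cases h1 : Λ x ∈ B <;> by_cases h2 : Λ x ∈ C <;> simp [h1, h2]) f

theorem inner_cutOp_left {Λ : X → Pt n} (hΛ : Measurable Λ) {B : Set (Pt n)}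
    (hB : MeasurableSet B) (f g : Lp K 2 ν) : ⟪cutOp hΛ hB f, g⟫_ℂ = ⟪f, cutOp hΛ hB g⟫_ℂ :=
  IsMultiplier.inner_op_left _ _ (fun x => by
    by_cases h : x ∈ Λ ⁻¹' B <;> simp [h]) f g

theorem norm_cutOp_sq {Λ : X → Pt n} (hΛ : Measurable Λ) {B : Set (Pt n)}
    (hB : MeasurableSet B) (f : Lp K 2 ν) :
    ‖cutOp hΛ hB f‖ ^ 2 = (densityMeasure Λ f).real B := by
  have h : ⟪cutOp hΛ hB f, cutOp hΛ hB f⟫_ℂ = ⟪f, cutOp hΛ hB f⟫_ℂ := by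
    rw [inner_cutOp_left, cutOp_cutOp]
    simp only [Set.inter_self]
  rw [inner_cutOp, inner_self_eq_norm_sq_to_K] at h
  exact Complex.ofReal_injective (by rw [Complex.ofReal_pow]; exact h)

theorem cutOp_union {Λ : X → Pt n} (hΛ : Measurable Λ) {B C : Set (Pt n)} (hB : MeasurableSet B)
    (hC : MeasurableSet C) (hd : Disjoint B C) (f : Lp K 2 ν) :
    cutOp hΛ (hB.union hC) f = cutOp hΛ hB f + cutOp hΛ hC f :=
  IsMultiplier.op_add _ _ _ (fun x => by
    rw [Set.preimage_union, Set.indicator_union_of_disjoint (hd.preimage Λ)]) f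

theorem cutOp_univ {Λ : X → Pt n} (hΛ : Measurable Λ) (f : Lp K 2 ν) :
    cutOp hΛ MeasurableSet.univ f = f := IsMultiplier.op_one _ (fun x => by simp) f

theorem cutOp_congr {Λ : X → Pt n} (hΛ : Measurable Λ) {B C : Set (Pt n)} (hB : MeasurableSet B)
    (hC : MeasurableSet C) (h : B = C) (f : Lp K 2 ν) : cutOp hΛ hB f = cutOp hΛ hC f := by
  subst h
  rfl

theorem cutOp_biUnion {Λ : X → Pt n} (hΛ : Measurable Λ) {B : ℕ → Set (Pt n)}
    (hB : ∀ i, MeasurableSet (B i)) (hd : Pairwise (Function.onFun Disjoint B)) (s : Finset ℕ)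
    (f : Lp K 2 ν) : ∑ i ∈ s, cutOp hΛ (hB i) f
      = cutOp hΛ (s.measurableSet_biUnion fun i _ => hB i) f := by
  classical
  induction s using Finset.induction_on with
  | empty =>
    rw [Finset.sum_empty, eq_comm, ← norm_eq_zero, ← sq_eq_zero_iff, norm_cutOp_sq]
    simp
  | insert i s hi ih =>
    rw [Finset.sum_insert hi, ih, ← cutOp_union hΛ]
    · exact cutOp_congr hΛ _ _ (by simp) f
    · refine Set.disjoint_iUnion₂_right.2 fun j hj => hd ?_
      rintro rfl
      exact hi hj

/-- The remainder of a partial sum is itself a cut-off, and its squared norm is the tail of a finite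
scalar measure. -/
theorem hasSum_cutOp {Λ : X → Pt n} (hΛ : Measurable Λ) {B : ℕ → Set (Pt n)}
    (hB : ∀ i, MeasurableSet (B i)) (hd : Pairwise (Function.onFun Disjoint B))
    (f : Lp K 2 ν) :
    HasSum (fun i => cutOp hΛ (hB i) f) (cutOp hΛ (MeasurableSet.iUnion hB) f) := by
  set ρ := densityMeasure Λ f
  have h1 : HasSum (fun i => ρ.real (B i)) (ρ.real (⋃ i, B i)) := by
    simp only [Measure.real, measure_iUnion hd hB]
    rw [ENNReal.tsum_toReal_eq fun i => measure_ne_top _ _]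
    refine ENNReal.hasSum_toReal ?_
    rw [← measure_iUnion hd hB]
    exact measure_ne_top _ _
  have h2 : ∀ s : Finset ℕ, ‖∑ i ∈ s, cutOp hΛ (hB i) f - cutOp hΛ (MeasurableSet.iUnion hB) f‖ ^ 2
      = ρ.real (⋃ i, B i) - ∑ i ∈ s, ρ.real (B i) := by
    intro s
    have hs := s.measurableSet_biUnion fun i _ => hB i
    have hsub : ⋃ i ∈ s, B i ⊆ ⋃ i, B i := Set.iUnion₂_subset fun i _ => Set.subset_iUnion B i
    have h3 := cutOp_union hΛ hs ((MeasurableSet.iUnion hB).diff hs) Set.disjoint_sdiff_right f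
    rw [cutOp_congr hΛ _ (MeasurableSet.iUnion hB) (Set.union_sdiff_cancel hsub)] at h3
    rw [cutOp_biUnion hΛ hB hd, h3, sub_add_cancel_left, norm_neg, norm_cutOp_sq,
      measureReal_sdiff hsub hs, measureReal_biUnion_finset (fun i _ j _ hij => hd hij)
      (fun i _ => hB i)]
  rw [HasSum, SummationFilter.unconditional_filter, tendsto_iff_norm_sub_tendsto_zero]
  have h4 : Tendsto (fun s : Finset ℕ =>
      ‖∑ i ∈ s, cutOp hΛ (hB i) f - cutOp hΛ (MeasurableSet.iUnion hB) f‖ ^ 2) atTop (𝓝 0) := by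
    simp only [h2]
    have := (tendsto_const_nhds (x := ρ.real (⋃ i, B i))).sub h1
    rwa [sub_self] at this
  have h5 := h4.sqrt
  simpa only [Real.sqrt_sq (norm_nonneg _), Real.sqrt_zero] using h5

end MulOp

/-! ### Spectral resolutions from intertwining isometries -/

section Spectral

open scoped ENNReal ComplexConjugate

variable {n : ℕ} {X K : Type*} [MeasurableSpace X] {ν : Measure X} [NormedAddCommGroup K]
  [InnerProductSpace ℂ K] {Λ : X → Pt n}

/-- Multiplication by a character. -/
def phaseOp (hΛ : Measurable Λ) (p : Pt n) : Lp K 2 ν →L[ℂ] Lp K 2 ν :=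
  (isMultiplier_character hΛ p).op

theorem phaseOp_neg_phaseOp (hΛ : Measurable Λ) (p : Pt n) (f : Lp K 2 ν) :
    phaseOp hΛ (-p) (phaseOp hΛ p f) = f := by
  have h : IsMultiplier fun _ : X => (1 : ℂ) := ⟨measurable_const, fun _ => by simp⟩
  refine (IsMultiplier.op_op _ _ h (fun x => ?_) f).trans (h.op_one (fun _ => rfl) f)
  rw [← Complex.exp_add, ← mul_add, ← Complex.ofReal_add, ← add_dotProduct, neg_add_cancel,
    zero_dotProduct, Complex.ofReal_zero, mul_zero, Complex.exp_zero]

theorem inner_phaseOp_left (hΛ : Measurable Λ) (p : Pt n) (f g : Lp K 2 ν) :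
    ⟪phaseOp hΛ p f, g⟫_ℂ = ⟪f, phaseOp hΛ (-p) g⟫_ℂ :=
  IsMultiplier.inner_op_left _ _ (fun x => by
    rw [← Complex.exp_conj, map_mul, Complex.conj_I, Complex.conj_ofReal, neg_dotProduct,
      Complex.ofReal_neg]
    congr 1
    ring) f g

/-- A symmetric involution that commutes with the characters commutes with the cut-offs. -/
theorem cutOp_comm_of_phaseOp_comm (hΛ : Measurable Λ) {V : Lp K 2 ν →L[ℂ] Lp K 2 ν}
    (hV : ∀ f, V (V f) = f) (hVs : ∀ f g, ⟪V f, g⟫_ℂ = ⟪f, V g⟫_ℂ)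
    (hVp : ∀ p f, V (phaseOp hΛ p f) = phaseOp hΛ p (V f)) {B : Set (Pt n)}
    (hB : MeasurableSet B) (f : Lp K 2 ν) : V (cutOp hΛ hB f) = cutOp hΛ hB (V f) := by
  -- The Fourier transforms of the two densities agree because `V` commutes with characters and
  -- preserves inner products.
  have hm : ∀ f, densityMeasure Λ (V f) = densityMeasure Λ f := fun f => by
    refine measure_ext_of_integral_exp fun p => ?_
    rw [integral_densityMeasure hΛ (measurable_character p) (isMultiplier_character hΛ p),
      integral_densityMeasure hΛ (measurable_character p) (isMultiplier_character hΛ p)]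
    change ⟪V f, phaseOp hΛ p (V f)⟫_ℂ = ⟪f, phaseOp hΛ p f⟫_ℂ
    rw [hVs, hVp, hV]
  have h : V ∘L cutOp hΛ hB ∘L V = cutOp hΛ hB := eq_of_inner_self fun f => by
    rw [ContinuousLinearMap.comp_apply, ContinuousLinearMap.comp_apply, ← hVs, inner_cutOp,
      inner_cutOp, hm]
  have h1 := DFunLike.congr_fun h f
  rw [ContinuousLinearMap.comp_apply, ContinuousLinearMap.comp_apply] at h1
  rw [← h1, hV]

variable [CompleteSpace K] (W : Hilb n →ₗᵢ[ℂ] Lp K 2 ν)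

/-- The adjoint of an isometry. -/
def isomAdjoint : Lp K 2 ν →L[ℂ] Hilb n := ContinuousLinearMap.adjoint W.toContinuousLinearMap

theorem inner_isomAdjoint (f : Lp K 2 ν) (ψ : Hilb n) :
    ⟪isomAdjoint W f, ψ⟫_ℂ = ⟪f, W ψ⟫_ℂ :=
  ContinuousLinearMap.adjoint_inner_left W.toContinuousLinearMap ψ f

theorem inner_isomAdjoint_right (ψ : Hilb n) (f : Lp K 2 ν) :
    ⟪ψ, isomAdjoint W f⟫_ℂ = ⟪W ψ, f⟫_ℂ :=
  ContinuousLinearMap.adjoint_inner_right W.toContinuousLinearMap ψ f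

theorem isomAdjoint_apply (ψ : Hilb n) : isomAdjoint W (W ψ) = ψ :=
  ext_inner_right ℂ fun φ => by rw [inner_isomAdjoint, LinearIsometry.inner_map_map]

variable {W} {U : Pt n → (Hilb n ≃ₗᵢ[ℂ] Hilb n)}

theorem isomAdjoint_phaseOp (hΛ : Measurable Λ)
    (hW : ∀ p ψ, W (U p ψ) = phaseOp hΛ p (W ψ)) (p : Pt n) (f : Lp K 2 ν) :
    isomAdjoint W (phaseOp hΛ p f) = U p (isomAdjoint W f) := by
  refine ext_inner_right ℂ fun ψ => ?_
  have h : phaseOp hΛ (-p) (W ψ) = W ((U p).symm ψ) := by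
    have := hW p ((U p).symm ψ)
    rw [LinearIsometryEquiv.apply_symm_apply] at this
    rw [this, phaseOp_neg_phaseOp]
  rw [inner_isomAdjoint, inner_phaseOp_left, h, ← inner_isomAdjoint,
    LinearIsometryEquiv.inner_map_eq_flip]

/-- The range projection of an intertwining isometry commutes with the cut-offs. -/
theorem rangeProj_cutOp (hΛ : Measurable Λ) (hW : ∀ p ψ, W (U p ψ) = phaseOp hΛ p (W ψ))
    {B : Set (Pt n)} (hB : MeasurableSet B) (f : Lp K 2 ν) :
    W (isomAdjoint W (cutOp hΛ hB f)) = cutOp hΛ hB (W (isomAdjoint W f)) := by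
  let P : Lp K 2 ν →L[ℂ] Lp K 2 ν := W.toContinuousLinearMap ∘L isomAdjoint W
  have hP : ∀ f, P f = W (isomAdjoint W f) := fun _ => rfl
  have hPP : ∀ f, P (P f) = P f := fun f => by
    rw [hP, hP, isomAdjoint_apply]
  have hPs : ∀ f g, ⟪P f, g⟫_ℂ = ⟪f, P g⟫_ℂ := fun f g => by
    rw [hP, hP, ← inner_isomAdjoint_right, inner_isomAdjoint]
  have hPp : ∀ p f, P (phaseOp hΛ p f) = phaseOp hΛ p (P f) := fun p f => by
    rw [hP, hP, isomAdjoint_phaseOp hΛ hW, hW]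
  -- The reflection 2P - 1 is a symmetric involution, unlike P itself. This step makes surjectivity
  -- of `W` unnecessary.
  have hV := cutOp_comm_of_phaseOp_comm hΛ (V := (2 : ℂ) • P - 1) (fun f => by
      simp only [_root_.sub_apply, _root_.smul_apply, one_apply_eq_self, map_sub,
        map_smul, hPP]
      module) (fun f g => by
      simp only [_root_.sub_apply, _root_.smul_apply, one_apply_eq_self,
        inner_sub_left, inner_sub_right, inner_smul_left, inner_smul_right, hPs, map_ofNat]) (fun p f => by
      simp only [_root_.sub_apply, _root_.smul_apply, one_apply_eq_self, map_sub,
        map_smul, hPp]) hB f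
  simp only [_root_.sub_apply, _root_.smul_apply, one_apply_eq_self, map_sub,
    map_smul] at hV
  have h2 : (2 : ℂ) • P (cutOp hΛ hB f) = (2 : ℂ) • cutOp hΛ hB (P f) := sub_left_injective hV
  exact smul_right_injective _ (two_ne_zero (α := ℂ)) h2

open Classical in
/-- The projection-valued measure `B ↦ W⁻¹ 1_B W`. -/
def pvmOfIsometry (hΛ : Measurable Λ) (hW : ∀ p ψ, W (U p ψ) = phaseOp hΛ p (W ψ)) : PVM n where
  proj B := if hB : MeasurableSet B then
    isomAdjoint W ∘L cutOp hΛ hB ∘L W.toContinuousLinearMap else 0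
  selfAdjoint B hB := by
    rw [dif_pos hB]
    refine ContinuousLinearMap.isSelfAdjoint_iff_isSymmetric.2 fun φ ψ => ?_
    change ⟪isomAdjoint W (cutOp hΛ hB (W φ)), ψ⟫_ℂ = ⟪φ, isomAdjoint W (cutOp hΛ hB (W ψ))⟫_ℂ
    rw [inner_isomAdjoint, inner_isomAdjoint_right, inner_cutOp_left]
  univ := by
    rw [dif_pos MeasurableSet.univ]
    ext1 ψ
    change isomAdjoint W (cutOp hΛ MeasurableSet.univ (W ψ)) = ψ
    rw [cutOp_univ, isomAdjoint_apply]
  inter B C hB hC := by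
    rw [dif_pos hB, dif_pos hC, dif_pos (hB.inter hC)]
    ext1 ψ
    change isomAdjoint W (cutOp hΛ (hB.inter hC) (W ψ))
      = isomAdjoint W (cutOp hΛ hB (W (isomAdjoint W (cutOp hΛ hC (W ψ)))))
    rw [rangeProj_cutOp hΛ hW, isomAdjoint_apply, cutOp_cutOp]
  iUnion B hB hd ψ := by
    simp only [dif_pos (hB _), dif_pos (MeasurableSet.iUnion hB)]
    exact (hasSum_cutOp hΛ hB hd (W ψ)).mapL (isomAdjoint W)

/-- The spectral measure of ψ is the distribution of |Wψ|² under `Λ`, whose Fourier transform is a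
matrix element of the multiplication by a character. -/
theorem isSpectralResolution_pvmOfIsometry (hΛ : Measurable Λ)
    (hW : ∀ p ψ, W (U p ψ) = phaseOp hΛ p (W ψ)) :
    IsSpectralResolution U (pvmOfIsometry hΛ hW) := by
  intro p ψ
  have hm : (pvmOfIsometry hΛ hW).measure ψ = densityMeasure Λ (W ψ) := by
    refine Measure.ext fun B hB => ?_
    rw [← measureReal_eq_measureReal_iff]
    have h := (pvmOfIsometry hΛ hW).inner_proj_self hB ψ
    have h2 : (pvmOfIsometry hΛ hW).proj B ψ = isomAdjoint W (cutOp hΛ hB (W ψ)) := by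
      simp only [pvmOfIsometry, dif_pos hB]
      rfl
    rw [h2, inner_isomAdjoint_right, inner_cutOp] at h
    exact_mod_cast h.symm
  rw [hm, integral_densityMeasure hΛ (measurable_character p) (isMultiplier_character hΛ p)]
  change _ = ⟪W ψ, phaseOp hΛ p (W ψ)⟫_ℂ
  rw [← hW, LinearIsometry.inner_map_map]

end Spectral

/-! ### Logarithmic coordinates and the Fourier transform -/

section Logarithmic

open scoped ENNReal ComplexConjugate FourierTransform

variable {n : ℕ}

/-- Frequency space. -/
abbrev Eu (n : ℕ) : Type := EuclideanSpace ℝ (Fin (n + 1))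

/-- One component for each orthant. -/
abbrev Comp (n : ℕ) : Type := EuclideanSpace ℂ (Fin (n + 1) → Bool)

/-- The sign `±1`. -/
def signVal (b : Bool) : ℝ := if b then 1 else -1

theorem signVal_ne_zero (b : Bool) : signVal b ≠ 0 := by cases b <;> norm_num [signVal]

theorem abs_signVal (b : Bool) : |signVal b| = 1 := by cases b <;> norm_num [signVal]

/-- Exponential coordinates of an orthant. -/
def expPt (σ : Fin (n + 1) → Bool) (s : Pt n) : Pt n := fun i => signVal (σ i) * Real.exp (s i)

theorem continuous_expPt (σ : Fin (n + 1) → Bool) : Continuous (expPt (n := n) σ) := by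
  unfold expPt
  fun_prop

theorem expPt_injective (σ : Fin (n + 1) → Bool) : Function.Injective (expPt (n := n) σ) := by
  intro s t h
  funext i
  exact Real.exp_injective (mul_left_cancel₀ (signVal_ne_zero (σ i)) (congrFun h i))

theorem range_expPt (σ : Fin (n + 1) → Bool) :
    expPt σ '' Set.univ = {x : Pt n | ∀ i, 0 < signVal (σ i) * x i} := by
  have hs : ∀ b, signVal b * signVal b = 1 := fun b => by cases b <;> norm_num [signVal]
  ext x
  rw [Set.image_univ]
  constructor
  · rintro ⟨s, rfl⟩ i
    rw [expPt, ← mul_assoc, hs, one_mul]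
    exact Real.exp_pos _
  · intro h
    refine ⟨fun i => Real.log (signVal (σ i) * x i), funext fun i => ?_⟩
    rw [expPt, Real.exp_log (h i), ← mul_assoc, hs, one_mul]

theorem hasFDerivAt_expPt (σ : Fin (n + 1) → Bool) (s : Pt n) :
    HasFDerivAt (expPt σ)
      (LinearMap.toContinuousLinearMap (Matrix.toLin' (Matrix.diagonal (expPt σ s)))) s := by
  rw [hasFDerivAt_pi']
  intro i
  have h1 : HasFDerivAt (fun t : Pt n => t i)
      (ContinuousLinearMap.proj (R := ℝ) (φ := fun _ : Fin (n + 1) => ℝ) i) s :=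
    (ContinuousLinearMap.proj (R := ℝ) (φ := fun _ : Fin (n + 1) => ℝ) i).hasFDerivAt
  have h2 := (h1.exp).const_mul (signVal (σ i))
  refine h2.congr_fderiv ?_
  ext t
  simp [Matrix.toLin'_apply, Matrix.mulVec_diagonal, expPt, mul_assoc]

theorem det_expPt (σ : Fin (n + 1) → Bool) (s : Pt n) :
    |(LinearMap.toContinuousLinearMap (Matrix.toLin' (Matrix.diagonal (expPt σ s)))).det|
      = Real.exp (∑ i, s i) := by
  have h : (LinearMap.toContinuousLinearMap (Matrix.toLin' (Matrix.diagonal (expPt σ s)))).det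
      = (Matrix.diagonal (expPt σ s)).det := LinearMap.det_toLin' _
  rw [h, Matrix.det_diagonal, Finset.abs_prod, Real.exp_sum]
  refine Finset.prod_congr rfl fun i _ => ?_
  rw [expPt, abs_mul, abs_signVal, one_mul, Real.abs_exp]

/-- Change of variables to exponential coordinates in all orthants. -/
theorem sum_lintegral_expPt (f : Pt n → ℝ≥0∞) :
    ∑ σ : Fin (n + 1) → Bool, ∫⁻ s : Pt n, ENNReal.ofReal (Real.exp (∑ i, s i)) * f (expPt σ s)
      = ∫⁻ x, f x := by
  have h1 : ∀ σ : Fin (n + 1) → Bool,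
      ∫⁻ s : Pt n, ENNReal.ofReal (Real.exp (∑ i, s i)) * f (expPt σ s)
        = ∫⁻ x in {x : Pt n | ∀ i, 0 < signVal (σ i) * x i}, f x := fun σ => by
    rw [← range_expPt, lintegral_image_eq_lintegral_abs_det_fderiv_mul volume MeasurableSet.univ
      (fun s _ => (hasFDerivAt_expPt σ s).hasFDerivWithinAt) (expPt_injective σ).injOn]
    simp only [det_expPt, Measure.restrict_univ]
  have hm : ∀ σ : Fin (n + 1) → Bool,
      MeasurableSet {x : Pt n | ∀ i, 0 < signVal (σ i) * x i} := fun σ => by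
    rw [Set.ofPred_forall]
    exact MeasurableSet.iInter fun i => measurableSet_lt measurable_const (by fun_prop)
  have hd : Pairwise (Function.onFun Disjoint
      fun σ : Fin (n + 1) → Bool => {x : Pt n | ∀ i, 0 < signVal (σ i) * x i}) := by
    intro σ τ hne
    refine Set.disjoint_left.2 fun x hx hy => hne (funext fun i => ?_)
    by_contra hστ
    have h2 := hx i
    have h3 := hy i
    have h4 : signVal (τ i) = -signVal (σ i) := by
      revert hστ
      cases σ i <;> cases τ i <;> simp [signVal]
    rw [h4] at h3
    linarith
  have hU : (⋃ σ : Fin (n + 1) → Bool, {x : Pt n | ∀ i, 0 < signVal (σ i) * x i})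
      =ᵐ[volume] Set.univ := by
    rw [ae_eq_univ]
    -- Off the coordinate hyperplanes every point lies in the orthant of its signs.
    refine measure_mono_null (t := ⋃ i, {x : Pt n | x i = 0}) (fun x hx => ?_)
      (measure_iUnion_null fun i => ?_)
    · by_contra hx0
      simp only [Set.mem_iUnion, not_exists] at hx0
      refine hx (Set.mem_iUnion.2 ⟨fun i => decide (0 < x i), fun i => ?_⟩)
      have h0 : x i ≠ 0 := hx0 i
      by_cases h : 0 < x i
      · simp [signVal, h]
      · simpa [signVal, h] using lt_of_le_of_ne (not_lt.1 h) h0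
    · rw [volume_pi]
      exact Measure.pi_hyperplane _ i 0
  simp only [h1]
  have h2 := lintegral_iUnion (μ := volume) hm hd f
  rw [tsum_fintype, setLIntegral_congr hU, Measure.restrict_univ] at h2
  exact h2.symm

/-- A Schwartz function in exponential coordinates. -/
def logFun (Φ : Sch n) (s : Eu n) : Comp n :=
  WithLp.toLp 2 fun σ => (Real.exp ((∑ i, s i) / 2) : ℂ) * Φ (expPt σ s.ofLp)

theorem continuous_logFun (Φ : Sch n) : Continuous (logFun Φ) := by
  refine (PiLp.continuous_toLp 2 _).comp (continuous_pi fun σ => ?_)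
  refine Continuous.mul ?_ (Φ.continuous.comp ((continuous_expPt σ).comp
    (PiLp.continuous_ofLp 2 _)))
  fun_prop

/-- The half-density factor in `logFun` squares to the Jacobian of the exponential coordinates. -/
theorem lintegral_logFun (Φ : Sch n) : ∫⁻ s, ‖logFun Φ s‖ₑ ^ 2 = ∫⁻ x, ‖Φ x‖ₑ ^ 2 := by
  have h1 : ∀ s : Eu n, ‖logFun Φ s‖ₑ ^ 2 = ∑ σ : Fin (n + 1) → Bool,
      ENNReal.ofReal (Real.exp (∑ i, s.ofLp i)) * ‖Φ (expPt σ s.ofLp)‖ₑ ^ 2 := fun s => by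
    rw [← ofReal_norm, ← ENNReal.ofReal_pow (norm_nonneg _), EuclideanSpace.norm_sq_eq,
      ENNReal.ofReal_sum_of_nonneg fun σ _ => sq_nonneg _]
    refine Finset.sum_congr rfl fun σ _ => ?_
    rw [logFun, norm_mul, mul_pow, ENNReal.ofReal_mul (sq_nonneg _), Complex.norm_real,
      Real.norm_eq_abs, Real.abs_exp, ← Real.exp_nat_mul, ENNReal.ofReal_pow (norm_nonneg _),
      ofReal_norm]
    congr 3
    push_cast
    ring
  simp only [h1]
  have h2 := (PiLp.volume_preserving_ofLp (Fin (n + 1))).lintegral_comp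
    (f := fun s : Pt n => ∑ σ : Fin (n + 1) → Bool,
      ENNReal.ofReal (Real.exp (∑ i, s i)) * ‖Φ (expPt σ s)‖ₑ ^ 2) ?_
  · rw [h2, lintegral_finsetSum, sum_lintegral_expPt fun x => ‖Φ x‖ₑ ^ 2]
    intro σ _
    have := (Φ.continuous.comp (continuous_expPt σ)).measurable.enorm.pow_const 2
    exact Measurable.mul (by fun_prop) this
  · refine Finset.measurable_sum _ fun σ _ => ?_
    have := (Φ.continuous.comp (continuous_expPt σ)).measurable.enorm.pow_const 2
    exact Measurable.mul (by fun_prop) this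

theorem memLp_logFun (Φ : Sch n) : MemLp (logFun Φ) 2 volume := by
  refine ⟨(continuous_logFun Φ).aestronglyMeasurable, ?_⟩
  have h : eLpNorm (logFun Φ) 2 volume ^ 2 = ‖toHilb Φ‖ₑ ^ 2 := by
    rw [eLpNorm_two_sq, lintegral_logFun, enorm_toHilb_sq]
  rw [enorm_eq_of_sq h]
  exact enorm_lt_top

/-- Exponential coordinates as a linear map into `L²`. -/
def logLin (n : ℕ) : Sch n →ₗ[ℂ] Lp (Comp n) 2 (volume : Measure (Eu n)) where
  toFun Φ := (memLp_logFun Φ).toLp _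
  map_add' Φ Ψ := by
    rw [← MemLp.toLp_add]
    refine MemLp.toLp_congr _ _ (ae_of_all _ fun s => ?_)
    ext σ
    exact mul_add _ _ _
  map_smul' c Φ := by
    rw [RingHom.id_apply, ← MemLp.toLp_const_smul]
    refine MemLp.toLp_congr _ _ (ae_of_all _ fun s => ?_)
    ext σ
    exact mul_left_comm _ _ _

theorem norm_logLin (Φ : Sch n) : ‖logLin n Φ‖ = ‖toHilb Φ‖ := by
  have h : ‖logLin n Φ‖ₑ = ‖toHilb Φ‖ₑ := by
    refine enorm_eq_of_sq ?_
    have h1 : ‖logLin n Φ‖ₑ = eLpNorm (logFun Φ) 2 volume := Lp.enorm_toLp (memLp_logFun Φ)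
    rw [h1, eLpNorm_two_sq, lintegral_logFun, enorm_toHilb_sq]
  rw [← toReal_enorm, h, toReal_enorm]

/-- Exponential coordinates as an isometry. -/
def logIsom (n : ℕ) : Hilb n →ₗᵢ[ℂ] Lp (Comp n) 2 (volume : Measure (Eu n)) where
  toLinearMap := ((logLin n).extendOfNorm (toHilb (n := n)).toLinearMap).toLinearMap
  norm_map' ψ := by
    refine denseRange_toHilb.induction_on (p := fun ψ =>
      ‖(logLin n).extendOfNorm (toHilb (n := n)).toLinearMap ψ‖ = ‖ψ‖) ψ
      (isClosed_eq (by fun_prop) continuous_norm) fun Φ => ?_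
    have := LinearMap.extendOfNorm_eq (f := logLin n) (e := (toHilb (n := n)).toLinearMap)
      denseRange_toHilb ⟨1, fun Φ => by simp [norm_logLin]⟩ Φ
    exact (congrArg norm this).trans (norm_logLin Φ)

theorem logIsom_toHilb (Φ : Sch n) : logIsom n (toHilb Φ) = logLin n Φ :=
  LinearMap.extendOfNorm_eq (f := logLin n) (e := (toHilb (n := n)).toLinearMap)
    denseRange_toHilb ⟨1, fun Φ => by simp [norm_logLin]⟩ Φ

/-- Translations of `L²`. -/
def transIsom (v : Eu n) : Lp (Comp n) 2 (volume : Measure (Eu n)) →ₗᵢ[ℂ]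
    Lp (Comp n) 2 (volume : Measure (Eu n)) :=
  Lp.compMeasurePreservingₗᵢ ℂ (fun s => s + v) (measurePreserving_add_right volume v)

/-- In exponential coordinates a dilation is a translation by (a_i p_i), and the half-density
absorbs the prefactor exp(a·p/2). Scale factors are positive, so orthants are not mixed. -/
theorem logFun_dilSch (a p : Pt n) (Φ : Sch n) (s : Eu n) :
    logFun (dilSch a p Φ) s = logFun Φ (s + WithLp.toLp 2 fun i => a i * p i) := by
  ext σ
  simp only [logFun, dilSch_apply]
  have h1 : dilate a p (expPt σ s.ofLp)
      = expPt σ (s + WithLp.toLp 2 fun i => a i * p i : Eu n).ofLp := by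
    ext i
    rw [dilate_apply, expPt, expPt, WithLp.ofLp_add, Pi.add_apply, Real.exp_add]
    ring
  have h2 : (∑ i, (s + WithLp.toLp 2 fun i => a i * p i : Eu n) i) / 2
      = (∑ i, s i) / 2 + a ⬝ᵥ p / 2 := by
    simp only [PiLp.add_apply, Finset.sum_add_distrib, dotProduct]
    ring
  rw [h1, h2, Real.exp_add, Complex.ofReal_mul, mul_assoc]

theorem logLin_dilSch (a p : Pt n) (Φ : Sch n) :
    logLin n (dilSch a p Φ) = transIsom (WithLp.toLp 2 fun i => a i * p i) (logLin n Φ) := by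
  have h : transIsom (WithLp.toLp 2 fun i => a i * p i) (logLin n Φ)
      = ((memLp_logFun Φ).comp_measurePreserving (measurePreserving_add_right volume
        (WithLp.toLp 2 fun i => a i * p i : Eu n))).toLp _ := rfl
  rw [h]
  exact MemLp.toLp_congr (memLp_logFun (dilSch a p Φ)) _
    (ae_of_all _ fun s => logFun_dilSch a p Φ s)

/-- The spectral coordinates in frequency space. -/
def freqCoord (a : Pt n) (ξ : Eu n) : Pt n := fun i => 2 * Real.pi * a i * ξ i

theorem measurable_freqCoord (a : Pt n) : Measurable (freqCoord a) := by
  refine Continuous.measurable (continuous_pi fun i => ?_)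
  unfold freqCoord
  fun_prop

theorem fourier_shift (v : Eu n) (f : 𝓢(Eu n, Comp n)) (ξ : Eu n) :
    𝓕 (f.compSubConstCLM ℂ (-v)) ξ
      = Complex.exp (Complex.I * ((2 * Real.pi * ⟪v, ξ⟫_ℝ : ℝ) : ℂ)) • 𝓕 f ξ := by
  have h := congrFun (VectorFourier.fourierIntegral_comp_add_right Real.fourierChar
    (volume : Measure (Eu n)) (innerₗ (Eu n)) f v) ξ
  have h1 : (⇑(f.compSubConstCLM ℂ (-v)) : Eu n → Comp n) = f ∘ fun s => s + v := by
    funext s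
    rw [SchwartzMap.compSubConstCLM_apply, sub_neg_eq_add]
    rfl
  rw [SchwartzMap.fourier_coe, SchwartzMap.fourier_coe, h1]
  refine h.trans ?_
  rw [Circle.smul_def, Real.fourierChar_apply, innerₗ_apply_apply, mul_comm _ Complex.I]
  rfl

/-- The factor 2πa_i in `freqCoord` turns the Fourier phase of the translation by (a_i p_i) into the
character of p. It is checked on Schwartz functions and extended by density. -/
theorem fourier_transIsom (a p : Pt n) (f : Lp (Comp n) 2 (volume : Measure (Eu n))) :
    Lp.fourierTransformₗᵢ (Eu n) (Comp n) (transIsom (WithLp.toLp 2 fun i => a i * p i) f)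
      = phaseOp (measurable_freqCoord a) p (Lp.fourierTransformₗᵢ (Eu n) (Comp n) f) := by
  have hd := SchwartzMap.denseRange_toLpCLM (E := Eu n) (F := Comp n) (p := 2)
    (μ := volume) ENNReal.ofNat_ne_top
  refine hd.induction_on f (isClosed_eq (by fun_prop) (by fun_prop)) fun f => ?_
  have h1 : transIsom (WithLp.toLp 2 fun i => a i * p i) (f.toLp 2 volume)
      = (f.compSubConstCLM ℂ (-(WithLp.toLp 2 fun i => a i * p i : Eu n))).toLp 2 volume := by
    refine MemLp.toLp_congr ((f.memLp 2 volume).comp_measurePreserving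
      (measurePreserving_add_right volume _)) (SchwartzMap.memLp _ 2 volume)
      (ae_of_all _ fun s => ?_)
    rw [SchwartzMap.compSubConstCLM_apply, sub_neg_eq_add]
    rfl
  have hF : ∀ g : 𝓢(Eu n, Comp n), Lp.fourierTransformₗᵢ (Eu n) (Comp n) (g.toLp 2 volume)
      = (𝓕 g).toLp 2 volume := fun g => SchwartzMap.toLp_fourier_eq g
  change Lp.fourierTransformₗᵢ (Eu n) (Comp n) (transIsom _ (f.toLp 2 volume))
    = phaseOp _ p (Lp.fourierTransformₗᵢ (Eu n) (Comp n) (f.toLp 2 volume))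
  rw [h1, hF, hF]
  refine Lp.ext ?_
  filter_upwards [SchwartzMap.coeFn_toLp (𝓕 (f.compSubConstCLM ℂ
      (-(WithLp.toLp 2 fun i => a i * p i : Eu n)))) 2 volume,
    (isMultiplier_character (measurable_freqCoord a) p).op_coeFn ((𝓕 f).toLp 2 volume),
    SchwartzMap.coeFn_toLp (𝓕 f) 2 volume] with ξ h2 h3 h4
  rw [h2, phaseOp, h3, h4, fourier_shift]
  congr 4
  simp only [freqCoord, dotProduct, PiLp.inner_apply, Finset.mul_sum]
  refine Finset.sum_congr rfl fun i _ => ?_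
  simp only [RCLike.inner_apply, conj_trivial]
  ring

/-- The isometry that diagonalizes the dilation group. -/
def diagIsom (n : ℕ) : Hilb n →ₗᵢ[ℂ] Lp (Comp n) 2 (volume : Measure (Eu n)) :=
  (Lp.fourierTransformₗᵢ (Eu n) (Comp n)).toLinearIsometry.comp (logIsom n)

theorem diagIsom_dilUnitary (a p : Pt n) (ψ : Hilb n) :
    diagIsom n (dilUnitary a p ψ) = phaseOp (measurable_freqCoord a) p (diagIsom n ψ) := by
  refine denseRange_toHilb.induction_on ψ (isClosed_eq (by fun_prop) (by fun_prop)) fun Φ => ?_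
  rw [dilUnitary_toHilb]
  change Lp.fourierTransformₗᵢ (Eu n) (Comp n) (logIsom n (toHilb (dilSch a p Φ)))
    = phaseOp _ p (Lp.fourierTransformₗᵢ (Eu n) (Comp n) (logIsom n (toHilb Φ)))
  rw [logIsom_toHilb, logIsom_toHilb, logLin_dilSch, fourier_transIsom]

theorem exists_expGroup_spectralResolution (a : Pt n) :
    ∃ (U : Pt n → (Hilb n ≃ₗᵢ[ℂ] Hilb n)) (E : PVM n),
      IsExpGroup (coordOp a) U ∧ IsSpectralResolution U E :=
  ⟨dilUnitary a, pvmOfIsometry (measurable_freqCoord a) (diagIsom_dilUnitary a),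
    isExpGroup_dilUnitary a, isSpectralResolution_pvmOfIsometry _ _⟩

end Logarithmic

end WarpedMetric

end

/-! ### The main theorem -/

open WarpedMetric in
theorem mainTheorem1 (n : ℕ) (a q : Pt n) (ha : ∀ μ, a μ ≠ 0) (hq : q ≠ 0)
    (Θ : Matrix (Fin (n + 1)) (Fin (n + 1)) ℝ) (hΘ : Θᵀ = -Θ) :
    -- the unitary group `exp(i p_μ X^μ)` and its spectral resolution exist
    (∃ (U : Pt n → (Hilb n ≃ₗᵢ[ℂ] Hilb n)) (E : PVM n),
      IsExpGroup (coordOp a) U ∧ IsSpectralResolution U E) ∧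
    ∀ (U : Pt n → (Hilb n ≃ₗᵢ[ℂ] Hilb n)) (E : PVM n),
      IsExpGroup (coordOp a) U → IsSpectralResolution U E →
      -- the curved line-element is densely defined
      Dense {ψ : Hilb n | ∃ Φ v, toHilb Φ = ψ ∧
        HasLineElement a q E (deformedMetric a Θ) Φ v} ∧
      -- the deformed and the curved line-element are the same operator
      (∀ Φ v, HasDeformedLineElement a q (HasWarped U E Θ) Φ v ↔
        HasLineElement a q E (deformedMetric a Θ) Φ v) ∧
      (∀ Φ v, HasDeformedLineElement a q (HasOscWarped U Θ) Φ v ↔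
        HasLineElement a q E (deformedMetric a Θ) Φ v) ∧
      -- the same when the flat line-element is deformed as one operator
      (∀ Φ v, HasLineElement a q E (deformedMetric a Θ) Φ v →
        HasWarped U E Θ (rep a q (lineElement a)) Φ v ∧
        HasOscWarped U Θ (rep a q (lineElement a)) Φ v) ∧
      -- on all of the Schwartz space, in the sense of matrix elements
      (∀ (Φ : Sch n) (Ψ : Hilb n) (w : Fin (n + 1) → Fin (n + 1) → Hilb n),
        (∀ μ ν, E.HasApply (fun x => (deformedMetric a Θ x μ ν : ℂ)) Ψ (w μ ν)) →
        HasOscWarpedElement U Θ (rep a q (lineElement a)) Ψ Φ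
          (∑ μ, ∑ ν, inner ℂ (w μ ν)
            (toHilb (rep a q (dx a μ) (rep a q (dx a ν) Φ))))) ∧
      -- the metric can be read off from the represented line-element
      ((∀ μ, q μ ≠ 0) → ∀ g : Pt n → Matrix (Fin (n + 1)) (Fin (n + 1)) ℝ,
        Continuous g → (∀ x, (g x).IsSymm) →
        (∀ Φ v, HasLineElement a q E g Φ v ↔
          HasLineElement a q E (deformedMetric a Θ) Φ v) →
        g = deformedMetric a Θ) := by
  refine ⟨exists_expGroup_spectralResolution a, fun U E hU hE => ⟨dense_lineElement_domain hU hE Θ, fun Φ v => ?_,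
    fun Φ v => ?_, fun Φ v hv => ⟨hasWarped_lineElement hU hv, hasOscWarped_lineElement hU hE hΘ hv⟩,
    fun Φ Ψ w hw => hasOscWarpedElement_lineElement hU hE hΘ Φ Ψ w hw,
    fun hq' g hg hs heq => metric_unique ha hq' hU hE Θ hg hs heq⟩⟩
  · exact hasDeformedLineElement_iff (fun μ v => hasWarped_diffSq_iff hU E Θ μ Φ v) v
  · exact hasDeformedLineElement_iff (fun μ v => hasOscWarped_diffSq_iff hU hE hΘ μ Φ v) v
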